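/- Let $X$ be a compact complex manifold of dimension $n$. For a holomorphic line bundle $F$ over $X$, with dual bundle $F^*$, let $\overline{F^*}$ denote the complex conjugate manifold of the total space of $F^*$. A Hermitian algebraic function on $F$ is a holomorphic function $Q:F^*\times\overline{F^*}\to\mathbb C$ such that $Q(v,\overline w)=\overline{Q(w,\overline v)}$ and $Q(\lambda v,\overline w)=\lambda Q(v,\overline w)$ for all $v,w\in F^*$ and $\lambda\in\mathbb C$; equivalently, $Q$ is a holomorphic section $Q(x,\overline y)\in F_x\otimes\overline{F_y}$ over $X\times\overline X$ with $Q(x,\overline y)=\overline{Q(y,\overline x)}$. It is positive if $Q(v,\overline v)>0$ for all $v\neq 0$; then $h_Q(v,w)=Q(v,\overline w)$ ($v,w\in F^*_x$) is a Hermitian metric on $F^*$, with curvature form $\Theta_{h_Q}=-\sqrt{-1}\,\partial\overline\partial\log h_Q(\xi,\xi)$ for any local non-vanishing holomorphic section $\xi$ of $F^*$. A positive $Q$ satisfies the strong global Cauchy–Schwarz condition if $|Q(v,\overline w)|^2<Q(v,\overline v)\,Q(w,\overline w)$ for all non-zero $v\in F^*_x$, $w\in F^*_y$ with $x\neq y$,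 and $\Theta_{h_Q}$ is negative definite on $X$. **Theorem 1.1.** Let $L$ and $E$ be holomorphic line bundles over a compact complex manifold $X$ of dimension $n$. Let $R$ and $P$ be positive Hermitian algebraic functions on $L$ and $E$ respectively, such that $R$ satisfies the strong global Cauchy–Schwarz condition. Let $\Omega=\omega^n/n!$ be the volume form on $X$ induced by $R$, where $\omega=\frac{\sqrt{-1}}{2}\,\partial\overline\partial\log h_R(\xi,\xi)$ for local non-vanishing holomorphic sections $\xi$ of $L^*$; that is, in local coordinates $\Omega=\det\left(\frac{\partial^2\log h_R(\xi,\xi)}{\partial z_i\,\partial\overline{z_j}}\right)dV$ with $dV$ the Lebesgue measure of $\mathbb C^n$. For an integer $m\geq 1$ and $s,t\in H^0(X,L^m\otimes E)$ put $$\|s\|^2=\int_X\frac{s(x)\overline{s(x)}}{R^m(x,\overline x)P(x,\overline x)}\,\Omega(x),$$ $$\mathbf K_{R^mP,\Omega}(s,t)=\iint_{X\times X}\frac{R^m(x,\overline y)P(x,\overline y)\,s(y)\overline{t(x)}}{R^m(x,\overline x)P(x,\overline x)\,R^m(y,\overline y)P(y,\overline y)}\,\Omega(x)\,\Omega(y).$$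 Then there exists a constant $C>0$ such that for all integers $m\geq 1$ and all $s\in H^0(X,L^m\otimes E)$, $$\left|\mathbf K_{R^mP,\Omega}(s,s)-\frac{\pi^n}{m^n}\|s\|^2\right|\leq\frac{C}{m^{n+1}}\|s\|^2.$$ -/

import Mathlib

open Bundle MeasureTheory
open scoped Manifold ContDiff TensorProduct ComplexOrder

noncomputable section

/-! ### Wirtinger derivatives on `ℂⁿ` -/

/-- `∂f/∂zᵢ = ½ (∂f/∂xᵢ - √-1 ∂f/∂yᵢ)`, where `zᵢ = xᵢ + √-1 yᵢ`. -/
def wirtinger {n : ℕ} (i : Fin n) (f : (Fin n → ℂ) → ℂ) (z : Fin n → ℂ) : ℂ :=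
  (1 / 2 : ℂ) *
    (fderiv ℝ f z (Pi.single i 1) - Complex.I * fderiv ℝ f z (Pi.single i Complex.I))

/-- `∂f/∂z̄ᵢ = ½ (∂f/∂xᵢ + √-1 ∂f/∂yᵢ)`. -/
def wirtingerBar {n : ℕ} (i : Fin n) (f : (Fin n → ℂ) → ℂ) (z : Fin n → ℂ) : ℂ :=
  (1 / 2 : ℂ) *
    (fderiv ℝ f z (Pi.single i 1) + Complex.I * fderiv ℝ f z (Pi.single i Complex.I))

/-! ### Local frames of the dual bundle -/

section DualFrame

variable {X : Type*} [TopologicalSpace X] (F : X → Type*)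
  [∀ x, AddCommGroup (F x)] [∀ x, Module ℂ (F x)] [∀ x, TopologicalSpace (F x)]
  [TopologicalSpace (TotalSpace ℂ F)] [FiberBundle ℂ F] [VectorBundle ℂ ℂ F]

/-- The local frame of `F*` near `x₀` given by the preferred local trivialization of the line
bundle `F` at `x₀`: over its base set, `dualFrame F x₀ x : F x → ℂ` is the (bijective) restriction
of the trivialization to the fibre. Outside the base set it is `0`. -/
def dualFrame (x₀ x : X) : F x →L[ℂ] ℂ :=
  (trivializationAt ℂ F x₀).continuousLinearMapAt ℂ x

end DualFrame

/-! ### Hermitian algebraic functions -/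

/-- A Hermitian algebraic function on a holomorphic line bundle `F` over a complex manifold `X` of
dimension `n`. `toFun v w` is `Q(v, w̄)` for `v ∈ F*_x`, `w ∈ F*_y`. -/
structure HermitianAlgebraicFunction (n : ℕ) {X : Type*} [TopologicalSpace X]
    [ChartedSpace (Fin n → ℂ) X] (F : X → Type*)
    [∀ x, AddCommGroup (F x)] [∀ x, Module ℂ (F x)] [∀ x, TopologicalSpace (F x)]
    [TopologicalSpace (TotalSpace ℂ F)] [FiberBundle ℂ F] [VectorBundle ℂ ℂ F] where
  toFun : ∀ {x y : X}, (F x →L[ℂ] ℂ) → (F y →L[ℂ] ℂ) → ℂ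
  conj_symm : ∀ {x y : X} (v : F x →L[ℂ] ℂ) (w : F y →L[ℂ] ℂ),
    toFun v w = (starRingEnd ℂ) (toFun w v)
  smul_left : ∀ {x y : X} (c : ℂ) (v : F x →L[ℂ] ℂ) (w : F y →L[ℂ] ℂ),
    toFun (c • v) w = c * toFun v w
  /-- `Q` is holomorphic on `F* × conj F*`. Near `(x₀, y₀)` the points of `F* × conj F*` are
  `(a • ξ_x, b • ξ_y)` for the local frames `ξ` of `F*`, so by homogeneity this says that the
  coefficient `Q(ξ_x, conj ξ_y)` is holomorphic on `X × conj X`. A chart of the conjugate manifold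
  `conj X` is the complex conjugate of a chart of `X`. -/
  holomorphic : ∀ x₀ y₀ : X,
    AnalyticAt ℂ
      (fun p : (Fin n → ℂ) × (Fin n → ℂ) =>
        toFun (dualFrame F x₀ ((chartAt (Fin n → ℂ) x₀).symm p.1))
          (dualFrame F y₀ ((chartAt (Fin n → ℂ) y₀).symm (star p.2))))
      (chartAt (Fin n → ℂ) x₀ x₀, star (chartAt (Fin n → ℂ) y₀ y₀))

namespace HermitianAlgebraicFunction

variable {n : ℕ} {X : Type*} [TopologicalSpace X] [ChartedSpace (Fin n → ℂ) X] {F : X → Type*}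
  [∀ x, AddCommGroup (F x)] [∀ x, Module ℂ (F x)] [∀ x, TopologicalSpace (F x)]
  [TopologicalSpace (TotalSpace ℂ F)] [FiberBundle ℂ F] [VectorBundle ℂ ℂ F]

/-- The induced form `h_Q(v, v) = Q(v, v̄)`, a real number by Hermitian symmetry. -/
def normSq (Q : HermitianAlgebraicFunction n F) {x : X} (v : F x →L[ℂ] ℂ) : ℝ :=
  (Q.toFun v v).re

def IsPositive (Q : HermitianAlgebraicFunction n F) : Prop :=
  ∀ (x : X) (v : F x →L[ℂ] ℂ), v ≠ 0 → 0 < Q.normSq v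

/-- `log h_Q(ξ, ξ)` in the chart at `x₀`, for the local frame `ξ` of `F*` near `x₀`. -/
def logWeight (Q : HermitianAlgebraicFunction n F) (x₀ : X) (z : Fin n → ℂ) : ℂ :=
  (Real.log (Q.normSq (dualFrame F x₀ ((chartAt (Fin n → ℂ) x₀).symm z))) : ℂ)

/-- The coefficient matrix `Θᵢⱼ = - ∂² log h_Q(ξ, ξ) / ∂zᵢ ∂z̄ⱼ`, in the chart at `x₀`, of the
curvature form `Θ = - √-1 ∂∂̄ log h_Q(ξ, ξ) = √-1 ∑ Θᵢⱼ dzᵢ ∧ dz̄ⱼ`. -/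
def curvature (Q : HermitianAlgebraicFunction n F) (x₀ : X) (z : Fin n → ℂ) :
    Matrix (Fin n) (Fin n) ℂ :=
  Matrix.of fun i j => -wirtinger i (wirtingerBar j (Q.logWeight x₀)) z

/-- The strong global Cauchy–Schwarz condition. The second field says that the curvature form is
negative definite at every point. -/
structure SGCS (Q : HermitianAlgebraicFunction n F) : Prop where
  cauchySchwarz : ∀ (x y : X), x ≠ y → ∀ (v : F x →L[ℂ] ℂ) (w : F y →L[ℂ] ℂ), v ≠ 0 → w ≠ 0 →
    ‖Q.toFun v w‖ ^ 2 < Q.normSq v * Q.normSq w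
  curvature_neg : ∀ x₀ : X, (-Q.curvature x₀ (chartAt (Fin n → ℂ) x₀ x₀)).PosDef

variable [MeasurableSpace X]

/-- The part of the chart at `x₀` over which the frame of `F*` at `x₀` is defined. -/
def chartDomain (n : ℕ) {X : Type*} [TopologicalSpace X] [ChartedSpace (Fin n → ℂ) X]
    (F : X → Type*) [∀ x, TopologicalSpace (F x)]
    [TopologicalSpace (TotalSpace ℂ F)] [FiberBundle ℂ F] (x₀ : X) : Set (Fin n → ℂ) :=
  (chartAt (Fin n → ℂ) x₀).target ∩
    (chartAt (Fin n → ℂ) x₀).symm ⁻¹' (trivializationAt ℂ F x₀).baseSet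

/-- The volume form `Ω = ωⁿ / n!` near `x₀`, as a measure, where
`ω = (√-1 / 2) ∂∂̄ log h_Q = (√-1 / 2) ∑ gᵢⱼ dzᵢ ∧ dz̄ⱼ` with `gᵢⱼ = ∂² log h_Q / ∂zᵢ ∂z̄ⱼ`.
In the chart at `x₀`, `Ω = det (gᵢⱼ) (√-1 / 2)ⁿ dz₁ ∧ dz̄₁ ∧ ⋯ ∧ dzₙ ∧ dz̄ₙ`, and the last factor
is the Lebesgue measure of `ℂⁿ`. -/
def localVolume (Q : HermitianAlgebraicFunction n F) (x₀ : X) : Measure X :=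
  ((volume.restrict (chartDomain n F x₀)).withDensity
    fun z => ENNReal.ofReal (-Q.curvature x₀ z).det.re).map (chartAt (Fin n → ℂ) x₀).symm

/-- The volume form `Ω` of `X` induced by `Q`, as a measure: the local measures agree on overlaps,
so their supremum is the unique measure on `X` restricting to each of them. -/
def volumeForm (Q : HermitianAlgebraicFunction n F) : Measure X :=
  ⨆ x₀ : X, Q.localVolume x₀

end HermitianAlgebraicFunction

/-! ### Sections of `L^m ⊗ E` -/

/-- Evaluation of an element of `V^{⊗m} ⊗ W` at `v^{⊗m} ⊗ w`, for `v ∈ V*`, `w ∈ W*`. -/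
def tensorEval (m : ℕ) {V W : Type*} [AddCommGroup V] [Module ℂ V] [TopologicalSpace V]
    [AddCommGroup W] [Module ℂ W] [TopologicalSpace W] (v : V →L[ℂ] ℂ) (w : W →L[ℂ] ℂ) :
    ((⨂[ℂ]^m V) ⊗[ℂ] W) →ₗ[ℂ] ℂ :=
  LinearMap.mul' ℂ ℂ ∘ₗ
    TensorProduct.map
      (PiTensorProduct.lift
        ((MultilinearMap.mkPiAlgebra ℂ (Fin m) ℂ).compLinearMap fun _ => v.toLinearMap))
      w.toLinearMap

theorem tensorEval_tmul (m : ℕ) {V W : Type*} [AddCommGroup V] [Module ℂ V] [TopologicalSpace V]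
    [AddCommGroup W] [Module ℂ W] [TopologicalSpace W] (v : V →L[ℂ] ℂ) (w : W →L[ℂ] ℂ)
    (a : Fin m → V) (b : W) :
    tensorEval m v w ((PiTensorProduct.tprod ℂ a) ⊗ₜ[ℂ] b) = (∏ i, v (a i)) * w b := by
  simp [tensorEval]

section Sections

variable {n : ℕ} {X : Type*} [TopologicalSpace X] [ChartedSpace (Fin n → ℂ) X]
  {L : X → Type*}
  [∀ x, AddCommGroup (L x)] [∀ x, Module ℂ (L x)] [∀ x, TopologicalSpace (L x)]
  [TopologicalSpace (TotalSpace ℂ L)] [FiberBundle ℂ L] [VectorBundle ℂ ℂ L]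
  {E : X → Type*}
  [∀ x, AddCommGroup (E x)] [∀ x, Module ℂ (E x)] [∀ x, TopologicalSpace (E x)]
  [TopologicalSpace (TotalSpace ℂ E)] [FiberBundle ℂ E] [VectorBundle ℂ ℂ E]

/-- `s ∈ H⁰(X, L^m ⊗ E)`: the coefficients of `s` with respect to the local holomorphic frames
induced by those of `L` and `E` are holomorphic. -/
def IsHolomorphicSection (n : ℕ) {X : Type*} [TopologicalSpace X] [ChartedSpace (Fin n → ℂ) X]
    {L : X → Type*}
    [∀ x, AddCommGroup (L x)] [∀ x, Module ℂ (L x)] [∀ x, TopologicalSpace (L x)]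
    [TopologicalSpace (TotalSpace ℂ L)] [FiberBundle ℂ L] [VectorBundle ℂ ℂ L]
    {E : X → Type*}
    [∀ x, AddCommGroup (E x)] [∀ x, Module ℂ (E x)] [∀ x, TopologicalSpace (E x)]
    [TopologicalSpace (TotalSpace ℂ E)] [FiberBundle ℂ E] [VectorBundle ℂ ℂ E]
    {m : ℕ} (s : ∀ x : X, (⨂[ℂ]^m (L x)) ⊗[ℂ] E x) : Prop :=
  ∀ x₀ : X,
    AnalyticAt ℂ
      (fun z : Fin n → ℂ =>
        tensorEval m (dualFrame L x₀ ((chartAt (Fin n → ℂ) x₀).symm z))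
          (dualFrame E x₀ ((chartAt (Fin n → ℂ) x₀).symm z))
          (s ((chartAt (Fin n → ℂ) x₀).symm z)))
      (chartAt (Fin n → ℂ) x₀ x₀)

/-- `(R^m P)(x, ȳ)`, an element of `(L^m ⊗ E)_x ⊗ conj (L^m ⊗ E)_y`, evaluated at
`(ξ_x^m ⊗ η_x) ⊗ conj (ξ_y^m ⊗ η_y)`. Here and below `ξ_x`, `η_x` are the nonzero elements
`dualFrame L x x`, `dualFrame E x x` of `L*_x`, `E*_x`; the quotients below do not depend on their
choice. -/
def powMulKernel (m : ℕ) (R : HermitianAlgebraicFunction n L)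
    (P : HermitianAlgebraicFunction n E) (x y : X) : ℂ :=
  R.toFun (dualFrame L x x) (dualFrame L y y) ^ m *
    P.toFun (dualFrame E x x) (dualFrame E y y)

/-- `s(x)`, evaluated at `ξ_x^m ⊗ η_x`. -/
def sectionCoeff {m : ℕ} (s : ∀ x : X, (⨂[ℂ]^m (L x)) ⊗[ℂ] E x) (x : X) : ℂ :=
  tensorEval m (dualFrame L x x) (dualFrame E x x) (s x)

variable [MeasurableSpace X]

/-- The inner product
`(s, t) = ∫_X s(x) conj t(x) / (R^m P)(x, x̄) Ω(x)`. -/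
def sectionInner {m : ℕ} (R : HermitianAlgebraicFunction n L)
    (P : HermitianAlgebraicFunction n E) (Ω : Measure X)
    (s t : ∀ x : X, (⨂[ℂ]^m (L x)) ⊗[ℂ] E x) : ℂ :=
  ∫ x, sectionCoeff s x * (starRingEnd ℂ) (sectionCoeff t x) / powMulKernel m R P x x ∂Ω

/-- The `L²` norm `‖s‖ = (s, s)^{1/2}`. -/
def sectionNorm {m : ℕ} (R : HermitianAlgebraicFunction n L)
    (P : HermitianAlgebraicFunction n E) (Ω : Measure X)
    (s : ∀ x : X, (⨂[ℂ]^m (L x)) ⊗[ℂ] E x) : ℝ :=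
  Real.sqrt (sectionInner R P Ω s s).re

/-- The integral operator (as a Hermitian form)
`K(s, t) = ∬ (R^m P)(x, ȳ) s(y) conj t(x) / ((R^m P)(x, x̄) (R^m P)(y, ȳ)) Ω(x) Ω(y)`. -/
def integralForm {m : ℕ} (R : HermitianAlgebraicFunction n L)
    (P : HermitianAlgebraicFunction n E) (Ω : Measure X)
    (s t : ∀ x : X, (⨂[ℂ]^m (L x)) ⊗[ℂ] E x) : ℂ :=
  ∫ p : X × X,
    powMulKernel m R P p.1 p.2 * sectionCoeff s p.2 * (starRingEnd ℂ) (sectionCoeff t p.1) /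
      (powMulKernel m R P p.1 p.1 * powMulKernel m R P p.2 p.2) ∂(Ω.prod Ω)

end Sections

end

/-! Let a(x, y) = |R(x, ȳ)|² / (R(x, x̄) R(y, ȳ)) be the `cauchyRatio` of `R`, let b be that of `P`,
and let |s| be the pointwise norm for R^m P. The integrand of K(s, s) has absolute value |s|(x)
|s|(y) (a^m b)^{1/2} (`norm_sectionKernel`). Since a < 1 off the diagonal, it concentrates on y = x
at scale m^{-1/2}. There -log a is Calabi's diastasis of the metric, and the claim becomes a Laplace
asymptotic, uniform in x and in the section.

Fix x. Because R(x, ȳ) = |R(y, x̄)|² / R(y, x̄), the integrand near x is F a^m b with F(y) = s(y)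
conj s(x) / (R^m P)(y, x̄). This F is holomorphic in y and equals |s|²(x) at y = x
(`exists_local_factor`). In Bochner coordinates w centred at x, those in which ∂_v log R(·, x̄) is
affine (`exists_normal_coordinates`), the diastasis is a positive Hermitian form T(w, w̄) up to
O(|w|⁴), and b times the volume density is det T up to O(|w|²). Both statements come from the
polarized functions: their differences from the models vanish to second, respectively first, order
in each of the two independent variables, and the Schwarz lemma, applied once per variable, makes
this quantitative (`norm_remainder_le_mul`, `norm_weightedDensity_sub_le`). The constants depend
only on bounds that hold uniformly near a given point (`exists_uniform_bochnerChart`).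

The Gaussian exp(-m T(w, w̄)) is invariant under w ↦ e^{iθ} w, so the mean value property gives its
integral against F as F(0) times its mass, and det T times the full mass is exactly (π/m)^n
(`det_mul_integral_gaussian`). Passing from the true weight to the Gaussian costs 1/m times the
integral of |F| a^{11m/20} (`exists_laplace_estimate`). This is not controlled by F(0), but |F|
a^{m/2} is comparable to |s|(x) |s|(y). What remains is the kernel a^{m/20}, whose row integrals are
O(m^{-n}). Schur's test (`integral_integral_sqrt_mul_ratio_le`) then bounds the total error by a
multiple of m^{-n-1} ‖s‖². Away from x, strict Cauchy–Schwarz and compactness give a ≤ q < 1, so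
that contribution decays exponentially. -/

noncomputable section

open Filter Topology ComplexConjugate

/-! ### Conjugating analytic functions -/

section ConjAnalytic

variable {E F : Type*} [NormedAddCommGroup E] [NormedSpace ℂ E] [StarAddMonoid E]
  [NormedStarGroup E] [StarModule ℂ E] [NormedAddCommGroup F] [NormedSpace ℂ F] [StarAddMonoid F]
  [NormedStarGroup F] [StarModule ℂ F]

/-- The multilinear map `m ↦ conj (p (conj m))`. -/
def conjMultilinear {k : ℕ} (p : ContinuousMultilinearMap ℂ (fun _ : Fin k => E) F) :
    ContinuousMultilinearMap ℂ (fun _ : Fin k => E) F :=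
  MultilinearMap.mkContinuous
    { toFun := fun m => star (p (star m))
      map_update_add' := by
        intro _ m i x y
        have h : ∀ z : E, star (Function.update m i z) = Function.update (star m) i (star z) := by
          intro z; ext j; by_cases hj : j = i
          · subst hj; simp
          · simp [hj]
        have hd : ‹DecidableEq (Fin k)› = instDecidableEqFin k := Subsingleton.elim _ _
        subst hd
        simp [h]
      map_update_smul' := by
        intro _ m i c x
        have h : ∀ z : E, star (Function.update m i z) = Function.update (star m) i (star z) := by
          intro z; ext j; by_cases hj : j = i
          · subst hj; simp
          · simp [hj]
        have hd : ‹DecidableEq (Fin k)› = instDecidableEqFin k := Subsingleton.elim _ _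
        subst hd
        simp [h] } ‖p‖ (by
    intro m
    simpa using p.le_opNorm (star m))

theorem conjMultilinear_apply {k : ℕ} (p : ContinuousMultilinearMap ℂ (fun _ : Fin k => E) F)
    (m : Fin k → E) : conjMultilinear p m = star (p (star m)) := rfl

/-- Conjugating the coefficients of a power series does not increase their norms, so the same radius
works, and `star` commutes with convergent sums. -/
theorem AnalyticAt.conj_conj {f : E → F} {z : E} (hf : AnalyticAt ℂ f z) :
    AnalyticAt ℂ (fun w => star (f (star w))) (star z) := by
  obtain ⟨p, r, hp⟩ := hf
  refine ⟨fun k => conjMultilinear (p k), r, ?_, hp.r_pos, ?_⟩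
  · refine hp.r_le.trans (FormalMultilinearSeries.radius_le_of_le fun k => ?_)
    exact MultilinearMap.mkContinuous_norm_le _ (norm_nonneg _) _
  · intro y hy
    have hy' : star y ∈ Metric.eball (0 : E) r := by
      simpa [Metric.mem_eball, edist_zero_right, ← ofReal_norm] using hy
    have := (hp.hasSum hy').star
    simp only [conjMultilinear_apply, star_add, star_star]
    exact this

end ConjAnalytic

/-! ### The mixed logarithmic Hessian -/

theorem analyticAt_clm_comp_right {A B G : Type*} [NormedAddCommGroup A] [NormedSpace ℂ A]
    [NormedAddCommGroup B] [NormedSpace ℂ B] [NormedAddCommGroup G] [NormedSpace ℂ G]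
    (S : A →L[ℂ] B) (T : B →L[ℂ] G) : AnalyticAt ℂ (fun T : B →L[ℂ] G => T.comp S) T :=
  ((ContinuousLinearMap.compL ℂ A B G).flip S).analyticAt _

section LogHess

variable {E F E' F' : Type*} [NormedAddCommGroup E] [NormedSpace ℂ E]
  [NormedAddCommGroup F] [NormedSpace ℂ F] [NormedAddCommGroup E'] [NormedSpace ℂ E']
  [NormedAddCommGroup F'] [NormedSpace ℂ F']

/-- `∂_v log f` for a function `f (u, v)`, without choosing a logarithm. -/
def logGradSnd (f : E × F → ℂ) (p : E × F) : F →L[ℂ] ℂ :=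
  (f p)⁻¹ • (fderiv ℂ f p).comp (ContinuousLinearMap.inr ℂ E F)

/-- `∂_u ∂_v log f` for a function `f (u, v)`, without choosing a logarithm. -/
def logHess (f : E × F → ℂ) (p : E × F) : E →L[ℂ] F →L[ℂ] ℂ :=
  (fderiv ℂ (logGradSnd f) p).comp (ContinuousLinearMap.inl ℂ E F)

theorem analyticAt_logGradSnd {f : E × F → ℂ} {p : E × F} (hf : AnalyticAt ℂ f p) (h0 : f p ≠ 0) :
    AnalyticAt ℂ (logGradSnd f) p := by
  have h1 : AnalyticAt ℂ (fun q => (fderiv ℂ f q).comp (ContinuousLinearMap.inr ℂ E F)) p :=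
    ((ContinuousLinearMap.compL ℂ F (E × F) ℂ).flip
      (ContinuousLinearMap.inr ℂ E F)).analyticAt _ |>.comp hf.fderiv
  exact (hf.inv h0).smul h1

theorem analyticAt_logHess {f : E × F → ℂ} {p : E × F}
    (hf : AnalyticAt ℂ f p) (h0 : f p ≠ 0) : AnalyticAt ℂ (logHess f) p := by
  have h := (analyticAt_logGradSnd hf h0).fderiv
  exact (analyticAt_clm_comp_right (ContinuousLinearMap.inl ℂ E F) _).comp h

theorem logGradSnd_congr {f g : E × F → ℂ} {p : E × F} (h : f =ᶠ[𝓝 p] g) :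
    logGradSnd f p = logGradSnd g p := by
  simp only [logGradSnd, h.fderiv_eq, h.eq_of_nhds]

theorem logHess_congr {f g : E × F → ℂ} {p : E × F} (h : f =ᶠ[𝓝 p] g) :
    logHess f p = logHess g p := by
  have : logGradSnd f =ᶠ[𝓝 p] logGradSnd g :=
    h.eventuallyEq_nhds.mono fun q hq => logGradSnd_congr hq
  simp only [logHess, this.fderiv_eq]

/-- The quotient rule. Written out this way, the expression shows the second derivative whose
symmetry drives `logHess_hermitian`. -/
theorem logHess_apply {f : E × F → ℂ} {p : E × F} (hf : AnalyticAt ℂ f p) (h0 : f p ≠ 0)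
    (x : E) (y : F) :
    logHess f p x y = (f p)⁻¹ * fderiv ℂ (fderiv ℂ f) p (x, 0) (0, y)
      - ((f p) ^ 2)⁻¹ * (fderiv ℂ f p (x, 0) * fderiv ℂ f p (0, y)) := by
  have hd := hf.differentiableAt.hasFDerivAt
  have hi : HasFDerivAt (fun q => (f q)⁻¹) (-((f p ^ 2)⁻¹) • fderiv ℂ f p) p := by
    exact (hasDerivAt_inv h0).comp_hasFDerivAt p hd
  have hd2 : HasFDerivAt (fun q => (fderiv ℂ f q).comp (ContinuousLinearMap.inr ℂ E F))
      (((ContinuousLinearMap.compL ℂ F (E × F) ℂ).flip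
      (ContinuousLinearMap.inr ℂ E F)).comp (fderiv ℂ (fderiv ℂ f) p)) p :=
    ((ContinuousLinearMap.compL ℂ F (E × F) ℂ).flip
      (ContinuousLinearMap.inr ℂ E F)).hasFDerivAt.comp p hf.fderiv.differentiableAt.hasFDerivAt
  have := (hi.smul hd2).fderiv
  have e : logGradSnd f = fun q => (f q)⁻¹ • (fderiv ℂ f q).comp (ContinuousLinearMap.inr ℂ E F) :=
    rfl
  rw [logHess, e]
  simp only [ContinuousLinearMap.comp_apply]
  erw [this]
  simp
  ring

/-- A factor of `u` alone is invisible to `∂_v log`; a factor of `v` alone adds its own logarithmic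
derivative, which the later `∂_u` annihilates. -/
theorem logGradSnd_comp {f : E' × F' → ℂ} {α : E → E'} {β : F → F'} {g : E → ℂ} {h : F → ℂ}
    {u : E} {v : F} (hf : AnalyticAt ℂ f (α u, β v)) (h0 : f (α u, β v) ≠ 0)
    (hα : AnalyticAt ℂ α u) (hβ : AnalyticAt ℂ β v) (hg : AnalyticAt ℂ g u)
    (hh : AnalyticAt ℂ h v) (hg0 : g u ≠ 0) (hh0 : h v ≠ 0) :
    logGradSnd (fun q : E × F => g q.1 * h q.2 * f (α q.1, β q.2)) (u, v)
      = (h v)⁻¹ • fderiv ℂ h v + (logGradSnd f (α u, β v)).comp (fderiv ℂ β v) := by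
  set ab : E × F → E' × F' := fun q => (α q.1, β q.2)
  have d1 : HasFDerivAt (fun q : E × F => g q.1)
      ((fderiv ℂ g u).comp (ContinuousLinearMap.fst ℂ E F)) (u, v) :=
    HasFDerivAt.comp (u, v) (g := g) hg.differentiableAt.hasFDerivAt hasFDerivAt_fst
  have d2 : HasFDerivAt (fun q : E × F => h q.2)
      ((fderiv ℂ h v).comp (ContinuousLinearMap.snd ℂ E F)) (u, v) :=
    HasFDerivAt.comp (u, v) (g := h) hh.differentiableAt.hasFDerivAt hasFDerivAt_snd
  have d3 : HasFDerivAt ab (((fderiv ℂ α u).comp (ContinuousLinearMap.fst ℂ E F)).prod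
      ((fderiv ℂ β v).comp (ContinuousLinearMap.snd ℂ E F))) (u, v) :=
    (HasFDerivAt.comp (u, v) (g := α) hα.differentiableAt.hasFDerivAt hasFDerivAt_fst).prodMk
      (HasFDerivAt.comp (u, v) (g := β) hβ.differentiableAt.hasFDerivAt hasFDerivAt_snd)
  have d4 : HasFDerivAt (fun q => f (ab q)) _ (u, v) :=
    HasFDerivAt.comp (u, v) (g := f) hf.differentiableAt.hasFDerivAt d3
  have d5 := ((d1.mul d2).mul d4).fderiv
  ext y
  simp only [logGradSnd]
  rw [smul_apply, ContinuousLinearMap.comp_apply]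
  erw [d5]
  simp [ab]
  field_simp
  ring

variable [CompleteSpace E'] [CompleteSpace F']

/-- The mixed logarithmic Hessian is invariant under a change of frame and natural under a
holomorphic change of coordinates. -/
theorem logHess_comp {f : E' × F' → ℂ} {α : E → E'} {β : F → F'} {g : E → ℂ} {h : F → ℂ}
    {u : E} {v : F} (hf : AnalyticAt ℂ f (α u, β v)) (h0 : f (α u, β v) ≠ 0)
    (hα : AnalyticAt ℂ α u) (hβ : AnalyticAt ℂ β v) (hg : AnalyticAt ℂ g u)
    (hh : AnalyticAt ℂ h v) (hg0 : g u ≠ 0) (hh0 : h v ≠ 0) (x : E) (y : F) :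
    logHess (fun q : E × F => g q.1 * h q.2 * f (α q.1, β q.2)) (u, v) x y
      = logHess f (α u, β v) (fderiv ℂ α u x) (fderiv ℂ β v y) := by
  set ab : E × F → E' × F' := fun q => (α q.1, β q.2)
  have hα' : AnalyticAt ℂ (fun q : E × F => α q.1) (u, v) := hα.fun_comp analyticAt_fst
  have hβ' : AnalyticAt ℂ (fun q : E × F => β q.2) (u, v) := hβ.fun_comp analyticAt_snd
  have hab : AnalyticAt ℂ ab (u, v) := hα'.prod hβ'
  have hg' : AnalyticAt ℂ (fun q : E × F => g q.1) (u, v) := hg.fun_comp analyticAt_fst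
  have hh' : AnalyticAt ℂ (fun q : E × F => h q.2) (u, v) := hh.fun_comp analyticAt_snd
  have hfc : AnalyticAt ℂ (fun q => f (ab q)) (u, v) := AnalyticAt.fun_comp (g := f) (f := ab) hf hab
  -- The first-order formula is needed on a whole neighbourhood, because it is differentiated once
  -- more.
  have key : logGradSnd (fun q : E × F => g q.1 * h q.2 * f (ab q)) =ᶠ[𝓝 (u, v)]
      fun q => (h q.2)⁻¹ • fderiv ℂ h q.2 + (logGradSnd f (ab q)).comp (fderiv ℂ β q.2) := by
    filter_upwards [hg'.eventually_analyticAt, hg'.continuousAt.eventually_ne hg0,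
      hh'.continuousAt.eventually_ne hh0, hfc.continuousAt.eventually_ne h0,
      continuousAt_fst.eventually hα.eventually_analyticAt,
      continuousAt_snd.eventually hβ.eventually_analyticAt,
      continuousAt_fst.eventually hg.eventually_analyticAt,
      continuousAt_snd.eventually hh.eventually_analyticAt,
      hab.continuousAt.eventually hf.eventually_analyticAt] with
      q _ h2 h3 h4 h5 h6 h7 h8 h9
    exact logGradSnd_comp h9 h4 h5 h6 h7 h8 h2 h3
  have hs := analyticAt_logGradSnd hf h0
  have dL : HasFDerivAt (fun q => logGradSnd f (ab q))
      ((fderiv ℂ (logGradSnd f) (ab (u, v))).comp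
        (((fderiv ℂ α u).comp (ContinuousLinearMap.fst ℂ E F)).prod
        ((fderiv ℂ β v).comp (ContinuousLinearMap.snd ℂ E F)))) (u, v) :=
    HasFDerivAt.comp (u, v) (g := logGradSnd f) (f := ab) hs.differentiableAt.hasFDerivAt
      ((HasFDerivAt.comp (u, v) (g := α) hα.differentiableAt.hasFDerivAt hasFDerivAt_fst).prodMk
        (HasFDerivAt.comp (u, v) (g := β) hβ.differentiableAt.hasFDerivAt hasFDerivAt_snd))
  have dB : HasFDerivAt (fun q : E × F => fderiv ℂ β q.2)
      ((fderiv ℂ (fderiv ℂ β) v).comp (ContinuousLinearMap.snd ℂ E F)) (u, v) :=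
    HasFDerivAt.comp (u, v) hβ.fderiv.differentiableAt.hasFDerivAt hasFDerivAt_snd
  have dh : HasFDerivAt (fun q : E × F => (h q.2)⁻¹ • fderiv ℂ h q.2)
      ((fderiv ℂ (fun w => (h w)⁻¹ • fderiv ℂ h w) v).comp (ContinuousLinearMap.snd ℂ E F))
      (u, v) :=
    HasFDerivAt.comp (u, v) (g := fun w => (h w)⁻¹ • fderiv ℂ h w)
      (((hh.inv hh0).smul hh.fderiv).differentiableAt.hasFDerivAt) hasFDerivAt_snd
  -- The frame term and the variation of `β'` both factor through `snd`, so they vanish on vectors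
  -- `(x, 0)`.
  have tot := (dh.add (dL.clm_comp dB)).fderiv
  rw [logHess, key.fderiv_eq]
  simp only [ContinuousLinearMap.comp_apply]
  erw [tot]
  simp [logHess, ab]

theorem fderiv_fderiv_swap {f : E × F → ℂ} {p : E × F} (hf : AnalyticAt ℂ f p) (a b : E × F) :
    fderiv ℂ (fderiv ℂ f) p a b = fderiv ℂ (fderiv ℂ f) p b a :=
  (hf.contDiffAt (n := 2)).isSymmSndFDerivAt (by simp) a b

end LogHess

/-! ### Hermitian symmetry and Wirtinger derivatives on the anti-diagonal. -/

section Hermitian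

variable {n : ℕ}

theorem hasFDerivAt_of_hermitian {f : (Fin n → ℂ) × (Fin n → ℂ) → ℂ} {u v : Fin n → ℂ}
    (hH : ∀ᶠ q in 𝓝 (star v, star u), f q = conj (f (star q.2, star q.1)))
    (hf : AnalyticAt ℂ f (u, v)) (x y : Fin n → ℂ) :
    fderiv ℂ f (star v, star u) (x, y) = conj (fderiv ℂ f (u, v) (star y, star x)) := by
  have h1 := hf.differentiableAt.hasFDerivAt.star_star
  have hsw : HasFDerivAt (fun q : (Fin n → ℂ) × (Fin n → ℂ) => (q.2, q.1))
    ((ContinuousLinearMap.snd ℂ (Fin n → ℂ) (Fin n → ℂ)).prod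
      (ContinuousLinearMap.fst ℂ (Fin n → ℂ) (Fin n → ℂ))) (star v, star u) :=
    hasFDerivAt_snd.prodMk hasFDerivAt_fst
  have h2 := HasFDerivAt.comp (star v, star u) (g := star ∘ f ∘ star) h1 hsw
  have h3 : f =ᶠ[𝓝 (star v, star u)]
      ((star ∘ f ∘ star) ∘ fun q : (Fin n → ℂ) × (Fin n → ℂ) => (q.2, q.1)) := by
    filter_upwards [hH] with q hq
    rw [hq]; rfl
  rw [(h2.congr_of_eventuallyEq h3).fderiv]
  rfl

/-- Conjugation exchanges the two variables, so it turns `∂_u ∂_v` into `∂_v ∂_u`, and symmetry of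
the second derivative restores the order. The identity is wanted away from the diagonal, for the
polarized density in `IsBochnerChart.weightedDensity_conj`. -/
theorem logHess_hermitian {f : (Fin n → ℂ) × (Fin n → ℂ) → ℂ} {u v : Fin n → ℂ}
    (hH : ∀ᶠ q in 𝓝 (star v, star u), f q = conj (f (star q.2, star q.1)))
    (hf : AnalyticAt ℂ f (u, v)) (hf' : AnalyticAt ℂ f (star v, star u)) (h0 : f (u, v) ≠ 0)
    (x y : Fin n → ℂ) :
    logHess f (star v, star u) x y = conj (logHess f (u, v) (star y) (star x)) := by
  have hfst : f (star v, star u) = conj (f (u, v)) := by simpa using hH.self_of_nhds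
  have h0' : f (star v, star u) ≠ 0 := by rw [hfst]; simpa using h0
  rw [logHess_apply hf' h0', logHess_apply hf h0]
  -- The first-order symmetry holds at all nearby points, so it may be differentiated again below.
  have ev : ∀ᶠ q in 𝓝 (star v, star u), ∀ x y : Fin n → ℂ,
      fderiv ℂ f q (x, y) = conj (fderiv ℂ f (star q.2, star q.1) (star y, star x)) := by
    have hc : Tendsto (fun q : (Fin n → ℂ) × (Fin n → ℂ) => (star q.2, star q.1))
        (𝓝 (star v, star u)) (𝓝 (u, v)) := by
      have : Continuous (fun q : (Fin n → ℂ) × (Fin n → ℂ) => (star q.2, star q.1)) := by fun_prop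
      simpa using this.tendsto (star v, star u)
    filter_upwards [hH.eventually_nhds, hc.eventually hf.eventually_analyticAt] with q hq ha x y
    have := hasFDerivAt_of_hermitian (f := f) (u := star q.2) (v := star q.1)
      (by simpa using hq) ha x y
    simpa using this
  have hE : fderiv ℂ f (star v, star u) (x, 0) = conj (fderiv ℂ f (u, v) (0, star x)) := by
    simpa using ev.self_of_nhds x 0
  have hE2 : fderiv ℂ f (star v, star u) (0, y) = conj (fderiv ℂ f (u, v) (star y, 0)) := by
    simpa using ev.self_of_nhds 0 y
  have hD : fderiv ℂ (fderiv ℂ f) (star v, star u) (x, 0) (0, y)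
      = conj (fderiv ℂ (fderiv ℂ f) (u, v) (0, star x) (star y, 0)) := by
    set φ : (Fin n → ℂ) × (Fin n → ℂ) → ℂ := fun q => fderiv ℂ f q (star y, 0) with hφ
    have e1 : (fun q => fderiv ℂ f q (0, y)) =ᶠ[𝓝 (star v, star u)]
        ((star ∘ φ ∘ star) ∘ fun q : (Fin n → ℂ) × (Fin n → ℂ) => (q.2, q.1)) := by
      filter_upwards [ev] with q hq
      rw [hq 0 y]
      simp only [hφ, star_zero]
      rfl
    have hsw : HasFDerivAt (fun q : (Fin n → ℂ) × (Fin n → ℂ) => (q.2, q.1))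
      ((ContinuousLinearMap.snd ℂ (Fin n → ℂ) (Fin n → ℂ)).prod
        (ContinuousLinearMap.fst ℂ (Fin n → ℂ) (Fin n → ℂ))) (star v, star u) :=
      hasFDerivAt_snd.prodMk hasFDerivAt_fst
    have dφ : HasFDerivAt φ ((ContinuousLinearMap.apply ℂ ℂ (star y, (0 : Fin n → ℂ))).comp
        (fderiv ℂ (fderiv ℂ f) (u, v))) (u, v) :=
      (ContinuousLinearMap.apply ℂ ℂ (star y, (0 : Fin n → ℂ))).hasFDerivAt.comp _
        hf.fderiv.differentiableAt.hasFDerivAt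
    have h2 := HasFDerivAt.comp (star v, star u) (g := star ∘ φ ∘ star) dφ.star_star hsw
    have h3 : HasFDerivAt (fun q => fderiv ℂ f q (0, y))
        ((ContinuousLinearMap.apply ℂ ℂ ((0 : Fin n → ℂ), y)).comp
        (fderiv ℂ (fderiv ℂ f) (star v, star u))) (star v, star u) :=
      (ContinuousLinearMap.apply ℂ ℂ ((0 : Fin n → ℂ), y)).hasFDerivAt.comp _
        hf'.fderiv.differentiableAt.hasFDerivAt
    have h4 := (h2.congr_of_eventuallyEq e1).unique h3
    have h5 := congrArg (fun l => l (x, (0 : Fin n → ℂ))) h4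
    simp only [ContinuousLinearMap.comp_apply] at h5
    have h6 : (fderiv ℂ (fderiv ℂ f) (star v, star u) (x, 0)) (0, y) = conj (fderiv ℂ (fderiv ℂ f) (u, v) (star ((0 : Fin n → ℂ), x)) (star y, 0)) := h5.symm
    rw [h6]
    congr 3
    exact Prod.ext (star_zero _) rfl
  rw [hfst, hE, hE2, hD, fderiv_fderiv_swap hf]
  simp only [map_sub, map_mul, map_inv₀, map_pow]
  ring

theorem star_single {n : ℕ} (i : Fin n) (c : ℂ) :
    star (Pi.single i c : Fin n → ℂ) = Pi.single i (conj c) := by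
  ext j; by_cases h : j = i
  · subst h; simp
  · simp [h]

theorem hasFDerivAt_real_diag {f : (Fin n → ℂ) × (Fin n → ℂ) → ℂ} {z : Fin n → ℂ}
    (hf : AnalyticAt ℂ f (z, star z)) (x : Fin n → ℂ) :
    fderiv ℝ (fun w => f (w, star w)) z x = fderiv ℂ f (z, star z) (x, star x) := by
  have h1 := hf.differentiableAt.hasFDerivAt.restrictScalars ℝ
  have hs : HasFDerivAt (fun w : Fin n → ℂ => star w)
      ((starL' ℝ : (Fin n → ℂ) ≃L[ℝ] (Fin n → ℂ)) : (Fin n → ℂ) →L[ℝ] (Fin n → ℂ)) z :=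
    (starL' ℝ : (Fin n → ℂ) ≃L[ℝ] (Fin n → ℂ)).hasFDerivAt
  have h2 := HasFDerivAt.comp z h1 ((hasFDerivAt_id (𝕜 := ℝ) z).prodMk hs)
  erw [h2.fderiv]
  rfl

/-- The curve `w ↦ (w, w̄)` feeds `I` into the first slot and `-I` into the second, so the
combination defining `∂/∂z̄` cancels the first slot and keeps the second. -/
theorem wirtingerBar_diag {f : (Fin n → ℂ) × (Fin n → ℂ) → ℂ} {z : Fin n → ℂ}
    (hf : AnalyticAt ℂ f (z, star z)) (j : Fin n) :
    wirtingerBar j (fun w => f (w, star w)) z = fderiv ℂ f (z, star z) (0, Pi.single j 1) := by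
  rw [wirtingerBar, hasFDerivAt_real_diag hf, hasFDerivAt_real_diag hf, star_single, star_single]
  set T := fderiv ℂ f (z, star z)
  have e1 : T (Pi.single j 1, Pi.single j (conj (1 : ℂ)))
      = T (Pi.single j 1, 0) + T (0, Pi.single j 1) := by
    rw [← map_add]; simp
  have e2 : T (Pi.single j Complex.I, Pi.single j (conj Complex.I))
      = Complex.I * T (Pi.single j 1, 0) - Complex.I * T (0, Pi.single j 1) := by
    rw [← smul_eq_mul, ← smul_eq_mul, ← map_smul, ← map_smul, ← map_sub]
    congr 1
    ext k <;> by_cases hk : k = j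
    all_goals first | (subst hk; simp) | simp [hk]
  rw [e1, e2]
  linear_combination (1 / 2) * (T (Pi.single j 1, 0) - T (0, Pi.single j 1)) * Complex.I_mul_I

theorem wirtinger_diag {f : (Fin n → ℂ) × (Fin n → ℂ) → ℂ} {z : Fin n → ℂ}
    (hf : AnalyticAt ℂ f (z, star z)) (j : Fin n) :
    wirtinger j (fun w => f (w, star w)) z = fderiv ℂ f (z, star z) (Pi.single j 1, 0) := by
  rw [wirtinger, hasFDerivAt_real_diag hf, hasFDerivAt_real_diag hf, star_single, star_single]
  set T := fderiv ℂ f (z, star z)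
  have e1 : T (Pi.single j 1, Pi.single j (conj (1 : ℂ)))
      = T (Pi.single j 1, 0) + T (0, Pi.single j 1) := by
    rw [← map_add]; simp
  have e2 : T (Pi.single j Complex.I, Pi.single j (conj Complex.I))
      = Complex.I * T (Pi.single j 1, 0) - Complex.I * T (0, Pi.single j 1) := by
    rw [← smul_eq_mul, ← smul_eq_mul, ← map_smul, ← map_smul, ← map_sub]
    congr 1
    ext k <;> by_cases hk : k = j
    all_goals first | (subst hk; simp) | simp [hk]
  rw [e1, e2]
  linear_combination (-1 / 2) * (T (Pi.single j 1, 0) - T (0, Pi.single j 1)) * Complex.I_mul_I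

theorem wirtinger_congr {f g : (Fin n → ℂ) → ℂ} {z : Fin n → ℂ} (h : f =ᶠ[𝓝 z] g) (i : Fin n) :
    wirtinger i f z = wirtinger i g z := by
  simp only [wirtinger, h.fderiv_eq]

theorem wirtingerBar_congr {f g : (Fin n → ℂ) → ℂ} {z : Fin n → ℂ} (h : f =ᶠ[𝓝 z] g)
    (i : Fin n) : wirtingerBar i f z = wirtingerBar i g z := by
  simp only [wirtingerBar, h.fderiv_eq]

/-- The coefficients of `∂∂̄ log f(z, z̄)` are those of the mixed logarithmic Hessian of `f`. -/
theorem wirtinger_wirtingerBar_log {f : (Fin n → ℂ) × (Fin n → ℂ) → ℂ} {z : Fin n → ℂ}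
    {l : (Fin n → ℂ) → ℂ} (hf : AnalyticAt ℂ f (z, star z)) (h0 : f (z, star z) ∈ Complex.slitPlane)
    (hl : ∀ᶠ w in 𝓝 z, l w = Complex.log (f (w, star w))) (i j : Fin n) :
    wirtinger i (wirtingerBar j l) z
      = logHess f (z, star z) (Pi.single i 1) (Pi.single j 1) := by
  have hc : ContinuousAt (fun w : Fin n → ℂ => (w, star w)) z := by fun_prop
  have h1 : wirtingerBar j l =ᶠ[𝓝 z]
      fun w => (fun q => logGradSnd f q (Pi.single j 1)) (w, star w) := by
    filter_upwards [hl.eventually_nhds, hc.eventually hf.eventually_analyticAt,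
      hc.eventually (hf.continuousAt.eventually (Complex.isOpen_slitPlane.mem_nhds h0))]
      with w hw ha hs
    rw [wirtingerBar_congr hw, wirtingerBar_diag (f := fun q => Complex.log (f q)) (ha.clog hs)]
    rw [(ha.differentiableAt.hasFDerivAt.clog hs).fderiv]
    simp [logGradSnd]
  have hne : f (z, star z) ≠ 0 := Complex.slitPlane_ne_zero h0
  have ha := analyticAt_logGradSnd hf hne
  rw [wirtinger_congr h1, wirtinger_diag (f := fun q => logGradSnd f q (Pi.single j 1))]
  · have d : HasFDerivAt (fun q => logGradSnd f q (Pi.single j 1))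
        ((ContinuousLinearMap.apply ℂ ℂ (Pi.single j (1 : ℂ) : Fin n → ℂ)).comp
        (fderiv ℂ (logGradSnd f) (z, star z))) (z, star z) :=
      (ContinuousLinearMap.apply ℂ ℂ (Pi.single j (1 : ℂ) : Fin n → ℂ)).hasFDerivAt.comp _
        ha.differentiableAt.hasFDerivAt
    rw [d.fderiv]
    simp [logHess]
  · exact ((ContinuousLinearMap.apply ℂ ℂ (Pi.single j (1 : ℂ) : Fin n → ℂ)).analyticAt _).fun_comp ha

end Hermitian

/-! ### Frames and charts -/

section Frames

variable {n : ℕ} {X : Type*} [TopologicalSpace X] [ChartedSpace (Fin n → ℂ) X]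
  {F : X → Type*}
  [∀ x, AddCommGroup (F x)] [∀ x, Module ℂ (F x)] [∀ x, TopologicalSpace (F x)]
  [TopologicalSpace (TotalSpace ℂ F)] [FiberBundle ℂ F] [VectorBundle ℂ ℂ F]

theorem dualFrame_ne_zero {p x : X} (hx : x ∈ (trivializationAt ℂ F p).baseSet) :
    dualFrame F p x ≠ 0 := by
  set e := (trivializationAt ℂ F p).continuousLinearEquivAt ℂ x hx
  intro h
  have h1 : dualFrame F p x (e.symm 1) = e (e.symm 1) := by
    simp [dualFrame, e, Trivialization.coe_linearMapAt_of_mem _ hx]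
  rw [h] at h1
  simp at h1

variable (F) in
/-- The transition function from the frame at `q` to the frame at `p`. -/
def frameTransition (q p x : X) : ℂ :=
  (trivializationAt ℂ F q).coordChangeL ℂ (trivializationAt ℂ F p) x 1

theorem dualFrame_eq_frameTransition_smul {p q x : X}
    (hp : x ∈ (trivializationAt ℂ F p).baseSet) (hq : x ∈ (trivializationAt ℂ F q).baseSet) :
    dualFrame F p x = frameTransition F q p x • dualFrame F q x := by
  set ep := (trivializationAt ℂ F p).continuousLinearEquivAt ℂ x hp
  set eq := (trivializationAt ℂ F q).continuousLinearEquivAt ℂ x hq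
  ext y
  have h1 : dualFrame F p x y = ep y := by
    simp [dualFrame, ep, Trivialization.coe_linearMapAt_of_mem _ hp]
  have h2 : dualFrame F q x y = eq y := by
    simp [dualFrame, eq, Trivialization.coe_linearMapAt_of_mem _ hq]
  have h3 : frameTransition F q p x = ep (eq.symm 1) := by
    rw [frameTransition, Trivialization.coordChangeL_apply _ _ ⟨hq, hp⟩]
    rfl
  rw [smul_apply, h1, h2, h3]
  have h4 : y = (eq y) • eq.symm 1 := by
    apply eq.injective
    simp
  conv_lhs => rw [h4]
  simp [mul_comm]

theorem frameTransition_ne_zero {p q x : X}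
    (hp : x ∈ (trivializationAt ℂ F p).baseSet) (hq : x ∈ (trivializationAt ℂ F q).baseSet) :
    frameTransition F q p x ≠ 0 := by
  intro h
  refine dualFrame_ne_zero (F := F) hp ?_
  rw [dualFrame_eq_frameTransition_smul (F := F) hp hq, h]
  ext y
  simp

theorem analyticAt_of_contMDiffAt_chart {G : Type*} [NormedAddCommGroup G] [NormedSpace ℂ G]
    [CompleteSpace G]
    [IsManifold 𝓘(ℂ, Fin n → ℂ) ω X] {f : X → G} {c : X} {z : Fin n → ℂ}
    (hz : z ∈ (chartAt (Fin n → ℂ) c).target)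
    (hf : ContMDiffAt 𝓘(ℂ, Fin n → ℂ) 𝓘(ℂ, G) ω f ((chartAt (Fin n → ℂ) c).symm z)) :
    AnalyticAt ℂ (fun w => f ((chartAt (Fin n → ℂ) c).symm w)) z := by
  have h1 : ContMDiffAt 𝓘(ℂ, Fin n → ℂ) 𝓘(ℂ, Fin n → ℂ) ω (chartAt (Fin n → ℂ) c).symm z :=
    contMDiffOn_chart_symm.contMDiffAt ((chartAt (Fin n → ℂ) c).open_target.mem_nhds hz)
  have h2 := hf.comp z h1
  exact (contMDiffAt_iff_contDiffAt.mp h2).analyticAt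

theorem analyticAt_frameTransition [IsManifold 𝓘(ℂ, Fin n → ℂ) ω X]
    [ContMDiffVectorBundle ω ℂ F 𝓘(ℂ, Fin n → ℂ)] {c p q : X} {z : Fin n → ℂ}
    (hz : z ∈ (chartAt (Fin n → ℂ) c).target)
    (hp : (chartAt (Fin n → ℂ) c).symm z ∈ (trivializationAt ℂ F p).baseSet)
    (hq : (chartAt (Fin n → ℂ) c).symm z ∈ (trivializationAt ℂ F q).baseSet) :
    AnalyticAt ℂ (fun w => frameTransition F q p ((chartAt (Fin n → ℂ) c).symm w)) z := by
  have h := (contMDiffOn_coordChangeL (n := ω) (IB := 𝓘(ℂ, Fin n → ℂ))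
    (trivializationAt ℂ F q) (trivializationAt ℂ F p)).contMDiffAt
    (((trivializationAt ℂ F q).open_baseSet.inter
      (trivializationAt ℂ F p).open_baseSet).mem_nhds ⟨hq, hp⟩)
  have h2 := analyticAt_of_contMDiffAt_chart hz h
  exact ((ContinuousLinearMap.apply ℂ ℂ (1 : ℂ)).analyticAt _).comp h2

theorem analyticAt_chart_transition [IsManifold 𝓘(ℂ, Fin n → ℂ) ω X] {p q : X} {z : Fin n → ℂ}
    (hz : z ∈ (chartAt (Fin n → ℂ) p).target)
    (hq : (chartAt (Fin n → ℂ) p).symm z ∈ (chartAt (Fin n → ℂ) q).source) :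
    AnalyticAt ℂ (fun w => chartAt (Fin n → ℂ) q ((chartAt (Fin n → ℂ) p).symm w)) z :=
  analyticAt_of_contMDiffAt_chart hz
    (contMDiffOn_chart.contMDiffAt ((chartAt (Fin n → ℂ) q).open_source.mem_nhds hq))

/-- By the chain rule the derivative of the reverse transition is a left inverse. -/
theorem fderiv_chart_transition_injective [IsManifold 𝓘(ℂ, Fin n → ℂ) ω X] {p q : X}
    {z : Fin n → ℂ} (hz : z ∈ (chartAt (Fin n → ℂ) p).target)
    (hq : (chartAt (Fin n → ℂ) p).symm z ∈ (chartAt (Fin n → ℂ) q).source) :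
    Function.Injective
      (fderiv ℂ (fun w => chartAt (Fin n → ℂ) q ((chartAt (Fin n → ℂ) p).symm w)) z) := by
  set τ := fun w => chartAt (Fin n → ℂ) q ((chartAt (Fin n → ℂ) p).symm w)
  set σ := fun w => chartAt (Fin n → ℂ) p ((chartAt (Fin n → ℂ) q).symm w)
  have h1 : AnalyticAt ℂ τ z := analyticAt_chart_transition hz hq
  have hτ : (chartAt (Fin n → ℂ) q).symm (τ z) = (chartAt (Fin n → ℂ) p).symm z :=
    (chartAt (Fin n → ℂ) q).left_inv hq
  have h2 : AnalyticAt ℂ σ (τ z) := by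
    refine analyticAt_chart_transition ((chartAt (Fin n → ℂ) q).map_source hq) ?_
    rw [hτ]; exact (chartAt (Fin n → ℂ) p).map_target hz
  have h3 : (σ ∘ τ) =ᶠ[𝓝 z] id := by
    have c1 : ContinuousAt (chartAt (Fin n → ℂ) p).symm z :=
      (chartAt (Fin n → ℂ) p).continuousAt_symm hz
    filter_upwards [(chartAt (Fin n → ℂ) p).open_target.mem_nhds hz,
      c1.eventually ((chartAt (Fin n → ℂ) q).open_source.mem_nhds hq)] with w hw1 hw2
    simp only [Function.comp_apply, σ, τ, id]
    rw [(chartAt (Fin n → ℂ) q).left_inv hw2, (chartAt (Fin n → ℂ) p).right_inv hw1]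
  have h4 := (HasFDerivAt.comp z h2.differentiableAt.hasFDerivAt
    h1.differentiableAt.hasFDerivAt).congr_of_eventuallyEq h3.symm
  have h5 := h4.unique (hasFDerivAt_id z)
  intro a b hab
  have := congrArg (fun T => T a - T b) h5
  simp only [ContinuousLinearMap.comp_apply, hab, sub_self, ContinuousLinearMap.id_apply] at this
  exact (sub_eq_zero.mp this.symm)

end Frames

/-! ### Common domains of charts and frames. -/

section FrameDomain

variable {n : ℕ} {X : Type*} [TopologicalSpace X] [ChartedSpace (Fin n → ℂ) X]
  {F : X → Type*} [∀ x, TopologicalSpace (F x)] [TopologicalSpace (TotalSpace ℂ F)]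
  [FiberBundle ℂ F]

variable (n F) in
/-- The open set over which both the chart and the frame at `p` are defined. -/
def frameDomain (p : X) : Set X :=
  (chartAt (Fin n → ℂ) p).source ∩ (trivializationAt ℂ F p).baseSet

theorem isOpen_frameDomain (p : X) : IsOpen (frameDomain n F p) :=
  (chartAt (Fin n → ℂ) p).open_source.inter (trivializationAt ℂ F p).open_baseSet

theorem mem_frameDomain_self (p : X) : p ∈ frameDomain n F p :=
  ⟨mem_chart_source _ p, mem_baseSet_trivializationAt ℂ F p⟩

open HermitianAlgebraicFunction in
theorem isOpen_chartDomain (p : X) : IsOpen (chartDomain n F p) :=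
  (chartAt (Fin n → ℂ) p).isOpen_inter_preimage_symm (trivializationAt ℂ F p).open_baseSet

open HermitianAlgebraicFunction in
theorem symm_mem_frameDomain {p : X} {z : Fin n → ℂ} (hz : z ∈ chartDomain n F p) :
    (chartAt (Fin n → ℂ) p).symm z ∈ frameDomain n F p :=
  ⟨(chartAt (Fin n → ℂ) p).map_target hz.1, hz.2⟩

open HermitianAlgebraicFunction in
theorem chart_mem_chartDomain {p x : X} (hx : x ∈ frameDomain n F p) :
    chartAt (Fin n → ℂ) p x ∈ chartDomain n F p := by
  refine ⟨(chartAt (Fin n → ℂ) p).map_source hx.1, ?_⟩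
  rw [Set.mem_preimage, (chartAt (Fin n → ℂ) p).left_inv hx.1]
  exact hx.2

end FrameDomain

/-! ### Matrices of sesquilinear data -/

section BilinMatrix

variable {n : ℕ}

/-- The matrix of a bilinear form on `ℂⁿ`. -/
def bilinMatrix (T : (Fin n → ℂ) →L[ℂ] (Fin n → ℂ) →L[ℂ] ℂ) : Matrix (Fin n) (Fin n) ℂ :=
  Matrix.of fun i j => T (Pi.single i 1) (Pi.single j 1)

theorem bilin_apply_eq_sum (T : (Fin n → ℂ) →L[ℂ] (Fin n → ℂ) →L[ℂ] ℂ) (x y : Fin n → ℂ) :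
    T x y = ∑ i, ∑ j, x i * bilinMatrix T i j * y j := by
  have e : ∀ z : Fin n → ℂ, z = ∑ i, z i • (Pi.single i 1 : Fin n → ℂ) := fun z => by
    simpa using (Finset.univ_sum_single z).symm.trans
      (Finset.sum_congr rfl fun i _ => by rw [← Pi.single_smul]; simp)
  conv_lhs => rw [e x, e y]
  simp only [map_sum, map_smul, sum_apply, smul_apply, bilinMatrix, Matrix.of_apply, smul_eq_mul,
    Finset.mul_sum]
  rw [Finset.sum_comm]
  exact Finset.sum_congr rfl fun i _ => Finset.sum_congr rfl fun j _ => by ring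

theorem bilin_eq_dotProduct (T : (Fin n → ℂ) →L[ℂ] (Fin n → ℂ) →L[ℂ] ℂ) (x y : Fin n → ℂ) :
    T x y = x ⬝ᵥ ((bilinMatrix T).mulVec y) := by
  rw [bilin_apply_eq_sum]
  simp only [dotProduct, Matrix.mulVec, Finset.mul_sum, mul_assoc]

theorem bilinMatrix_comp (T S : (Fin n → ℂ) →L[ℂ] (Fin n → ℂ) →L[ℂ] ℂ)
    (A B : (Fin n → ℂ) →L[ℂ] (Fin n → ℂ)) (h : ∀ x y, S x y = T (A x) (B y)) :
    bilinMatrix S = (LinearMap.toMatrix' A.toLinearMap).transpose * bilinMatrix T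
      * LinearMap.toMatrix' B.toLinearMap := by
  ext i j
  have : bilinMatrix S i j = S (Pi.single i 1) (Pi.single j 1) := rfl
  rw [this, h, bilin_apply_eq_sum]
  simp only [Matrix.mul_apply, Matrix.transpose_apply, LinearMap.toMatrix'_apply, Finset.sum_mul]
  rw [Finset.sum_comm]
  rfl

theorem det_bilinMatrix_comp (T S : (Fin n → ℂ) →L[ℂ] (Fin n → ℂ) →L[ℂ] ℂ)
    (A B : (Fin n → ℂ) →L[ℂ] (Fin n → ℂ)) (h : ∀ x y, S x y = T (A x) (B y)) :
    (bilinMatrix S).det = A.det * (bilinMatrix T).det * B.det := by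
  rw [bilinMatrix_comp T S A B h, Matrix.det_mul, Matrix.det_mul, Matrix.det_transpose,
    LinearMap.det_toMatrix', LinearMap.det_toMatrix']

/-- The map `x ↦ conj (A (conj x))`. -/
def conjCLM (A : (Fin n → ℂ) →L[ℂ] (Fin n → ℂ)) : (Fin n → ℂ) →L[ℂ] (Fin n → ℂ) :=
  (starL ℂ).toContinuousLinearMap.comp <| A.comp (starL ℂ).toContinuousLinearMap

theorem conjCLM_apply (A : (Fin n → ℂ) →L[ℂ] (Fin n → ℂ)) (x : Fin n → ℂ) :
    conjCLM A x = star (A (star x)) := rfl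

theorem toMatrix'_conjCLM (A : (Fin n → ℂ) →L[ℂ] (Fin n → ℂ)) :
    LinearMap.toMatrix' (conjCLM A).toLinearMap
      = (LinearMap.toMatrix' A.toLinearMap).map conj := by
  ext i j
  simp [LinearMap.toMatrix'_apply, conjCLM_apply]

theorem det_conjCLM (A : (Fin n → ℂ) →L[ℂ] (Fin n → ℂ)) : (conjCLM A).det = conj A.det := by
  have h1 : (conjCLM A).det = (LinearMap.toMatrix' (conjCLM A).toLinearMap).det :=
    (LinearMap.det_toMatrix' _).symm
  have h2 : A.det = (LinearMap.toMatrix' A.toLinearMap).det := (LinearMap.det_toMatrix' _).symm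
  rw [h1, h2, toMatrix'_conjCLM, RingHom.map_det]
  rfl

/-- The norm from ℂ to ℝ is z ↦ |z|². This real Jacobian is the factor that the Levi determinant
produces under a change of coordinates. -/
theorem det_restrictScalars_real (A : (Fin n → ℂ) →L[ℂ] (Fin n → ℂ)) :
    (A.restrictScalars ℝ).det = ‖A.det‖ ^ 2 := by
  have : (A.restrictScalars ℝ).det = Algebra.norm ℝ A.det := by
    simp only [ContinuousLinearMap.det]
    rw [← LinearMap.det_restrictScalars]
    rfl
  rw [this, Algebra.norm_complex_apply, Complex.normSq_eq_norm_sq]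

theorem hasFDerivAt_conj_conj {Φ : (Fin n → ℂ) → Fin n → ℂ} {w : Fin n → ℂ}
    (h : DifferentiableAt ℂ Φ w) :
    HasFDerivAt (fun v => star (Φ (star v))) (conjCLM (fderiv ℂ Φ w)) (star w) :=
  h.hasFDerivAt.star_star

/-- Pulling back by `Φ × Φ̄` multiplies the determinant of the mixed Hessian by `|det Φ'|²`. -/
theorem logHess_conj_comp {f : (Fin n → ℂ) × (Fin n → ℂ) → ℂ} {Φ : (Fin n → ℂ) → Fin n → ℂ}
    {g : (Fin n → ℂ) → ℂ} {w : Fin n → ℂ}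
    (hf : AnalyticAt ℂ f (Φ w, star (Φ w))) (h0 : f (Φ w, star (Φ w)) ≠ 0)
    (hΦ : AnalyticAt ℂ Φ w) (hg : AnalyticAt ℂ g w) (hg0 : g w ≠ 0) (x y : Fin n → ℂ) :
    logHess (fun q => g q.1 * conj (g (star q.2)) * f (Φ q.1, star (Φ (star q.2)))) (w, star w) x y
      = logHess f (Φ w, star (Φ w)) (fderiv ℂ Φ w x) (conjCLM (fderiv ℂ Φ w) y) := by
  have h := logHess_comp (f := f) (α := Φ) (β := fun v => star (Φ (star v))) (g := g)
    (h := fun v => conj (g (star v))) (u := w) (v := star w) (by simpa using hf) (by simpa using h0)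
    hΦ hΦ.conj_conj hg hg.conj_conj hg0 (by simpa using hg0) x y
  rw [(hasFDerivAt_conj_conj hΦ.differentiableAt).fderiv] at h
  simpa using h

end BilinMatrix

/-! ### Hermitian algebraic functions in local frames -/

namespace HermitianAlgebraicFunction

variable {n : ℕ} {X : Type*} [TopologicalSpace X] [ChartedSpace (Fin n → ℂ) X] {F : X → Type*}
  [∀ x, AddCommGroup (F x)] [∀ x, Module ℂ (F x)] [∀ x, TopologicalSpace (F x)]
  [TopologicalSpace (TotalSpace ℂ F)] [FiberBundle ℂ F] [VectorBundle ℂ ℂ F]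
  (Q : HermitianAlgebraicFunction n F)

theorem smul_right {x y : X} (c : ℂ) (v : F x →L[ℂ] ℂ) (w : F y →L[ℂ] ℂ) :
    Q.toFun v (c • w) = conj c * Q.toFun v w := by
  rw [Q.conj_symm, Q.smul_left, map_mul, ← Q.conj_symm]

theorem toFun_self {x : X} (v : F x →L[ℂ] ℂ) : Q.toFun v v = (Q.normSq v : ℂ) :=
  (Complex.conj_eq_iff_re.mp (Q.conj_symm v v).symm).symm

/-- `Q(x, ȳ)` in the frames at `p` and at `q`. -/
def inFrames (p q x y : X) : ℂ :=
  Q.toFun (dualFrame F p x) (dualFrame F q y)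

theorem inFrames_conj_symm (p q x y : X) : Q.inFrames p q x y = conj (Q.inFrames q p y x) :=
  Q.conj_symm _ _

theorem inFrames_self (p x : X) : Q.inFrames p p x x = (Q.normSq (dualFrame F p x) : ℂ) :=
  Q.toFun_self _

/-- `Q` in the chart and the frame at `p`, as a function on `ℂⁿ × ℂⁿ`. -/
def loc (p : X) (a : (Fin n → ℂ) × (Fin n → ℂ)) : ℂ :=
  Q.inFrames p p ((chartAt (Fin n → ℂ) p).symm a.1) ((chartAt (Fin n → ℂ) p).symm (star a.2))

theorem loc_hermitian (p : X) (a : (Fin n → ℂ) × (Fin n → ℂ)) :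
    Q.loc p a = conj (Q.loc p (star a.2, star a.1)) := by
  rw [loc, Q.inFrames_conj_symm, loc, star_star]

theorem loc_diag (p : X) (z : Fin n → ℂ) :
    Q.loc p (z, star z)
      = (Q.normSq (dualFrame F p ((chartAt (Fin n → ℂ) p).symm z)) : ℂ) := by
  rw [← inFrames_self, loc, star_star]

theorem inFrames_transition {p p' q q' x y : X}
    (hp : x ∈ (trivializationAt ℂ F p).baseSet) (hp' : x ∈ (trivializationAt ℂ F p').baseSet)
    (hq : y ∈ (trivializationAt ℂ F q).baseSet) (hq' : y ∈ (trivializationAt ℂ F q').baseSet) :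
    Q.inFrames p q x y
      = frameTransition F p' p x * conj (frameTransition F q' q y) * Q.inFrames p' q' x y := by
  rw [inFrames, dualFrame_eq_frameTransition_smul (F := F) (q := p') hp hp',
    dualFrame_eq_frameTransition_smul (F := F) (q := q') hq hq', Q.smul_left, Q.smul_right,
    inFrames]
  ring

variable {Q} in
theorem IsPositive.normSq_dualFrame_pos (hQ : Q.IsPositive) {p x : X}
    (hx : x ∈ (trivializationAt ℂ F p).baseSet) : 0 < Q.normSq (dualFrame F p x) :=
  hQ x _ (dualFrame_ne_zero hx)

variable {Q} in
theorem IsPositive.loc_diag_mem_slitPlane (hQ : Q.IsPositive) {p : X} {z : Fin n → ℂ}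
    (hz : z ∈ chartDomain n F p) : Q.loc p (z, star z) ∈ Complex.slitPlane := by
  rw [loc_diag]
  exact Complex.ofReal_mem_slitPlane.mpr (hQ.normSq_dualFrame_pos hz.2)

variable {Q} in
theorem IsPositive.loc_diag_ne_zero (hQ : Q.IsPositive) {p : X} {z : Fin n → ℂ}
    (hz : z ∈ chartDomain n F p) : Q.loc p (z, star z) ≠ 0 :=
  Complex.slitPlane_ne_zero (hQ.loc_diag_mem_slitPlane hz)

/-- The change of chart and frame for `Q`. -/
theorem loc_transition {p q : X} {z : Fin n → ℂ} (hz : z ∈ chartDomain n F p)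
    (hq : (chartAt (Fin n → ℂ) p).symm z ∈ frameDomain n F q) :
    Q.loc p =ᶠ[𝓝 (z, star z)] fun a =>
      frameTransition F q p ((chartAt (Fin n → ℂ) p).symm a.1)
        * conj (frameTransition F q p ((chartAt (Fin n → ℂ) p).symm (star a.2)))
        * Q.loc q (chartAt (Fin n → ℂ) q ((chartAt (Fin n → ℂ) p).symm a.1),
            star (chartAt (Fin n → ℂ) q ((chartAt (Fin n → ℂ) p).symm (star a.2)))) := by
  have c1 : ContinuousAt (chartAt (Fin n → ℂ) p).symm z :=
    (chartAt (Fin n → ℂ) p).continuousAt_symm hz.1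
  have h1 : ∀ᶠ w in 𝓝 z, w ∈ chartDomain n F p ∧
      (chartAt (Fin n → ℂ) p).symm w ∈ frameDomain n F q :=
    ((isOpen_chartDomain p).eventually_mem hz).and
      (c1.eventually ((isOpen_frameDomain q).eventually_mem hq))
  have hf : Tendsto (fun a : (Fin n → ℂ) × (Fin n → ℂ) => a.1) (𝓝 (z, star z)) (𝓝 z) :=
    continuous_fst.tendsto (z, star z)
  have hg : Tendsto (fun a : (Fin n → ℂ) × (Fin n → ℂ) => star a.2) (𝓝 (z, star z)) (𝓝 z) := by
    have : Continuous (fun a : (Fin n → ℂ) × (Fin n → ℂ) => star a.2) := by fun_prop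
    simpa using this.tendsto (z, star z)
  filter_upwards [hf.eventually h1, hg.eventually h1] with a ha hb
  rw [loc, loc, Q.inFrames_transition ha.1.2 ha.2.2 hb.1.2 hb.2.2, star_star,
    (chartAt (Fin n → ℂ) q).left_inv ha.2.1, (chartAt (Fin n → ℂ) q).left_inv hb.2.1]

variable [IsManifold 𝓘(ℂ, Fin n → ℂ) ω X] [ContMDiffVectorBundle ω ℂ F 𝓘(ℂ, Fin n → ℂ)]

/-- The field `holomorphic` speaks only of the centres of charts. At a general `z` one passes to the
chart and frame centred at the point over `z`, where the field applies; all transition maps are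
analytic. -/
theorem analyticAt_loc {p : X} {z : Fin n → ℂ} (hz : z ∈ chartDomain n F p) :
    AnalyticAt ℂ (Q.loc p) (z, star z) := by
  set y := (chartAt (Fin n → ℂ) p).symm z
  have hy : y ∈ frameDomain n F y := mem_frameDomain_self y
  refine AnalyticAt.congr ?_ (Q.loc_transition hz hy).symm
  have ag : AnalyticAt ℂ (fun w => frameTransition F y p ((chartAt (Fin n → ℂ) p).symm w)) z :=
    analyticAt_frameTransition hz.1 hz.2 hy.2
  have aτ : AnalyticAt ℂ (fun w => chartAt (Fin n → ℂ) y ((chartAt (Fin n → ℂ) p).symm w)) z :=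
    analyticAt_chart_transition hz.1 hy.1
  have a1 := AnalyticAt.fun_comp (f := Prod.fst) (x := (z, star z)) ag analyticAt_fst
  have a2 := AnalyticAt.fun_comp (f := Prod.snd) (x := (z, star z)) ag.conj_conj analyticAt_snd
  have a3 := AnalyticAt.fun_comp (f := Prod.fst) (x := (z, star z)) aτ analyticAt_fst
  have a4 := AnalyticAt.fun_comp (f := Prod.snd) (x := (z, star z)) aτ.conj_conj analyticAt_snd
  refine (a1.mul a2).mul ?_
  refine AnalyticAt.fun_comp (g := Q.loc y) (f := fun a : (Fin n → ℂ) × (Fin n → ℂ) =>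
    (chartAt (Fin n → ℂ) y ((chartAt (Fin n → ℂ) p).symm a.1),
            star (chartAt (Fin n → ℂ) y ((chartAt (Fin n → ℂ) p).symm (star a.2)))))
    ?_ (a3.prod a4)
  have e : ((chartAt (Fin n → ℂ) y ((chartAt (Fin n → ℂ) p).symm z)),
      star (chartAt (Fin n → ℂ) y ((chartAt (Fin n → ℂ) p).symm (star (star z)))))
      = (chartAt (Fin n → ℂ) y y, star (chartAt (Fin n → ℂ) y y)) := by rw [star_star]
  exact e ▸ Q.holomorphic y y

/-- The mixed logarithmic Hessian of `Q` in the chart at `p`. -/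
def levi (p : X) (z : Fin n → ℂ) : (Fin n → ℂ) →L[ℂ] (Fin n → ℂ) →L[ℂ] ℂ :=
  logHess (Q.loc p) (z, star z)

variable {Q}

/-- From here on the curvature is handled through the polarization `loc`, holomorphic in two
independent variables, instead of through Wirtinger derivatives of a real function. -/
theorem neg_curvature_eq (hQ : Q.IsPositive) {p : X} {z : Fin n → ℂ} (hz : z ∈ chartDomain n F p) :
    -Q.curvature p z = bilinMatrix (Q.levi p z) := by
  ext i j
  simp only [curvature, Matrix.neg_apply, Matrix.of_apply, neg_neg, bilinMatrix, levi]
  refine wirtinger_wirtingerBar_log (Q.analyticAt_loc hz) (hQ.loc_diag_mem_slitPlane hz) ?_ i j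
  filter_upwards [(isOpen_chartDomain p).mem_nhds hz] with w hw
  rw [loc_diag, ← Complex.ofReal_log (hQ.normSq_dualFrame_pos hw.2).le]
  rfl

theorem levi_transition (hQ : Q.IsPositive) {p q : X} {z : Fin n → ℂ} (hz : z ∈ chartDomain n F p)
    (hq : (chartAt (Fin n → ℂ) p).symm z ∈ frameDomain n F q) (x y : Fin n → ℂ) :
    let τ := fun w => chartAt (Fin n → ℂ) q ((chartAt (Fin n → ℂ) p).symm w)
    Q.levi p z x y = Q.levi q (τ z) (fderiv ℂ τ z x) (conjCLM (fderiv ℂ τ z) y) := by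
  intro τ
  have hτ : τ z ∈ chartDomain n F q := chart_mem_chartDomain hq
  rw [levi, logHess_congr (Q.loc_transition hz hq)]
  exact logHess_conj_comp (Φ := τ) (Q.analyticAt_loc hτ) (hQ.loc_diag_ne_zero hτ)
    (analyticAt_chart_transition hz.1 hq.1) (analyticAt_frameTransition hz.1 hz.2 hq.2)
    (frameTransition_ne_zero hz.2 hq.2) x y

/-- The two slots transform by the Jacobian and by its conjugate, so the determinant acquires the
real Jacobian; this is why the local volumes agree on overlaps. -/
theorem det_levi_transition (hQ : Q.IsPositive) {p q : X} {z : Fin n → ℂ}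
    (hz : z ∈ chartDomain n F p)
    (hq : (chartAt (Fin n → ℂ) p).symm z ∈ frameDomain n F q) :
    let τ := fun w => chartAt (Fin n → ℂ) q ((chartAt (Fin n → ℂ) p).symm w)
    (bilinMatrix (Q.levi p z)).det
      = (‖(fderiv ℂ τ z).det‖ ^ 2 : ℝ) * (bilinMatrix (Q.levi q (τ z))).det := by
  intro τ
  rw [det_bilinMatrix_comp _ _ _ _ (levi_transition hQ hz hq), det_conjCLM, mul_right_comm,
    Complex.mul_conj, Complex.normSq_eq_norm_sq]

/-- The curvature hypothesis is given only at chart centres, and congruence by the invertible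
derivative of a transition carries positivity to every other point. -/
theorem SGCS.posDef_levi (hQ : Q.IsPositive) (hS : Q.SGCS) {p : X} {z : Fin n → ℂ}
    (hz : z ∈ chartDomain n F p) : (bilinMatrix (Q.levi p z)).PosDef := by
  set y := (chartAt (Fin n → ℂ) p).symm z with hy
  have hyd : y ∈ frameDomain n F y := mem_frameDomain_self y
  set τ := fun w => chartAt (Fin n → ℂ) y ((chartAt (Fin n → ℂ) p).symm w) with hτ
  have h1 : (bilinMatrix (Q.levi y (τ z))).PosDef := by
    have : τ z = chartAt (Fin n → ℂ) y y := rfl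
    rw [this, ← neg_curvature_eq hQ (chart_mem_chartDomain hyd)]
    exact hS.curvature_neg y
  rw [bilinMatrix_comp _ _ _ _ (levi_transition hQ hz hyd)]
  -- With J the Jacobian, `Jᵀ H J̄ = (J̄)ᴴ H J̄`: the congruence is by the conjugate matrix.
  have h2 := h1.conjTranspose_mul_mul_same
    (B := LinearMap.toMatrix' (conjCLM (fderiv ℂ τ z)).toLinearMap) (by
      have inj : Function.Injective (fderiv ℂ τ z) := fderiv_chart_transition_injective hz.1 hyd.1
      intro a b hab
      rw [LinearMap.toMatrix'_mulVec, LinearMap.toMatrix'_mulVec] at hab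
      have : star (fderiv ℂ τ z (star a)) = star (fderiv ℂ τ z (star b)) := hab
      exact star_injective (inj (star_injective this)))
  convert h2 using 2
  congr 1
  rw [toMatrix'_conjCLM]
  ext i j
  simp [hτ]

theorem continuousAt_det_levi (hQ : Q.IsPositive) {p : X} {z : Fin n → ℂ}
    (hz : z ∈ chartDomain n F p) :
    ContinuousAt (fun w => (bilinMatrix (Q.levi p w)).det) z := by
  have h1 : ContinuousAt (fun w => Q.levi p w) z :=
    ContinuousAt.comp (g := logHess (Q.loc p)) (f := fun w : Fin n → ℂ => (w, star w))
      (analyticAt_logHess (Q.analyticAt_loc hz) (hQ.loc_diag_ne_zero hz)).continuousAt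
      (by fun_prop)
  have h2 : Continuous fun T : (Fin n → ℂ) →L[ℂ] (Fin n → ℂ) →L[ℂ] ℂ => (bilinMatrix T).det := by
    refine Continuous.matrix_det (continuous_matrix fun i j => ?_)
    exact ((ContinuousLinearMap.apply ℂ ℂ (Pi.single j (1 : ℂ) : Fin n → ℂ)).continuous).comp
      (ContinuousLinearMap.apply ℂ ((Fin n → ℂ) →L[ℂ] ℂ)
        (Pi.single i (1 : ℂ) : Fin n → ℂ)).continuous
  exact h2.continuousAt.comp h1

end HermitianAlgebraicFunction

/-! ### Sections in local frames -/

section LocalSections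

variable {n : ℕ} {X : Type*} [TopologicalSpace X] [ChartedSpace (Fin n → ℂ) X]
  {L : X → Type*}
  [∀ x, AddCommGroup (L x)] [∀ x, Module ℂ (L x)] [∀ x, TopologicalSpace (L x)]
  [TopologicalSpace (TotalSpace ℂ L)] [FiberBundle ℂ L] [VectorBundle ℂ ℂ L]
  {E : X → Type*}
  [∀ x, AddCommGroup (E x)] [∀ x, Module ℂ (E x)] [∀ x, TopologicalSpace (E x)]
  [TopologicalSpace (TotalSpace ℂ E)] [FiberBundle ℂ E] [VectorBundle ℂ ℂ E]

theorem tensorEval_smul (m : ℕ) {V W : Type*} [AddCommGroup V] [Module ℂ V] [TopologicalSpace V]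
    [AddCommGroup W] [Module ℂ W] [TopologicalSpace W] (v : V →L[ℂ] ℂ) (w : W →L[ℂ] ℂ) (c d : ℂ)
    (t : (⨂[ℂ]^m V) ⊗[ℂ] W) :
    tensorEval m (c • v) (d • w) t = c ^ m * d * tensorEval m v w t := by
  have : tensorEval m (c • v) (d • w) = (c ^ m * d) • tensorEval m v w := by
    ext a b
    simp [tensorEval, Finset.prod_mul_distrib]
    ring
  rw [this]
  rfl

variable (n) in
/-- The coefficient of `s` in the chart and the frames at `p`. -/
def locSection {m : ℕ} (s : ∀ x : X, (⨂[ℂ]^m (L x)) ⊗[ℂ] E x) (p : X) (z : Fin n → ℂ) : ℂ :=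
  tensorEval m (dualFrame L p ((chartAt (Fin n → ℂ) p).symm z))
    (dualFrame E p ((chartAt (Fin n → ℂ) p).symm z)) (s ((chartAt (Fin n → ℂ) p).symm z))

-- As in `analyticAt_loc`: recentre the chart and both frames at the point over `z`, at the price of
-- an analytic factor.
open HermitianAlgebraicFunction in
theorem IsHolomorphicSection.analyticAt [IsManifold 𝓘(ℂ, Fin n → ℂ) ω X]
    [ContMDiffVectorBundle ω ℂ L 𝓘(ℂ, Fin n → ℂ)] [ContMDiffVectorBundle ω ℂ E 𝓘(ℂ, Fin n → ℂ)]
    {m : ℕ} {s : ∀ x : X, (⨂[ℂ]^m (L x)) ⊗[ℂ] E x} (hs : IsHolomorphicSection n s) {p : X}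
    {z : Fin n → ℂ} (hL : z ∈ chartDomain n L p) (hE : z ∈ chartDomain n E p) :
    AnalyticAt ℂ (locSection n s p) z := by
  set y := (chartAt (Fin n → ℂ) p).symm z
  have hyL : y ∈ frameDomain n L y := mem_frameDomain_self y
  have hyE : y ∈ frameDomain n E y := mem_frameDomain_self y
  have c1 : ContinuousAt (chartAt (Fin n → ℂ) p).symm z :=
    (chartAt (Fin n → ℂ) p).continuousAt_symm hL.1
  have aL : AnalyticAt ℂ (fun w => frameTransition L y p ((chartAt (Fin n → ℂ) p).symm w)) z :=
    analyticAt_frameTransition hL.1 hL.2 hyL.2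
  have aE : AnalyticAt ℂ (fun w => frameTransition E y p ((chartAt (Fin n → ℂ) p).symm w)) z :=
    analyticAt_frameTransition hE.1 hE.2 hyE.2
  have aτ : AnalyticAt ℂ (fun w => chartAt (Fin n → ℂ) y ((chartAt (Fin n → ℂ) p).symm w)) z :=
    analyticAt_chart_transition hL.1 hyL.1
  have as := AnalyticAt.fun_comp (g := locSection n s y) (x := z) (hs y) aτ
  refine AnalyticAt.congr (((aL.pow m).mul aE).mul as) ?_
  filter_upwards [(isOpen_chartDomain p).mem_nhds hL, (isOpen_chartDomain p).mem_nhds hE,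
    c1.eventually ((isOpen_frameDomain y).mem_nhds hyL),
    c1.eventually ((isOpen_frameDomain y).mem_nhds hyE)] with w h1 h2 h3 h4
  simp only [locSection, Pi.mul_apply, Pi.pow_apply]
  rw [(chartAt (Fin n → ℂ) y).left_inv h3.1,
    dualFrame_eq_frameTransition_smul (F := L) (q := y) h1.2 h3.2,
    dualFrame_eq_frameTransition_smul (F := E) (q := y) h2.2 h4.2, tensorEval_smul]

end LocalSections

/-! ### The volume form in local coordinates -/

section MeasureAux

theorem measurableSet_inter_preimage_of_continuousOn {α β : Type*} [TopologicalSpace α]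
    [MeasurableSpace α] [BorelSpace α] [TopologicalSpace β] [MeasurableSpace β] [BorelSpace β]
    {f : α → β} {s : Set α} {t : Set β} (hs : MeasurableSet s) (hf : ContinuousOn f s)
    (ht : MeasurableSet t) : MeasurableSet (s ∩ f ⁻¹' t) := by
  have h1 : MeasurableSet ((s.domRestrict f) ⁻¹' t) :=
    (continuousOn_iff_continuous_domRestrict.mp hf).measurable ht
  have h2 := hs.subtype_image h1
  convert h2 using 1
  ext x
  simp [Set.domRestrict, and_comm]

/-- The supremum of a family of measures that are carried by the members of an open cover and agree
on overlaps restricts to each of them. -/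
theorem iSup_measure_restrict_eq {α : Type*} [TopologicalSpace α] [CompactSpace α]
    [MeasurableSpace α] [BorelSpace α] (μ : α → Measure α) (U : α → Set α)
    (hU : ∀ i, IsOpen (U i)) (hmem : ∀ i, i ∈ U i) (hsupp : ∀ i, (μ i) (U i)ᶜ = 0)
    (hov : ∀ i j, (μ i).restrict (U i ∩ U j) = (μ j).restrict (U i ∩ U j)) (j : α) :
    (⨆ i, μ i).restrict (U j) = μ j := by
  obtain ⟨t, ht⟩ := isCompact_univ.elim_finite_subcover U hU fun x _ => Set.mem_iUnion.2 ⟨x, hmem x⟩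
  have hne : t.Nonempty := by
    obtain ⟨i, hi⟩ := Set.mem_iUnion.1 (ht (Set.mem_univ j))
    obtain ⟨h, -⟩ := Set.mem_iUnion.1 hi
    exact ⟨i, h⟩
  -- Listing the finite subcover along ℕ, with repetitions, makes `disjointed` and countable
  -- additivity available.
  obtain ⟨c, hc⟩ := t.countable_toSet.exists_eq_range hne
  have hcov : (⋃ k, U (c k)) = Set.univ := by
    refine Set.eq_univ_of_forall fun x => ?_
    obtain ⟨i, hi⟩ := Set.mem_iUnion.1 (ht (Set.mem_univ x))
    obtain ⟨h, hx⟩ := Set.mem_iUnion.1 hi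
    obtain ⟨k, rfl⟩ : i ∈ Set.range c := hc ▸ h
    exact Set.mem_iUnion.2 ⟨k, hx⟩
  set D := disjointed fun k => U (c k) with hD
  have hDm : ∀ k, MeasurableSet (D k) := fun k => by
    rw [hD]
    exact MeasurableSet.disjointed (fun k => (hU _).measurableSet) k
  have hDsub : ∀ k, D k ⊆ U (c k) := fun k => disjointed_subset _ k
  have hDU : (⋃ k, D k) = Set.univ := by rw [hD, iUnion_disjointed, hcov]
  have hdis : Pairwise (Function.onFun Disjoint D) := disjoint_disjointed _
  have hsplit : ∀ (m : Measure α) (A : Set α), MeasurableSet A → m A = ∑' k, m (A ∩ D k) := by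
    intro m A hA
    rw [← measure_iUnion (fun i j hij => (hdis hij).mono Set.inter_subset_right
      Set.inter_subset_right) fun k => hA.inter (hDm k), ← Set.inter_iUnion, hDU, Set.inter_univ]
  set ν : Measure α := Measure.sum fun k => (μ (c k)).restrict (D k) with hν
  have hνapp : ∀ A, MeasurableSet A → ν A = ∑' k, μ (c k) (A ∩ D k) := by
    intro A hA
    rw [hν, Measure.sum_apply _ hA]
    exact tsum_congr fun k => Measure.restrict_apply hA
  have hνr : ∀ j, ν.restrict (U j) = μ j := by
    intro j
    ext A hA
    rw [Measure.restrict_apply hA, hνapp _ (hA.inter (hU j).measurableSet)]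
    have h1 : μ j A = μ j (A ∩ U j) := (measure_inter_conull (hsupp j)).symm
    rw [h1, hsplit (μ j) _ (hA.inter (hU j).measurableSet)]
    refine tsum_congr fun k => ?_
    have h2 : (μ (c k)).restrict (U (c k) ∩ U j) (A ∩ U j ∩ D k)
        = (μ j).restrict (U (c k) ∩ U j) (A ∩ U j ∩ D k) := by rw [hov]
    rw [Measure.restrict_eq_self _, Measure.restrict_eq_self _] at h2
    · exact h2
    all_goals exact fun x hx => ⟨hDsub k hx.2, hx.1.2⟩
  -- `ν` is an upper bound because it restricts to every `μ j`, and it lies below any upper bound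
  -- because each of its pieces is dominated there.
  have hsup : (⨆ i, μ i) = ν := by
    refine le_antisymm (iSup_le fun i => ?_) ?_
    · rw [← hνr i]; exact Measure.restrict_le_self
    · refine Measure.le_iff.2 fun A hA => ?_
      rw [hνapp A hA, hsplit _ A hA]
      exact ENNReal.tsum_le_tsum fun k => (le_iSup μ (c k)) _
  rw [hsup, hνr]

end MeasureAux

namespace HermitianAlgebraicFunction

variable {n : ℕ} {X : Type*} [TopologicalSpace X] [ChartedSpace (Fin n → ℂ) X] {F : X → Type*}
  [∀ x, AddCommGroup (F x)] [∀ x, Module ℂ (F x)] [∀ x, TopologicalSpace (F x)]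
  [TopologicalSpace (TotalSpace ℂ F)] [FiberBundle ℂ F] [VectorBundle ℂ ℂ F]
  [MeasurableSpace X] [BorelSpace X]
  (Q : HermitianAlgebraicFunction n F)

theorem localVolume_apply (p : X) {T : Set X} (hT : MeasurableSet T) :
    Q.localVolume p T = ∫⁻ z in (chartAt (Fin n → ℂ) p).symm ⁻¹' T ∩ chartDomain n F p,
      ENNReal.ofReal (-Q.curvature p z).det.re := by
  have hD : MeasurableSet (chartDomain n F p) := (isOpen_chartDomain p).measurableSet
  have h1 : AEMeasurable (chartAt (Fin n → ℂ) p).symm (volume.restrict (chartDomain n F p)) :=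
    ((chartAt (Fin n → ℂ) p).continuousOn_symm.mono Set.inter_subset_left).aemeasurable hD
  rw [localVolume, Measure.map_apply_of_aemeasurable
    (h1.mono_ac (withDensity_absolutelyContinuous _ _)) hT, withDensity_apply',
    Measure.restrict_restrict' hD]

theorem localVolume_compl (p : X) : Q.localVolume p (frameDomain n F p)ᶜ = 0 := by
  rw [localVolume_apply _ _ (isOpen_frameDomain p).measurableSet.compl]
  have : (chartAt (Fin n → ℂ) p).symm ⁻¹' (frameDomain n F p)ᶜ ∩ chartDomain n F p = ∅ := by
    ext z
    simp only [Set.mem_inter_iff, Set.mem_preimage, Set.mem_compl_iff, Set.mem_empty_iff_false,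
      iff_false, not_and]
    intro h1 h2
    exact h1 (symm_mem_frameDomain h2)
  rw [this]
  simp

/-- The local volume form in a holomorphic coordinate system `Φ`. -/
theorem localVolume_restrict_image (p : X) {B : Set (Fin n → ℂ)} (hB : MeasurableSet B)
    {Φ : (Fin n → ℂ) → Fin n → ℂ} (hΦ : ∀ w ∈ B, DifferentiableAt ℂ Φ w) (hinj : Set.InjOn Φ B)
    (hmaps : Set.MapsTo Φ B (chartDomain n F p)) :
    let κ := fun w => (chartAt (Fin n → ℂ) p).symm (Φ w)
    MeasurableSet (κ '' B) ∧ (Q.localVolume p).restrict (κ '' B)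
      = ((volume.restrict B).withDensity fun w =>
        ENNReal.ofReal (‖(fderiv ℂ Φ w).det‖ ^ 2 * (-Q.curvature p (Φ w)).det.re)).map κ := by
  intro κ
  have hder : ∀ w ∈ B, HasFDerivWithinAt Φ ((fderiv ℂ Φ w).restrictScalars ℝ) B w := fun w hw =>
    ((hΦ w hw).hasFDerivAt.restrictScalars ℝ).hasFDerivWithinAt
  have hΦB : MeasurableSet (Φ '' B) := measurable_image_of_fderivWithin hB hder hinj
  have hcont : ContinuousOn κ B := by
    refine (chartAt (Fin n → ℂ) p).continuousOn_symm.comp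
      (fun w hw => (hΦ w hw).continuousAt.continuousWithinAt) fun w hw => (hmaps hw).1
  have hκB : κ '' B = (chartAt (Fin n → ℂ) p).source ∩ (chartAt (Fin n → ℂ) p) ⁻¹' (Φ '' B) := by
    ext x
    constructor
    · rintro ⟨w, hw, rfl⟩
      refine ⟨(chartAt (Fin n → ℂ) p).map_target (hmaps hw).1, w, hw, ?_⟩
      exact ((chartAt (Fin n → ℂ) p).right_inv (hmaps hw).1).symm
    · rintro ⟨hx, w, hw, hwx⟩
      refine ⟨w, hw, ?_⟩
      simp only [κ, hwx, (chartAt (Fin n → ℂ) p).left_inv hx]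
  have hκm : MeasurableSet (κ '' B) := by
    rw [hκB]
    exact measurableSet_inter_preimage_of_continuousOn
      (chartAt (Fin n → ℂ) p).open_source.measurableSet (chartAt (Fin n → ℂ) p).continuousOn hΦB
  refine ⟨hκm, ?_⟩
  ext A hA
  have hs : MeasurableSet (B ∩ κ ⁻¹' A) :=
    measurableSet_inter_preimage_of_continuousOn hB hcont hA
  have hset : (chartAt (Fin n → ℂ) p).symm ⁻¹' (A ∩ κ '' B) ∩ chartDomain n F p
      = Φ '' (B ∩ κ ⁻¹' A) := by
    ext z
    constructor
    · rintro ⟨⟨hzA, w, hw, hwz⟩, hzD⟩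
      have : Φ w = z := (chartAt (Fin n → ℂ) p).symm.injOn (hmaps hw).1 hzD.1 hwz
      refine ⟨w, ⟨hw, ?_⟩, this⟩
      simp only [Set.mem_preimage, κ, this]
      exact hzA
    · rintro ⟨w, ⟨hw, hwA⟩, rfl⟩
      exact ⟨⟨hwA, w, hw, rfl⟩, hmaps hw⟩
  rw [Measure.restrict_apply hA, localVolume_apply _ _ (hA.inter hκm), hset,
    lintegral_image_eq_lintegral_abs_det_fderiv_mul volume hs
      (fun w hw => (hder w hw.1).mono Set.inter_subset_left) (hinj.mono Set.inter_subset_left),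
    Measure.map_apply_of_aemeasurable ((hcont.aemeasurable hB).mono_ac
      (withDensity_absolutelyContinuous _ _)) hA, withDensity_apply',
    Measure.restrict_restrict' hB, Set.inter_comm]
  refine lintegral_congr fun w => ?_
  rw [det_restrictScalars_real, abs_of_nonneg (by positivity), ENNReal.ofReal_mul (by positivity)]

variable [IsManifold 𝓘(ℂ, Fin n → ℂ) ω X] [ContMDiffVectorBundle ω ℂ F 𝓘(ℂ, Fin n → ℂ)]
variable {Q}

/-- Both measures are written in the chart at `q`, one through the transition map to `p` and one
through the identity; `det_levi_transition` then identifies the densities. -/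
theorem localVolume_restrict_inter (hQ : Q.IsPositive) (p q : X) :
    (Q.localVolume p).restrict (frameDomain n F p ∩ frameDomain n F q)
      = (Q.localVolume q).restrict (frameDomain n F p ∩ frameDomain n F q) := by
  set B : Set (Fin n → ℂ) := chartDomain n F q ∩
    (chartAt (Fin n → ℂ) q).symm ⁻¹' (frameDomain n F p) with hBdef
  have hB : MeasurableSet B := measurableSet_inter_preimage_of_continuousOn
    (isOpen_chartDomain q).measurableSet
    ((chartAt (Fin n → ℂ) q).continuousOn_symm.mono Set.inter_subset_left)
    (isOpen_frameDomain p).measurableSet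
  set τ := fun w => chartAt (Fin n → ℂ) p ((chartAt (Fin n → ℂ) q).symm w) with hτ
  have h1 := Q.localVolume_restrict_image p hB (Φ := τ)
    (fun w hw => (analyticAt_chart_transition hw.1.1 hw.2.1).differentiableAt)
    (fun a ha b hb hab => (chartAt (Fin n → ℂ) q).symm.injOn ha.1.1 hb.1.1
      ((chartAt (Fin n → ℂ) p).injOn ha.2.1 hb.2.1 hab))
    (fun w hw => chart_mem_chartDomain hw.2)
  have h2 := Q.localVolume_restrict_image q hB (Φ := id) (fun w _ => differentiableAt_id)
    (Set.injOn_id _) (fun w hw => hw.1)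
  have e1 : (fun w => (chartAt (Fin n → ℂ) q).symm (id w)) '' B
      = frameDomain n F p ∩ frameDomain n F q := by
    ext x
    constructor
    · rintro ⟨w, hw, rfl⟩
      exact ⟨hw.2, symm_mem_frameDomain hw.1⟩
    · rintro ⟨hxp, hxq⟩
      refine ⟨chartAt (Fin n → ℂ) q x, ⟨chart_mem_chartDomain hxq, ?_⟩,
        (chartAt (Fin n → ℂ) q).left_inv hxq.1⟩
      rw [Set.mem_preimage, (chartAt (Fin n → ℂ) q).left_inv hxq.1]
      exact hxp
  have e0 : ∀ w ∈ B, (chartAt (Fin n → ℂ) p).symm (τ w) = (chartAt (Fin n → ℂ) q).symm (id w) :=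
    fun w hw => (chartAt (Fin n → ℂ) p).left_inv hw.2.1
  have e2 : (fun w => (chartAt (Fin n → ℂ) p).symm (τ w)) '' B
      = frameDomain n F p ∩ frameDomain n F q := by
    rw [← e1]
    exact Set.image_congr e0
  have h1' := h1.2
  have h2' := h2.2
  rw [e2] at h1'
  rw [e1] at h2'
  rw [h1', h2']
  have hd : (volume.restrict B).withDensity (fun w =>
        ENNReal.ofReal (‖(fderiv ℂ τ w).det‖ ^ 2 * (-Q.curvature p (τ w)).det.re))
      = (volume.restrict B).withDensity (fun w =>
        ENNReal.ofReal (‖(fderiv ℂ id w).det‖ ^ 2 * (-Q.curvature q (id w)).det.re)) := by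
    refine withDensity_congr_ae ?_
    refine (ae_restrict_iff' hB).2 (Eventually.of_forall fun w hw => ?_)
    simp only [id]
    rw [neg_curvature_eq hQ hw.1, neg_curvature_eq hQ (chart_mem_chartDomain hw.2),
      det_levi_transition hQ hw.1 hw.2, Complex.re_ofReal_mul]
    simp [ContinuousLinearMap.det, fderiv_id, hτ]
  rw [hd]
  refine Measure.map_congr ?_
  refine (withDensity_absolutelyContinuous _ _).ae_le ?_
  exact (ae_restrict_iff' hB).2 (Eventually.of_forall e0)

variable [CompactSpace X]

theorem volumeForm_restrict (hQ : Q.IsPositive) (p : X) :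
    Q.volumeForm.restrict (frameDomain n F p) = Q.localVolume p :=
  iSup_measure_restrict_eq Q.localVolume (frameDomain n F) isOpen_frameDomain
    mem_frameDomain_self Q.localVolume_compl (localVolume_restrict_inter hQ) p

theorem volumeForm_restrict_image (hQ : Q.IsPositive) (p : X) {B : Set (Fin n → ℂ)}
    (hB : MeasurableSet B)
    {Φ : (Fin n → ℂ) → Fin n → ℂ} (hΦ : ∀ w ∈ B, DifferentiableAt ℂ Φ w) (hinj : Set.InjOn Φ B)
    (hmaps : Set.MapsTo Φ B (chartDomain n F p)) :
    let κ := fun w => (chartAt (Fin n → ℂ) p).symm (Φ w)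
    MeasurableSet (κ '' B) ∧ Q.volumeForm.restrict (κ '' B)
      = ((volume.restrict B).withDensity fun w =>
        ENNReal.ofReal
          (‖(fderiv ℂ Φ w).det‖ ^ 2 * (bilinMatrix (Q.levi p (Φ w))).det.re)).map κ := by
  intro κ
  obtain ⟨h1, h2⟩ := Q.localVolume_restrict_image p hB hΦ hinj hmaps
  refine ⟨h1, ?_⟩
  have hsub : κ '' B ⊆ frameDomain n F p := by
    rintro _ ⟨w, hw, rfl⟩
    exact symm_mem_frameDomain (hmaps hw)
  rw [← Set.inter_eq_left.2 hsub, ← Measure.restrict_restrict h1, volumeForm_restrict hQ, h2]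
  congr 1
  refine withDensity_congr_ae ((ae_restrict_iff' hB).2 (Eventually.of_forall fun w hw => ?_))
  simp only [neg_curvature_eq hQ (hmaps hw)]

/-- Compactness reduces the claim to a neighbourhood of each point, where the density is continuous
and hence bounded on a small ball. -/
theorem isFiniteMeasure_volumeForm (hQ : Q.IsPositive) : IsFiniteMeasure Q.volumeForm := by
  refine ⟨isCompact_univ.measure_lt_top_of_nhdsWithin fun x _ => ?_⟩
  rw [nhdsWithin_univ]
  set z := chartAt (Fin n → ℂ) x x with hz
  have hzD : z ∈ chartDomain n F x := chart_mem_chartDomain (mem_frameDomain_self x)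
  have hc := (continuousAt_det_levi hQ hzD).norm
  have hb : ∀ᶠ w in 𝓝 z, ‖(bilinMatrix (Q.levi x w)).det‖
      < ‖(bilinMatrix (Q.levi x z)).det‖ + 1 := hc.eventually_lt_const (by linarith)
  obtain ⟨r, hr, hball⟩ := Metric.eventually_nhds_iff_ball.1
    (hb.and ((isOpen_chartDomain x).eventually_mem hzD))
  obtain ⟨h1, h2⟩ := volumeForm_restrict_image hQ x (B := Metric.ball z r)
    Metric.isOpen_ball.measurableSet (Φ := id) (fun w _ => differentiableAt_id)
    (Set.injOn_id _) (fun w hw => (hball w hw).2)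
  set κ := fun w => (chartAt (Fin n → ℂ) x).symm (id w) with hκ
  refine ⟨κ '' Metric.ball z r, ?_, ?_⟩
  · have : κ '' Metric.ball z r = (chartAt (Fin n → ℂ) x).symm '' Metric.ball z r := rfl
    rw [this]
    have hx : x = (chartAt (Fin n → ℂ) x).symm z :=
      ((chartAt (Fin n → ℂ) x).left_inv (mem_chart_source _ x)).symm
    conv_lhs => rw [hx]
    exact (chartAt (Fin n → ℂ) x).symm.image_mem_nhds hzD.1 (Metric.ball_mem_nhds z hr)
  · have h3 := congrArg (fun m => m Set.univ) h2
    simp only [Measure.restrict_apply_univ] at h3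
    rw [h3]
    have hcont : ContinuousOn κ (Metric.ball z r) :=
      (chartAt (Fin n → ℂ) x).continuousOn_symm.mono fun w hw => (hball w hw).2.1
    rw [Measure.map_apply_of_aemeasurable ((hcont.aemeasurable
      Metric.isOpen_ball.measurableSet).mono_ac
      (withDensity_absolutelyContinuous _ _)) MeasurableSet.univ, Set.preimage_univ,
      withDensity_apply', Measure.restrict_univ]
    refine lt_of_le_of_lt (setLIntegral_mono (g := fun _ =>
      ENNReal.ofReal (‖(bilinMatrix (Q.levi x z)).det‖ + 1)) measurable_const fun w hw => ?_) ?_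
    · refine ENNReal.ofReal_le_ofReal ?_
      have h5 := (Complex.re_le_norm (bilinMatrix (Q.levi x w)).det).trans (hball w hw).1.le
      simpa [ContinuousLinearMap.det, fderiv_id] using h5
    · rw [setLIntegral_const]
      exact ENNReal.mul_lt_top ENNReal.ofReal_lt_top Metric.isBounded_ball.measure_lt_top

end HermitianAlgebraicFunction

/-! ### Bochner coordinates -/

section NormalCoordinates

variable {n : ℕ}

/-- The coordinate vector of `∂_v log r` at `(z, b)`, as a function of `(b, z)`. -/
def logGradVec (r : (Fin n → ℂ) × (Fin n → ℂ) → ℂ) (a : (Fin n → ℂ) × (Fin n → ℂ)) : Fin n → ℂ :=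
  fun j => logGradSnd r (a.2, a.1) (Pi.single j 1)

theorem logGradSnd_apply_eq (r : (Fin n → ℂ) × (Fin n → ℂ) → ℂ) (z b k : Fin n → ℂ) :
    logGradSnd r (z, b) k = logGradVec r (b, z) ⬝ᵥ k := by
  have e : k = ∑ i, k i • (Pi.single i 1 : Fin n → ℂ) := by
    simpa using (Finset.univ_sum_single k).symm.trans
      (Finset.sum_congr rfl fun i _ => by rw [← Pi.single_smul]; simp)
  conv_lhs => rw [e]
  simp [map_sum, dotProduct, logGradVec, mul_comm]

theorem analyticAt_logGradVec {r : (Fin n → ℂ) × (Fin n → ℂ) → ℂ} {a : (Fin n → ℂ) × (Fin n → ℂ)}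
    (hr : AnalyticAt ℂ r (a.2, a.1)) (h0 : r (a.2, a.1) ≠ 0) :
    AnalyticAt ℂ (logGradVec r) a := by
  refine AnalyticAt.pi fun j => ?_
  have h1 : AnalyticAt ℂ (fun a : (Fin n → ℂ) × (Fin n → ℂ) => logGradSnd r (a.2, a.1)) a :=
    AnalyticAt.fun_comp (g := logGradSnd r) (f := fun a : (Fin n → ℂ) × (Fin n → ℂ) => (a.2, a.1))
      (analyticAt_logGradSnd hr h0) (analyticAt_snd.prod analyticAt_fst)
  exact ((ContinuousLinearMap.apply ℂ ℂ (Pi.single j (1 : ℂ) : Fin n → ℂ)).analyticAt _).comp h1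

/-- The derivative in `z` is the Levi matrix acting on row vectors; its invertibility is what the
inverse function theorem needs in `exists_normal_coordinates`. -/
theorem fderiv_logGradVec_snd {r : (Fin n → ℂ) × (Fin n → ℂ) → ℂ} {a : (Fin n → ℂ) × (Fin n → ℂ)}
    (hr : AnalyticAt ℂ r (a.2, a.1)) (h0 : r (a.2, a.1) ≠ 0) (ζ : Fin n → ℂ) :
    fderiv ℂ (logGradVec r) a (0, ζ) = Matrix.vecMul ζ (bilinMatrix (logHess r (a.2, a.1))) := by
  have hs := (analyticAt_logGradSnd hr h0).differentiableAt.hasFDerivAt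
  have hsw : HasFDerivAt (fun a : (Fin n → ℂ) × (Fin n → ℂ) => (a.2, a.1))
      ((ContinuousLinearMap.snd ℂ (Fin n → ℂ) (Fin n → ℂ)).prod
        (ContinuousLinearMap.fst ℂ (Fin n → ℂ) (Fin n → ℂ))) a :=
    hasFDerivAt_snd.prodMk hasFDerivAt_fst
  have h1 := HasFDerivAt.comp a (g := logGradSnd r) hs hsw
  ext j
  have h2 : HasFDerivAt (fun a => logGradVec r a j) _ a :=
    (ContinuousLinearMap.apply ℂ ℂ (Pi.single j (1 : ℂ) : Fin n → ℂ)).hasFDerivAt.comp a h1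
  have h3 : HasFDerivAt (fun a => logGradVec r a j)
      ((ContinuousLinearMap.proj j).comp (fderiv ℂ (logGradVec r) a)) a :=
    (ContinuousLinearMap.proj (R := ℂ) (φ := fun _ : Fin n => ℂ) j).hasFDerivAt.comp a
      (analyticAt_logGradVec hr h0).differentiableAt.hasFDerivAt
  have h4 := congrArg (fun T => T ((0 : Fin n → ℂ), ζ)) (h3.unique h2)
  have h5 : fderiv ℂ (logGradVec r) a (0, ζ) j
      = logHess r (a.2, a.1) ζ (Pi.single j 1) := h4
  rw [h5, bilin_eq_dotProduct, Matrix.mulVec_single_one]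
  rfl

/-- Holomorphic coordinates `Φ x` centred at each point `x` near `p`, in which `∂_v log r (·, x̄)`
is an affine function. -/
theorem exists_normal_coordinates {r : (Fin n → ℂ) × (Fin n → ℂ) → ℂ} {p : Fin n → ℂ}
    (hr : AnalyticAt ℂ r (p, star p)) (h0 : r (p, star p) ≠ 0)
    (hdet : (bilinMatrix (logHess r (p, star p))).det ≠ 0) :
    ∃ Φ : (Fin n → ℂ) → (Fin n → ℂ) → (Fin n → ℂ),
      Tendsto (fun q : (Fin n → ℂ) × (Fin n → ℂ) => Φ q.1 q.2) (𝓝 (p, 0)) (𝓝 p) ∧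
      ContinuousAt (fun q : (Fin n → ℂ) × (Fin n → ℂ) => fderiv ℂ (Φ q.1) q.2) (p, 0) ∧
      (∀ᶠ q : (Fin n → ℂ) × (Fin n → ℂ) in 𝓝 (p, 0), AnalyticAt ℂ (Φ q.1) q.2) ∧
      (∀ᶠ q : (Fin n → ℂ) × (Fin n → ℂ) in 𝓝 (p, 0), ∀ k, logGradSnd r (Φ q.1 q.2, star q.1) k
        = logGradSnd r (q.1, star q.1) k + q.2 ⬝ᵥ k) ∧
      (∀ᶠ x in 𝓝 p, Φ x 0 = x) ∧
      ∀ ρ > 0, ∀ᶠ q : (Fin n → ℂ) × (Fin n → ℂ) in 𝓝 (p, p),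
        ∃ w ∈ Metric.ball (0 : Fin n → ℂ) ρ, Φ q.1 w = q.2 := by
  -- For fixed `b`, the map z ↦ ∂_v log r(z, b) gives the wanted coordinates up to a translation.
  -- Carrying `b` along as a parameter lets one inverse function theorem serve all centres near `p`.
  set T : (Fin n → ℂ) × (Fin n → ℂ) → (Fin n → ℂ) × (Fin n → ℂ) :=
    fun a => (a.1, logGradVec r a) with hT
  have av : AnalyticAt ℂ (logGradVec r) (star p, p) := analyticAt_logGradVec hr h0
  have aT : AnalyticAt ℂ T (star p, p) := analyticAt_fst.prod av
  have dT : HasFDerivAt T ((ContinuousLinearMap.fst ℂ (Fin n → ℂ) (Fin n → ℂ)).prod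
      (fderiv ℂ (logGradVec r) (star p, p))) (star p, p) :=
    hasFDerivAt_fst.prodMk av.differentiableAt.hasFDerivAt
  set T' := (ContinuousLinearMap.fst ℂ (Fin n → ℂ) (Fin n → ℂ)).prod
      (fderiv ℂ (logGradVec r) (star p, p)) with hT'
  have inj : Function.Injective T'.toLinearMap := by
    rw [injective_iff_map_eq_zero]
    rintro ⟨β, ζ⟩ h
    have h1 : β = 0 := congrArg Prod.fst h
    subst h1
    have h2 : fderiv ℂ (logGradVec r) (star p, p) (0, ζ) = 0 := congrArg Prod.snd h
    rw [fderiv_logGradVec_snd hr h0] at h2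
    have h3 : ζ = 0 := Matrix.eq_zero_of_vecMul_eq_zero hdet h2
    rw [h3]; rfl
  set e' := (LinearEquiv.ofInjectiveEndo T'.toLinearMap inj).toContinuousLinearEquiv with he'
  have he'T : (e' : (Fin n → ℂ) × (Fin n → ℂ) →L[ℂ] (Fin n → ℂ) × (Fin n → ℂ)) = T' := by
    ext1 <;> rfl
  have hstrict : HasStrictFDerivAt T
      (e' : (Fin n → ℂ) × (Fin n → ℂ) →L[ℂ] (Fin n → ℂ) × (Fin n → ℂ)) (star p, p) := by
    rw [he'T, ← dT.fderiv]
    exact aT.hasStrictFDerivAt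
  set e := hstrict.toOpenPartialHomeomorph T with he
  have heT : ∀ a, e a = T a := fun a => rfl
  have hsrc : (star p, p) ∈ e.source := hstrict.mem_toOpenPartialHomeomorph_source
  have htgt : T (star p, p) ∈ e.target := hstrict.image_mem_toOpenPartialHomeomorph_target
  have hsymm : e.symm (T (star p, p)) = (star p, p) := e.left_inv hsrc
  have aS : AnalyticAt ℂ e.symm (T (star p, p)) := by
    have : ContDiffAt ℂ ω e.symm (T (star p, p)) := by
      refine e.contDiffAt_symm (f₀' := e') htgt ?_ ?_
      · rw [hsymm]; exact hstrict.hasFDerivAt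
      · rw [hsymm]; exact aT.contDiffAt
    exact this.analyticAt
  -- The centre enters through `star q.1`, so the coordinates are holomorphic in `w` but depend on
  -- the centre only real-analytically. At `w = 0` this is `T (star x, x)`, whence `Φ x 0 = x`.
  set G : (Fin n → ℂ) × (Fin n → ℂ) → (Fin n → ℂ) × (Fin n → ℂ) :=
    fun q => (star q.1, logGradVec r (star q.1, q.1) + q.2) with hG
  have hGp : G (p, 0) = T (star p, p) := by simp [hG, hT]
  have cstar : ContinuousAt (fun q : (Fin n → ℂ) × (Fin n → ℂ) => (star q.1, q.1)) (p, 0) := by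
    fun_prop
  have cv : ContinuousAt (fun q : (Fin n → ℂ) × (Fin n → ℂ) => logGradVec r (star q.1, q.1))
      (p, 0) := ContinuousAt.comp (g := logGradVec r) (x := (p, (0 : Fin n → ℂ)))
        av.continuousAt cstar
  have cG : Tendsto G (𝓝 (p, 0)) (𝓝 (T (star p, p))) := by
    rw [← hGp]
    have c1 : ContinuousAt (fun q : (Fin n → ℂ) × (Fin n → ℂ) => star q.1) (p, 0) := by fun_prop
    exact c1.prodMk (cv.add continuousAt_snd)
  set S : (Fin n → ℂ) × (Fin n → ℂ) → Fin n → ℂ := fun a => (e.symm a).2 with hS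
  have aS2 : AnalyticAt ℂ S (T (star p, p)) := analyticAt_snd.comp aS
  have hGd : ∀ q : (Fin n → ℂ) × (Fin n → ℂ), HasFDerivAt (fun w => G (q.1, w))
      (ContinuousLinearMap.inr ℂ (Fin n → ℂ) (Fin n → ℂ)) q.2 := by
    intro q
    have h1 : HasFDerivAt (fun w : Fin n → ℂ => logGradVec r (star q.1, q.1) + w)
        (ContinuousLinearMap.id ℂ (Fin n → ℂ)) q.2 := (hasFDerivAt_id q.2).const_add _
    exact (hasFDerivAt_const (star q.1) q.2).prodMk h1
  refine ⟨fun x w => S (G (x, w)), ?_, ?_, ?_, ?_, ?_, ?_⟩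
  · have := aS2.continuousAt.tendsto.comp cG
    have h2 : S (T (star p, p)) = p := by rw [hS]; simp only [hsymm]
    rw [h2] at this
    exact this
  · have hd : (fun q : (Fin n → ℂ) × (Fin n → ℂ) => fderiv ℂ (fun w => S (G (q.1, w))) q.2)
        =ᶠ[𝓝 (p, 0)] fun q => (fderiv ℂ S (G q)).comp
          (ContinuousLinearMap.inr ℂ (Fin n → ℂ) (Fin n → ℂ)) := by
      filter_upwards [cG.eventually aS2.eventually_analyticAt] with q hq
      exact (HasFDerivAt.comp q.2 (g := S) (f := fun w => G (q.1, w))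
        hq.differentiableAt.hasFDerivAt (hGd q)).fderiv
    refine ContinuousAt.congr ?_ hd.symm
    have h3 : ContinuousAt (fun q => fderiv ℂ S (G q)) (p, 0) := by
      have h4 : ContinuousAt (fderiv ℂ S) (G (p, 0)) := by
        rw [hGp]; exact aS2.fderiv.continuousAt
      have h5 : ContinuousAt G (p, 0) := by rw [ContinuousAt, hGp]; exact cG
      exact ContinuousAt.comp (g := fderiv ℂ S) (f := G) h4 h5
    have h6 : ContinuousAt (fun _ : (Fin n → ℂ) × (Fin n → ℂ) =>
      ContinuousLinearMap.inr ℂ (Fin n → ℂ) (Fin n → ℂ)) (p, 0) := continuousAt_const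
    exact h3.clm_comp h6
  · filter_upwards [cG.eventually aS2.eventually_analyticAt] with q hq
    refine AnalyticAt.fun_comp (g := S) (f := fun w => G (q.1, w)) hq ?_
    have h7 : AnalyticAt ℂ (fun w : Fin n → ℂ => logGradVec r (star q.1, q.1) + w) q.2 :=
      (analyticAt_const (v := logGradVec r (star q.1, q.1))).fun_add analyticAt_id
    exact (analyticAt_const (v := star q.1)).prod h7
  · filter_upwards [cG.eventually (e.open_target.eventually_mem htgt)] with q hq k
    have h1 : T (e.symm (G q)) = G q := e.right_inv hq
    have h2 : (e.symm (G q)).1 = star q.1 := congrArg Prod.fst h1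
    have h3 : logGradVec r (e.symm (G q)) = logGradVec r (star q.1, q.1) + q.2 :=
      congrArg Prod.snd h1
    have h4 : e.symm (G q) = (star q.1, S (G q)) := Prod.ext h2 rfl
    rw [logGradSnd_apply_eq, logGradSnd_apply_eq, ← add_dotProduct, ← h3, h4]
  · have c2 : Tendsto (fun x : Fin n → ℂ => (star x, x)) (𝓝 p) (𝓝 (star p, p)) := by
      have : Continuous (fun x : Fin n → ℂ => (star x, x)) := by fun_prop
      exact this.tendsto p
    filter_upwards [c2.eventually (e.open_source.eventually_mem hsrc)] with x hx
    have h1 : G (x, 0) = e (star x, x) := by simp [hG, heT, hT]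
    simp only [hS, h1, e.left_inv hx]
  · intro ρ hρ
    have c3 : Tendsto (fun q : (Fin n → ℂ) × (Fin n → ℂ) => (star q.1, q.2)) (𝓝 (p, p))
        (𝓝 (star p, p)) := by
      have : Continuous (fun q : (Fin n → ℂ) × (Fin n → ℂ) => (star q.1, q.2)) := by fun_prop
      exact this.tendsto (p, p)
    have c4 : Tendsto (fun q : (Fin n → ℂ) × (Fin n → ℂ) => (star q.1, q.1)) (𝓝 (p, p))
        (𝓝 (star p, p)) := by
      have : Continuous (fun q : (Fin n → ℂ) × (Fin n → ℂ) => (star q.1, q.1)) := by fun_prop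
      exact this.tendsto (p, p)
    -- The coordinate of `y` in the system centred at `x` is the difference of the gradients at `y`
    -- and at `x`, which tends to 0 as both points tend to `p`.
    have c5 : Tendsto (fun q : (Fin n → ℂ) × (Fin n → ℂ) =>
        logGradVec r (star q.1, q.2) - logGradVec r (star q.1, q.1)) (𝓝 (p, p)) (𝓝 0) := by
      have := (av.continuousAt.tendsto.comp c3).sub (av.continuousAt.tendsto.comp c4)
      rw [sub_self] at this
      exact this
    filter_upwards [c3.eventually (e.open_source.eventually_mem hsrc),
      c5.eventually (Metric.ball_mem_nhds 0 hρ)] with q h1 h2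
    refine ⟨_, h2, ?_⟩
    have h3 : G (q.1, logGradVec r (star q.1, q.2) - logGradVec r (star q.1, q.1))
        = e (star q.1, q.2) := by simp [hG, heT, hT]
    simp only [hS, h3, e.left_inv h1]

end NormalCoordinates

/-! ### Estimates in Bochner coordinates -/

section BochnerEstimates

variable {n : ℕ}

theorem differentiableAt_det {E : Type*} [NormedAddCommGroup E] [NormedSpace ℂ E]
    {A : E → Matrix (Fin n) (Fin n) ℂ} {a : E}
    (h : ∀ i j, DifferentiableAt ℂ (fun b => A b i j) a) :
    DifferentiableAt ℂ (fun b => (A b).det) a := by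
  simp only [Matrix.det_apply]
  refine DifferentiableAt.fun_sum fun σ _ => DifferentiableAt.const_smul ?_ _
  exact (HasFDerivAt.finsetProd fun i _ => (h (σ i) i).hasFDerivAt).differentiableAt

theorem differentiableAt_det_logHess {f : (Fin n → ℂ) × (Fin n → ℂ) → ℂ}
    {q : (Fin n → ℂ) × (Fin n → ℂ)} (hf : AnalyticAt ℂ f q) (h0 : f q ≠ 0) :
    DifferentiableAt ℂ (fun q => (bilinMatrix (logHess f q)).det) q :=
  differentiableAt_det fun _ _ => ((analyticAt_logHess hf h0).differentiableAt.clm_apply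
    (differentiableAt_const _)).clm_apply (differentiableAt_const _)

theorem exists_lower_bound_of_posDef {T : (Fin n → ℂ) →L[ℂ] (Fin n → ℂ) →L[ℂ] ℂ}
    (hT : (bilinMatrix T).PosDef) : ∃ c > 0, ∀ w, c * ‖w‖ ^ 2 ≤ (T w (star w)).re := by
  have hpos : ∀ w ≠ 0, 0 < (T w (star w)).re := by
    intro w hw
    have h1 := hT.dotProduct_mulVec_pos (x := star w) (by simpa using hw)
    rw [star_star, ← bilin_eq_dotProduct] at h1
    exact (Complex.lt_def.1 h1).1
  have hcont : Continuous fun w : Fin n → ℂ => (T w (star w)).re := by fun_prop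
  have hcomp : IsCompact (Metric.sphere (0 : Fin n → ℂ) 1) := isCompact_sphere _ _
  have hhom : ∀ (t : ℝ) (w : Fin n → ℂ),
      (T ((t : ℂ) • w) (star ((t : ℂ) • w))).re = t ^ 2 * (T w (star w)).re := by
    intro t w
    have h2 : star ((t : ℂ) • w) = (t : ℂ) • star w := by rw [star_smul]; simp
    rw [h2, map_smul, map_smul, smul_apply, smul_smul, smul_eq_mul, ← pow_two,
      ← Complex.ofReal_pow, Complex.re_ofReal_mul]
  -- The unit sphere is empty when `n = 0`.
  rcases (Metric.sphere (0 : Fin n → ℂ) 1).eq_empty_or_nonempty with he | hne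
  · refine ⟨1, one_pos, fun w => ?_⟩
    have hw : w = 0 := by
      by_contra hw
      have : ((‖w‖⁻¹ : ℝ) : ℂ) • w ∈ Metric.sphere (0 : Fin n → ℂ) 1 := by
        simp [norm_smul, hw]
      rw [he] at this
      exact this
    simp [hw]
  · obtain ⟨w₀, hw₀, hmin⟩ := hcomp.exists_isMinOn hne hcont.continuousOn
    refine ⟨_, hpos w₀ (by rintro rfl; simp at hw₀), fun w => ?_⟩
    by_cases hw : w = 0
    · simp [hw]
    · have hmem : ((‖w‖⁻¹ : ℝ) : ℂ) • w ∈ Metric.sphere (0 : Fin n → ℂ) 1 := by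
        simp [norm_smul, hw]
      have h3 := hmin hmem
      simp only [Set.mem_ofPred_eq] at h3
      rw [hhom] at h3
      have h4 : (0 : ℝ) < ‖w‖ ^ 2 := by positivity
      calc _ ≤ (‖w‖⁻¹ ^ 2 * (T w (star w)).re) * ‖w‖ ^ 2 := by gcongr
        _ = _ := by field_simp

/-- The exponential of the polarized diastasis of `r` centred at `φ 0`, in the coordinates `φ`. -/
def bochnerFun (r : (Fin n → ℂ) × (Fin n → ℂ) → ℂ) (φ : (Fin n → ℂ) → Fin n → ℂ)
    (q : (Fin n → ℂ) × (Fin n → ℂ)) : ℂ :=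
  (r (φ 0, star (φ 0)) / r (φ q.1, star (φ 0))) * (r (φ 0, star (φ (star q.2))))⁻¹
    * r (φ q.1, star (φ (star q.2)))

/-- The polarized density of the volume form of `r`, weighted by the inverse of the Bochner function
of `e`, in the coordinates `φ`. -/
def weightedDensity (r e : (Fin n → ℂ) × (Fin n → ℂ) → ℂ) (φ : (Fin n → ℂ) → Fin n → ℂ)
    (q : (Fin n → ℂ) × (Fin n → ℂ)) : ℂ :=
  (bochnerFun e φ q)⁻¹ * ((fderiv ℂ φ q.1).det
    * (bilinMatrix (logHess r (φ q.1, star (φ (star q.2))))).det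
    * conj (fderiv ℂ φ (star q.2)).det)

/-- `φ` is a Bochner coordinate system for `r` centred at `x`, with the uniform bounds needed
below. -/
structure IsBochnerChart (r e : (Fin n → ℂ) × (Fin n → ℂ) → ℂ) (x : Fin n → ℂ)
    (φ : (Fin n → ℂ) → Fin n → ℂ) (ρ M : ℝ) : Prop where
  radius_pos : 0 < ρ
  r_hermitian : ∀ a, r a = conj (r (star a.2, star a.1))
  e_hermitian : ∀ a, e a = conj (e (star a.2, star a.1))
  map_zero : φ 0 = x
  analytic : ∀ w ∈ Metric.ball (0 : Fin n → ℂ) ρ, AnalyticAt ℂ φ w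
  grad : ∀ w ∈ Metric.ball (0 : Fin n → ℂ) ρ, ∀ k,
    logGradSnd r (φ w, star x) k = logGradSnd r (x, star x) k + w ⬝ᵥ k
  r_analytic : ∀ w ∈ Metric.ball (0 : Fin n → ℂ) ρ, ∀ w' ∈ Metric.ball (0 : Fin n → ℂ) ρ,
    AnalyticAt ℂ r (φ w, star (φ w')) ∧ r (φ w, star (φ w')) ≠ 0
  e_analytic : ∀ w ∈ Metric.ball (0 : Fin n → ℂ) ρ, ∀ w' ∈ Metric.ball (0 : Fin n → ℂ) ρ,
    AnalyticAt ℂ e (φ w, star (φ w')) ∧ e (φ w, star (φ w')) ≠ 0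
  slit : ∀ w ∈ Metric.ball (0 : Fin n → ℂ) ρ, ∀ w' ∈ Metric.ball (0 : Fin n → ℂ) ρ,
    bochnerFun r φ (w, star w') ∈ Complex.slitPlane ∧
      ‖Complex.log (bochnerFun r φ (w, star w'))‖ ≤ 1
  density_le : ∀ w ∈ Metric.ball (0 : Fin n → ℂ) ρ, ∀ w' ∈ Metric.ball (0 : Fin n → ℂ) ρ,
    ‖weightedDensity r e φ (w, star w')‖ ≤ M
  fderiv_le : ‖fderiv ℂ φ 0‖ ≤ M
  posDef : (bilinMatrix (logHess r (x, star x))).PosDef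

theorem bochnerFun_hermitian {r : (Fin n → ℂ) × (Fin n → ℂ) → ℂ} {φ : (Fin n → ℂ) → Fin n → ℂ}
    (hr : ∀ a, r a = conj (r (star a.2, star a.1))) (a : (Fin n → ℂ) × (Fin n → ℂ)) :
    bochnerFun r φ a = conj (bochnerFun r φ (star a.2, star a.1)) := by
  have h : ∀ u v, conj (r (u, star v)) = r (v, star u) := fun u v => by
    rw [hr (v, star u)]; simp
  simp only [bochnerFun, map_mul, map_div₀, map_inv₀, star_star, h]
  ring

theorem det_conj_transpose_bilinMatrix {T S : (Fin n → ℂ) →L[ℂ] (Fin n → ℂ) →L[ℂ] ℂ}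
    (h : ∀ x y, T x y = conj (S (star y) (star x))) :
    (bilinMatrix T).det = conj (bilinMatrix S).det := by
  have h1 : bilinMatrix T = (bilinMatrix S).conjTranspose := by
    ext i j
    simp [bilinMatrix, h]
  rw [h1, Matrix.det_conjTranspose]
  rfl

theorem conjCLM_star_fderiv {φ : (Fin n → ℂ) → Fin n → ℂ} {w : Fin n → ℂ}
    (h : DifferentiableAt ℂ φ (star w)) :
    HasFDerivAt (fun v => star (φ (star v))) (conjCLM (fderiv ℂ φ (star w))) w := by
  simpa using hasFDerivAt_conj_conj h

namespace IsBochnerChart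

variable {r e : (Fin n → ℂ) × (Fin n → ℂ) → ℂ} {x : Fin n → ℂ} {φ : (Fin n → ℂ) → Fin n → ℂ}
  {ρ M : ℝ}

theorem zero_mem (h : IsBochnerChart r e x φ ρ M) :
    (0 : Fin n → ℂ) ∈ Metric.ball (0 : Fin n → ℂ) ρ :=
  Metric.mem_ball_self h.radius_pos

theorem star_mem {w : Fin n → ℂ} (hw : w ∈ Metric.ball (0 : Fin n → ℂ) ρ) :
    star w ∈ Metric.ball (0 : Fin n → ℂ) ρ := by simpa using hw

theorem analyticAt_comp {f : (Fin n → ℂ) × (Fin n → ℂ) → ℂ}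
    (h : IsBochnerChart r e x φ ρ M) {w w' : Fin n → ℂ} (hw : w ∈ Metric.ball (0 : Fin n → ℂ) ρ)
    (hw' : w' ∈ Metric.ball (0 : Fin n → ℂ) ρ) (hf : AnalyticAt ℂ f (φ w, star (φ (star w')))) :
    AnalyticAt ℂ (fun q : (Fin n → ℂ) × (Fin n → ℂ) => f (φ q.1, star (φ (star q.2)))) (w, w') := by
  have a1 : AnalyticAt ℂ (fun q : (Fin n → ℂ) × (Fin n → ℂ) => φ q.1) (w, w') :=
    AnalyticAt.fun_comp (g := φ) (f := Prod.fst) (x := (w, w')) (h.analytic w hw) analyticAt_fst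
  have a2 : AnalyticAt ℂ (fun v => star (φ (star v))) w' := by
    simpa using (h.analytic _ (star_mem hw')).conj_conj
  have a3 : AnalyticAt ℂ (fun q : (Fin n → ℂ) × (Fin n → ℂ) => star (φ (star q.2))) (w, w') :=
    AnalyticAt.fun_comp (f := Prod.snd) (x := (w, w')) a2 analyticAt_snd
  exact AnalyticAt.fun_comp (g := f) (f := fun q : (Fin n → ℂ) × (Fin n → ℂ) =>
    (φ q.1, star (φ (star q.2)))) (x := (w, w')) hf (a1.prod a3)

theorem analyticAt_left {f : (Fin n → ℂ) × (Fin n → ℂ) → ℂ}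
    (h : IsBochnerChart r e x φ ρ M) {w : Fin n → ℂ} {v : Fin n → ℂ}
    (hw : w ∈ Metric.ball (0 : Fin n → ℂ) ρ) (hf : AnalyticAt ℂ f (φ w, v)) :
    AnalyticAt ℂ (fun w => f (φ w, v)) w :=
  AnalyticAt.fun_comp (g := f) (f := fun w => (φ w, v)) hf ((h.analytic w hw).prod analyticAt_const)

theorem analyticAt_right {f : (Fin n → ℂ) × (Fin n → ℂ) → ℂ}
    (h : IsBochnerChart r e x φ ρ M) {w : Fin n → ℂ} {u : Fin n → ℂ}
    (hw : w ∈ Metric.ball (0 : Fin n → ℂ) ρ) (hf : AnalyticAt ℂ f (u, star (φ (star w)))) :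
    AnalyticAt ℂ (fun w => f (u, star (φ (star w)))) w := by
  have a2 : AnalyticAt ℂ (fun v => star (φ (star v))) w := by
    simpa using (h.analytic _ (star_mem hw)).conj_conj
  exact AnalyticAt.fun_comp (g := f) (f := fun w => (u, star (φ (star w)))) hf
    (analyticAt_const.prod a2)

theorem analyticAt_bochnerFun_of {f : (Fin n → ℂ) × (Fin n → ℂ) → ℂ}
    (h : IsBochnerChart r e x φ ρ M)
    (hf : ∀ w ∈ Metric.ball (0 : Fin n → ℂ) ρ, ∀ w' ∈ Metric.ball (0 : Fin n → ℂ) ρ,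
      AnalyticAt ℂ f (φ w, star (φ w')) ∧ f (φ w, star (φ w')) ≠ 0) {w w' : Fin n → ℂ}
    (hw : w ∈ Metric.ball (0 : Fin n → ℂ) ρ) (hw' : w' ∈ Metric.ball (0 : Fin n → ℂ) ρ) :
    AnalyticAt ℂ (bochnerFun f φ) (w, w') ∧ bochnerFun f φ (w, w') ≠ 0 := by
  have h1 := hf w hw 0 h.zero_mem
  have h2 := hf 0 h.zero_mem _ (star_mem hw')
  have h3 := hf w hw _ (star_mem hw')
  have h4 := hf 0 h.zero_mem 0 h.zero_mem
  constructor
  · have a1 : AnalyticAt ℂ (fun w => f (φ 0, star (φ 0)) / f (φ w, star (φ 0))) w :=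
      analyticAt_const.div (h.analyticAt_left hw h1.1) h1.2
    have a2 : AnalyticAt ℂ (fun w => (f (φ 0, star (φ (star w))))⁻¹) w' :=
      (h.analyticAt_right hw' h2.1).inv h2.2
    have a3 := h.analyticAt_comp hw hw' h3.1
    exact ((AnalyticAt.fun_comp (f := Prod.fst) (x := (w, w')) a1 analyticAt_fst).mul
      (AnalyticAt.fun_comp (f := Prod.snd) (x := (w, w')) a2 analyticAt_snd)).mul a3
  · exact mul_ne_zero (mul_ne_zero (div_ne_zero h4.2 h1.2) (inv_ne_zero h2.2)) h3.2

/-- The normalizing factors each depend on one variable only, so the mixed Hessian does not see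
them. -/
theorem logHess_bochnerFun (h : IsBochnerChart r e x φ ρ M) {w w' : Fin n → ℂ}
    (hw : w ∈ Metric.ball (0 : Fin n → ℂ) ρ) (hw' : w' ∈ Metric.ball (0 : Fin n → ℂ) ρ)
    (u v : Fin n → ℂ) :
    logHess (bochnerFun r φ) (w, w') u v = logHess r (φ w, star (φ (star w')))
      (fderiv ℂ φ w u) (conjCLM (fderiv ℂ φ (star w')) v) := by
  have h1 := h.r_analytic w hw 0 h.zero_mem
  have h2 := h.r_analytic 0 h.zero_mem _ (star_mem hw')
  have h3 := h.r_analytic w hw _ (star_mem hw')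
  have h4 := h.r_analytic 0 h.zero_mem 0 h.zero_mem
  have a2 : AnalyticAt ℂ (fun v => star (φ (star v))) w' := by
    simpa using (h.analytic _ (star_mem hw')).conj_conj
  have := logHess_comp (f := r) (α := φ) (β := fun v => star (φ (star v)))
    (g := fun w => r (φ 0, star (φ 0)) / r (φ w, star (φ 0)))
    (h := fun w => (r (φ 0, star (φ (star w))))⁻¹) h3.1 h3.2 (h.analytic w hw) a2
    (analyticAt_const.div (h.analyticAt_left hw h1.1) h1.2)
    ((h.analyticAt_right hw' h2.1).inv h2.2) (div_ne_zero h4.2 h1.2) (inv_ne_zero h2.2) u v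
  rw [(conjCLM_star_fderiv (h.analytic _ (star_mem hw')).differentiableAt).fderiv] at this
  exact this

/-- The normalizing factor in `w'` subtracts the gradient at the centre, and `grad` says that what
is left is linear in `w`. Hence the terms of the polarized diastasis linear in `w'` are exactly
bilinear, with no higher powers of `w`. -/
theorem logGradSnd_bochnerFun (h : IsBochnerChart r e x φ ρ M) {w : Fin n → ℂ}
    (hw : w ∈ Metric.ball (0 : Fin n → ℂ) ρ) (k : Fin n → ℂ) :
    logGradSnd (bochnerFun r φ) (w, 0) k = w ⬝ᵥ conjCLM (fderiv ℂ φ 0) k := by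
  have h1 := h.r_analytic w hw 0 h.zero_mem
  have h4 := h.r_analytic 0 h.zero_mem 0 h.zero_mem
  have z : star (0 : Fin n → ℂ) = 0 := star_zero _
  have a2 : AnalyticAt ℂ (fun v => star (φ (star v))) 0 := by
    simpa using (h.analytic 0 h.zero_mem).conj_conj
  have d2 : HasFDerivAt (fun v => star (φ (star v))) (conjCLM (fderiv ℂ φ 0)) 0 := by
    have := conjCLM_star_fderiv (φ := φ) (w := 0)
      (by rw [z]; exact (h.analytic 0 h.zero_mem).differentiableAt)
    rwa [z] at this
  have h4' : AnalyticAt ℂ r (φ 0, star (φ (star 0))) := by rw [z]; exact h4.1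
  have key := logGradSnd_comp (f := r) (α := φ) (β := fun v => star (φ (star v)))
    (g := fun w => r (φ 0, star (φ 0)) / r (φ w, star (φ 0)))
    (h := fun w => (r (φ 0, star (φ (star w))))⁻¹) (u := w) (v := 0) (by rw [z]; exact h1.1)
    (by rw [z]; exact h1.2) (h.analytic w hw) a2
    (analyticAt_const.div (h.analyticAt_left hw h1.1) h1.2)
    ((h.analyticAt_right h.zero_mem h4').inv (by rw [z]; exact h4.2)) (div_ne_zero h4.2 h1.2)
    (inv_ne_zero (by rw [z]; exact h4.2))
  have d3 : HasFDerivAt (fun v => (φ 0, star (φ (star v))))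
      ((0 : (Fin n → ℂ) →L[ℂ] (Fin n → ℂ)).prod (conjCLM (fderiv ℂ φ 0))) 0 :=
    (hasFDerivAt_const _ _).prodMk d2
  have d4 := HasFDerivAt.comp (0 : Fin n → ℂ) (g := r) h4'.differentiableAt.hasFDerivAt d3
  have d5 : HasFDerivAt (fun v => (r (φ 0, star (φ (star v))))⁻¹) _ 0 :=
    (hasDerivAt_inv (by rw [z]; exact h4.2)).comp_hasFDerivAt (0 : Fin n → ℂ) d4
  have e0 : logGradSnd (bochnerFun r φ) (w, 0) = _ := key
  rw [e0, d5.fderiv, d2.fderiv, z, add_apply, ContinuousLinearMap.comp_apply, h.map_zero, h.grad w hw]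
  simp only [logGradSnd, smul_apply, ContinuousLinearMap.comp_apply, smul_eq_mul,
    ContinuousLinearMap.prod_apply, ContinuousLinearMap.inr_apply, zero_apply]
  have h5 := h4.2
  rw [h.map_zero] at h5
  field_simp
  ring

/-- This is the affine identity `grad` differentiated in `w`. The right side does not involve the
point `w`: along `w' = 0` the pulled-back Hessian is constant. -/
theorem logHess_fderiv (h : IsBochnerChart r e x φ ρ M) {w : Fin n → ℂ}
    (hw : w ∈ Metric.ball (0 : Fin n → ℂ) ρ) (u k : Fin n → ℂ) :
    logHess r (φ w, star x) (fderiv ℂ φ w u) k = u ⬝ᵥ k := by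
  have h1 := h.r_analytic w hw 0 h.zero_mem
  rw [h.map_zero] at h1
  have d1 : HasFDerivAt (fun w => (φ w, star x)) ((fderiv ℂ φ w).prod 0) w :=
    (h.analytic w hw).differentiableAt.hasFDerivAt.prodMk (hasFDerivAt_const _ _)
  have d2 := HasFDerivAt.comp w (g := logGradSnd r)
    (analyticAt_logGradSnd h1.1 h1.2).differentiableAt.hasFDerivAt d1
  have d3 : HasFDerivAt (fun w => logGradSnd r (φ w, star x) k) _ w :=
    (ContinuousLinearMap.apply ℂ ℂ k).hasFDerivAt.comp w d2
  set dot : (Fin n → ℂ) →L[ℂ] ℂ :=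
    ∑ i, k i • ContinuousLinearMap.proj (R := ℂ) (φ := fun _ : Fin n => ℂ) i with hdot
  have hdot_apply : ∀ w, dot w = w ⬝ᵥ k := fun w => by
    simp [hdot, dotProduct, sum_apply, mul_comm]
  have d4 : HasFDerivAt (fun w => logGradSnd r (x, star x) k + dot w) dot w :=
    dot.hasFDerivAt.const_add _
  have ev : (fun w => logGradSnd r (φ w, star x) k)
      =ᶠ[𝓝 w] fun w => logGradSnd r (x, star x) k + dot w := by
    filter_upwards [Metric.isOpen_ball.eventually_mem hw] with w' hw'
    rw [h.grad w' hw', hdot_apply]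
  have h5 := congrArg (fun T => T u) (d3.unique (d4.congr_of_eventuallyEq ev))
  simp only [hdot_apply] at h5
  rw [← h5]
  rfl

theorem logHess_bochnerFun_zero (h : IsBochnerChart r e x φ ρ M) {w : Fin n → ℂ}
    (hw : w ∈ Metric.ball (0 : Fin n → ℂ) ρ) (u k : Fin n → ℂ) :
    logHess (bochnerFun r φ) (w, 0) u k = u ⬝ᵥ conjCLM (fderiv ℂ φ 0) k := by
  rw [h.logHess_bochnerFun hw h.zero_mem, star_zero, h.map_zero, h.logHess_fderiv hw]

theorem fderiv_injective (h : IsBochnerChart r e x φ ρ M) :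
    Function.Injective (fderiv ℂ φ 0) := by
  rw [injective_iff_map_eq_zero]
  intro u hu
  have : ∀ k, u ⬝ᵥ k = 0 := fun k => by
    rw [← h.logHess_fderiv h.zero_mem u k, hu]; simp
  exact dotProduct_eq_zero _ this

/-- The quadratic part of the diastasis. -/
def form (_ : IsBochnerChart r e x φ ρ M) : (Fin n → ℂ) →L[ℂ] (Fin n → ℂ) →L[ℂ] ℂ :=
  logHess (bochnerFun r φ) (0, 0)

theorem form_apply (h : IsBochnerChart r e x φ ρ M) (u k : Fin n → ℂ) :
    h.form u k = u ⬝ᵥ conjCLM (fderiv ℂ φ 0) k :=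
  h.logHess_bochnerFun_zero h.zero_mem u k

theorem form_posDef (h : IsBochnerChart r e x φ ρ M) : (bilinMatrix h.form).PosDef := by
  have h1 : ∀ u v, h.form u v
      = logHess r (x, star x) (fderiv ℂ φ 0 u) (conjCLM (fderiv ℂ φ 0) v) := fun u v => by
    have := h.logHess_bochnerFun h.zero_mem h.zero_mem u v
    rwa [star_zero, h.map_zero] at this
  rw [bilinMatrix_comp _ _ _ _ h1]
  have h2 := h.posDef.conjTranspose_mul_mul_same
    (B := LinearMap.toMatrix' (conjCLM (fderiv ℂ φ 0)).toLinearMap) (by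
      intro a b hab
      rw [LinearMap.toMatrix'_mulVec, LinearMap.toMatrix'_mulVec] at hab
      have : star (fderiv ℂ φ 0 (star a)) = star (fderiv ℂ φ 0 (star b)) := hab
      exact star_injective (h.fderiv_injective (star_injective this)))
  convert h2 using 2
  congr 1
  rw [toMatrix'_conjCLM]
  ext i j
  simp

theorem form_conj (h : IsBochnerChart r e x φ ρ M) (u v : Fin n → ℂ) :
    h.form u v = conj (h.form (star v) (star u)) := by
  rw [bilin_eq_dotProduct, bilin_eq_dotProduct, ← starRingEnd_self_apply (u ⬝ᵥ _)]
  congr 1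
  have hH := h.form_posDef.isHermitian
  change star (u ⬝ᵥ (bilinMatrix h.form).mulVec v) = _
  rw [Matrix.star_dotProduct, Matrix.star_mulVec, hH.eq, ← Matrix.dotProduct_mulVec, star_star, dotProduct_comm]

end IsBochnerChart

end BochnerEstimates

/-! ### Schwarz lemma bounds for the diastasis and the volume density. -/

section BochnerEstimates

variable {n : ℕ}

/-- `|r(x, ȳ)|² / (r(x, x̄) r(y, ȳ))`. -/
def cosSq (r : (Fin n → ℂ) × (Fin n → ℂ) → ℂ) (x y : Fin n → ℂ) : ℝ :=
  ‖r (x, star y)‖ ^ 2 / ((r (x, star x)).re * (r (y, star y)).re)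

theorem norm_dotProduct_le (x y : Fin n → ℂ) : ‖x ⬝ᵥ y‖ ≤ n * (‖x‖ * ‖y‖) := by
  refine (norm_sum_le _ _).trans ?_
  have : ∀ i ∈ Finset.univ, ‖x i * y i‖ ≤ ‖x‖ * ‖y‖ := fun i _ => by
    rw [norm_mul]
    exact mul_le_mul (norm_le_pi_norm x i) (norm_le_pi_norm y i) (norm_nonneg _) (norm_nonneg _)
  refine (Finset.sum_le_card_nsmul _ _ _ this).trans_eq ?_
  simp

namespace IsBochnerChart

variable {r e : (Fin n → ℂ) × (Fin n → ℂ) → ℂ} {x : Fin n → ℂ} {φ : (Fin n → ℂ) → Fin n → ℂ}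
  {ρ M : ℝ}

theorem bound_nonneg (h : IsBochnerChart r e x φ ρ M) : 0 ≤ M :=
  (norm_nonneg _).trans h.fderiv_le

theorem bochnerFun_right_zero {f : (Fin n → ℂ) × (Fin n → ℂ) → ℂ}
    (h : IsBochnerChart r e x φ ρ M)
    (hf : ∀ w ∈ Metric.ball (0 : Fin n → ℂ) ρ, ∀ w' ∈ Metric.ball (0 : Fin n → ℂ) ρ,
      AnalyticAt ℂ f (φ w, star (φ w')) ∧ f (φ w, star (φ w')) ≠ 0) {w : Fin n → ℂ}
    (hw : w ∈ Metric.ball (0 : Fin n → ℂ) ρ) : bochnerFun f φ (w, 0) = 1 := by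
  have h1 := (hf w hw 0 h.zero_mem).2
  have h2 := (hf 0 h.zero_mem 0 h.zero_mem).2
  simp only [bochnerFun, star_zero]
  field_simp

theorem slit' (h : IsBochnerChart r e x φ ρ M) {w w' : Fin n → ℂ}
    (hw : w ∈ Metric.ball (0 : Fin n → ℂ) ρ) (hw' : w' ∈ Metric.ball (0 : Fin n → ℂ) ρ) :
    bochnerFun r φ (w, w') ∈ Complex.slitPlane ∧ ‖Complex.log (bochnerFun r φ (w, w'))‖ ≤ 1 := by
  have := h.slit w hw (star w') (star_mem hw')
  rwa [star_star] at this

theorem norm_conjCLM_le (h : IsBochnerChart r e x φ ρ M) (v : Fin n → ℂ) :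
    ‖conjCLM (fderiv ℂ φ 0) v‖ ≤ M * ‖v‖ := by
  rw [conjCLM_apply, norm_star]
  refine ((fderiv ℂ φ 0).le_opNorm _).trans ?_
  rw [norm_star]
  exact mul_le_mul_of_nonneg_right h.fderiv_le (norm_nonneg _)

theorem norm_form_le (h : IsBochnerChart r e x φ ρ M) (u v : Fin n → ℂ) :
    ‖h.form u v‖ ≤ n * M * (‖u‖ * ‖v‖) := by
  rw [h.form_apply]
  calc _ ≤ n * (‖u‖ * ‖conjCLM (fderiv ℂ φ 0) v‖) := norm_dotProduct_le _ _
    _ ≤ n * (‖u‖ * (M * ‖v‖)) := by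
      gcongr
      exact h.norm_conjCLM_le v
    _ = _ := by ring

/-- The higher order part of the polarized diastasis. -/
def remainder (h : IsBochnerChart r e x φ ρ M) (w w' : Fin n → ℂ) : ℂ :=
  Complex.log (bochnerFun r φ (w, w')) - h.form w w'

/-- The crude bound from which the Schwarz lemma starts. -/
theorem norm_remainder_le (h : IsBochnerChart r e x φ ρ M) {w w' : Fin n → ℂ}
    (hw : w ∈ Metric.ball (0 : Fin n → ℂ) ρ) (hw' : w' ∈ Metric.ball (0 : Fin n → ℂ) ρ) :
    ‖h.remainder w w'‖ ≤ 1 + n * M * ρ ^ 2 := by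
  refine (norm_sub_le _ _).trans (add_le_add (h.slit' hw hw').2 ((h.norm_form_le _ _).trans ?_))
  have hM := h.bound_nonneg
  have h1 : ‖w‖ ≤ ρ := (mem_ball_zero_iff.1 hw).le
  have h2 : ‖w'‖ ≤ ρ := (mem_ball_zero_iff.1 hw').le
  have h3 := h.radius_pos.le
  rw [pow_two]
  gcongr

/-- Transfers vanishing in the second variable to vanishing in the first. -/
theorem remainder_conj (h : IsBochnerChart r e x φ ρ M) {w w' : Fin n → ℂ}
    (hw : w ∈ Metric.ball (0 : Fin n → ℂ) ρ) (hw' : w' ∈ Metric.ball (0 : Fin n → ℂ) ρ) :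
    h.remainder w w' = conj (h.remainder (star w') (star w)) := by
  have h1 := (h.slit' (star_mem hw') (star_mem hw)).1
  rw [remainder, remainder, map_sub, ← h.form_conj, ← Complex.log_conj _
    (Complex.slitPlane_arg_ne_pi h1), ← bochnerFun_hermitian h.r_hermitian (w, w')]

theorem remainder_right_zero (h : IsBochnerChart r e x φ ρ M) {w : Fin n → ℂ}
    (hw : w ∈ Metric.ball (0 : Fin n → ℂ) ρ) : h.remainder w 0 = 0 := by
  simp [remainder, h.bochnerFun_right_zero h.r_analytic hw]

theorem analyticAt_remainder (h : IsBochnerChart r e x φ ρ M) {w w' : Fin n → ℂ}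
    (hw : w ∈ Metric.ball (0 : Fin n → ℂ) ρ) (hw' : w' ∈ Metric.ball (0 : Fin n → ℂ) ρ) :
    DifferentiableAt ℂ (fun q : (Fin n → ℂ) × (Fin n → ℂ) => h.remainder q.1 q.2) (w, w') := by
  have h1 : DifferentiableAt ℂ (fun q => Complex.log (bochnerFun r φ q)) (w, w') :=
    ((h.analyticAt_bochnerFun_of h.r_analytic hw hw').1.clog (h.slit' hw hw').1).differentiableAt
  have h2 : DifferentiableAt ℂ (fun q : (Fin n → ℂ) × (Fin n → ℂ) => h.form q.1 q.2) (w, w') :=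
    (h.form.differentiableAt.comp (w, w') differentiableAt_fst).clm_apply differentiableAt_snd
  exact h1.sub h2

/-- In `w'` the remainder has value zero at the origin by normalization and derivative zero by
`logGradSnd_bochnerFun`, so the Schwarz lemma of higher order improves the crude bound to a
quadratic one. The constant depends on `n`, `M` and `ρ` only, not on the centre. -/
theorem norm_remainder_le_right (h : IsBochnerChart r e x φ ρ M) {w w' : Fin n → ℂ}
    (hw : w ∈ Metric.ball (0 : Fin n → ℂ) ρ) (hw' : w' ∈ Metric.ball (0 : Fin n → ℂ) ρ) :
    ‖h.remainder w w'‖ ≤ (1 + n * M * ρ ^ 2) * (‖w'‖ / ρ) ^ 2 := by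
  have hz := h.remainder_right_zero hw
  have hd : ∀ v ∈ Metric.ball (0 : Fin n → ℂ) ρ, DifferentiableAt ℂ (h.remainder w) v :=
    fun v hv => (h.analyticAt_remainder hw hv).comp (f := fun v => (w, v)) v
      ((differentiableAt_const w).prodMk differentiableAt_id)
  have ho : (fun v => h.remainder w v - h.remainder w 0) =o[𝓝 0] fun v => ‖v - 0‖ ^ 1 := by
    have hb := (h.analyticAt_bochnerFun_of h.r_analytic hw h.zero_mem).1.differentiableAt.hasFDerivAt
    have d1 : HasFDerivAt (fun v : Fin n → ℂ => (w, v))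
        (ContinuousLinearMap.inr ℂ (Fin n → ℂ) (Fin n → ℂ)) 0 :=
      (hasFDerivAt_const w _).prodMk (hasFDerivAt_id _)
    have d2 : HasFDerivAt (fun v => bochnerFun r φ (w, v)) _ 0 :=
      HasFDerivAt.comp (0 : Fin n → ℂ) (g := bochnerFun r φ) hb d1
    have d3 := (d2.clog (h.slit' hw h.zero_mem).1).sub (h.form w).hasFDerivAt
    have d4 : HasFDerivAt (h.remainder w) (0 : (Fin n → ℂ) →L[ℂ] ℂ) 0 := by
      refine d3.congr_fderiv ?_
      ext1 k
      have := h.logGradSnd_bochnerFun hw k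
      rw [← h.form_apply] at this
      rw [sub_apply, ← this]
      simp [logGradSnd]
    simpa using d4.isLittleO.norm_right
  -- With `n := 1` the hypothesis is `o(‖v‖)` and the resulting exponent is `n + 1 = 2`.
  have := Complex.dist_le_mul_div_pow_of_mapsTo_ball_of_isLittleO (n := 1)
    (R₂ := 1 + n * M * ρ ^ 2)
    (fun v hv => (hd v hv).differentiableWithinAt) (fun v hv => by
      rw [hz, mem_closedBall_zero_iff]
      exact h.norm_remainder_le hw hv) ho hw'
  simpa [hz] using this

/-- By Hermitian symmetry the remainder also vanishes to second order in `w`. Applying the Schwarz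
lemma in `w` to a function already bounded by a multiple of `‖w'‖²` multiplies the two gains, so the
error is of fourth order on the diagonal. -/
theorem norm_remainder_le_mul (h : IsBochnerChart r e x φ ρ M) {w w' : Fin n → ℂ}
    (hw : w ∈ Metric.ball (0 : Fin n → ℂ) ρ) (hw' : w' ∈ Metric.ball (0 : Fin n → ℂ) ρ) :
    ‖h.remainder w w'‖ ≤ (1 + n * M * ρ ^ 2) * (‖w'‖ / ρ) ^ 2 * (‖w‖ / ρ) ^ 2 := by
  have hb : ∀ v ∈ Metric.ball (0 : Fin n → ℂ) ρ,
      ‖h.remainder v w'‖ ≤ (1 + n * M * ρ ^ 2) * (‖v‖ / ρ) ^ 2 := by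
    intro v hv
    rw [h.remainder_conj hv hw', RCLike.norm_conj]
    simpa using h.norm_remainder_le_right (star_mem hw') (star_mem hv)
  have hz : h.remainder 0 w' = 0 := by
    have := hb 0 h.zero_mem
    simpa using this
  have hd : ∀ v ∈ Metric.ball (0 : Fin n → ℂ) ρ,
      DifferentiableAt ℂ (fun v => h.remainder v w') v :=
    fun v hv => (h.analyticAt_remainder hv hw').comp (f := fun v => (v, w')) v
      (differentiableAt_id.prodMk (differentiableAt_const w'))
  have ho : (fun v => h.remainder v w' - h.remainder 0 w') =o[𝓝 0] fun v => ‖v - 0‖ ^ 1 := by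
    have h1 : (fun v => h.remainder v w' - h.remainder 0 w') =O[𝓝 0]
        fun v : Fin n → ℂ => ‖v‖ ^ 2 := by
      refine Asymptotics.IsBigO.of_bound ((1 + n * M * ρ ^ 2) / ρ ^ 2) ?_
      filter_upwards [Metric.isOpen_ball.eventually_mem h.zero_mem] with v hv
      rw [hz, sub_zero]
      refine (hb v hv).trans_eq ?_
      rw [norm_pow, norm_norm]
      ring
    refine h1.trans_isLittleO ?_
    simp only [sub_zero]
    exact (Asymptotics.isLittleO_pow_pow (𝕜 := ℝ) (one_lt_two)).comp_tendsto
      (by simpa using (continuous_norm (E := Fin n → ℂ)).tendsto 0)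
  have := Complex.dist_le_mul_div_pow_of_mapsTo_ball_of_isLittleO (n := 1)
    (R₂ := (1 + n * M * ρ ^ 2) * (‖w'‖ / ρ) ^ 2) (f := fun v => h.remainder v w')
    (fun v hv => (hd v hv).differentiableWithinAt) (fun v hv => by
      simp only [hz, mem_closedBall_zero_iff]
      exact h.norm_remainder_le_right hv hw') ho hw
  simpa [hz] using this

theorem weightedDensity_eq (h : IsBochnerChart r e x φ ρ M) {w w' : Fin n → ℂ}
    (hw : w ∈ Metric.ball (0 : Fin n → ℂ) ρ) (hw' : w' ∈ Metric.ball (0 : Fin n → ℂ) ρ) :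
    weightedDensity r e φ (w, w')
      = (bochnerFun e φ (w, w'))⁻¹ * (bilinMatrix (logHess (bochnerFun r φ) (w, w'))).det := by
  rw [det_bilinMatrix_comp _ _ _ _ (h.logHess_bochnerFun hw hw'), det_conjCLM]
  rfl

/-- Along `w' = 0` the Bochner function of `e` is 1 and the Hessian of that of `r` is constant. This
is why the twist by `P` leaves no trace in the leading term. -/
theorem weightedDensity_right_zero (h : IsBochnerChart r e x φ ρ M) {w : Fin n → ℂ}
    (hw : w ∈ Metric.ball (0 : Fin n → ℂ) ρ) :
    weightedDensity r e φ (w, 0) = (bilinMatrix h.form).det := by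
  rw [h.weightedDensity_eq hw h.zero_mem, h.bochnerFun_right_zero h.e_analytic hw, inv_one, one_mul]
  congr 2
  refine ContinuousLinearMap.ext fun u => ContinuousLinearMap.ext fun k => ?_
  rw [h.form_apply, h.logHess_bochnerFun_zero hw]

theorem weightedDensity_conj (h : IsBochnerChart r e x φ ρ M) {w w' : Fin n → ℂ}
    (hw : w ∈ Metric.ball (0 : Fin n → ℂ) ρ) (hw' : w' ∈ Metric.ball (0 : Fin n → ℂ) ρ) :
    weightedDensity r e φ (w, w') = conj (weightedDensity r e φ (star w', star w)) := by
  have h1 := h.r_analytic w hw _ (star_mem hw')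
  have h2 := h.r_analytic _ (star_mem hw') w hw
  have h3 := det_conj_transpose_bilinMatrix (T := logHess r (φ w, star (φ (star w'))))
    (S := logHess r (φ (star w'), star (φ w))) fun a b => by
      have := logHess_hermitian (f := r) (u := φ (star w')) (v := star (φ w))
        (Eventually.of_forall h.r_hermitian) h2.1 (by rw [star_star]; exact h1.1) h2.2 a b
      rwa [star_star] at this
  simp only [weightedDensity, map_mul, map_inv₀, star_star, Complex.conj_conj]
  rw [← bochnerFun_hermitian h.e_hermitian (w, w'), ← h3]
  ring

theorem det_form_real (h : IsBochnerChart r e x φ ρ M) :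
    conj (bilinMatrix h.form).det = (bilinMatrix h.form).det := by
  have := congrArg Matrix.det h.form_posDef.isHermitian.eq
  rwa [Matrix.det_conjTranspose] at this

/-- The difference vanishes for `w' = 0` and, by Hermitian symmetry, for `w = 0`; one Schwarz lemma
in each variable gives the product of norms. The determinant is itself a value of the density, hence
the starting bound `2 * M`. -/
theorem norm_weightedDensity_sub_le (h : IsBochnerChart r e x φ ρ M) {w w' : Fin n → ℂ}
    (hw : w ∈ Metric.ball (0 : Fin n → ℂ) ρ) (hw' : w' ∈ Metric.ball (0 : Fin n → ℂ) ρ) :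
    ‖weightedDensity r e φ (w, w') - (bilinMatrix h.form).det‖
      ≤ 2 * M * (‖w'‖ / ρ) * (‖w‖ / ρ) := by
  set d := (bilinMatrix h.form).det with hd
  have hbd : ∀ v ∈ Metric.ball (0 : Fin n → ℂ) ρ, ∀ v' ∈ Metric.ball (0 : Fin n → ℂ) ρ,
      ‖weightedDensity r e φ (v, v')‖ ≤ M := fun v hv v' hv' => by
    have := h.density_le v hv (star v') (star_mem hv')
    rwa [star_star] at this
  have hdM : ‖d‖ ≤ M := by
    rw [hd, ← h.weightedDensity_right_zero h.zero_mem]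
    exact hbd _ h.zero_mem _ h.zero_mem
  have hdiff : ∀ v ∈ Metric.ball (0 : Fin n → ℂ) ρ, ∀ v' ∈ Metric.ball (0 : Fin n → ℂ) ρ,
      DifferentiableAt ℂ (weightedDensity r e φ) (v, v') := by
    intro v hv v' hv'
    have a1 := h.analyticAt_bochnerFun_of h.e_analytic hv hv'
    have a2 := h.analyticAt_bochnerFun_of h.r_analytic hv hv'
    have a3 := (a1.1.inv a1.2).differentiableAt.fun_mul (differentiableAt_det_logHess a2.1 a2.2)
    refine a3.congr_of_eventuallyEq ?_
    have hopen : IsOpen (Metric.ball (0 : Fin n → ℂ) ρ ×ˢ Metric.ball (0 : Fin n → ℂ) ρ) :=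
      Metric.isOpen_ball.prod Metric.isOpen_ball
    filter_upwards [hopen.eventually_mem (x := (v, v')) ⟨hv, hv'⟩] with q hq
    exact h.weightedDensity_eq hq.1 hq.2
  have hright : ∀ v ∈ Metric.ball (0 : Fin n → ℂ) ρ,
      ‖weightedDensity r e φ (v, w') - d‖ ≤ 2 * M * (‖w'‖ / ρ) := by
    intro v hv
    have h0 := h.weightedDensity_right_zero hv
    have := Complex.dist_le_div_mul_dist_of_mapsTo_ball (R₂ := 2 * M) (c := 0) (R₁ := ρ)
      (f := fun v' => weightedDensity r e φ (v, v')) (z := w')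
      (fun v' hv' => (DifferentiableAt.comp (f := fun v' => (v, v')) v' (hdiff v hv v' hv')
        ((differentiableAt_const v).prodMk differentiableAt_id)).differentiableWithinAt)
      (fun v' hv' => by
        simp only [h0, mem_closedBall_iff_norm]
        refine (norm_sub_le _ _).trans ?_
        have := hbd v hv v' hv'
        linarith) hw'
    rw [h0, dist_zero_right, dist_eq_norm] at this
    exact this.trans_eq (by ring)
  have h0 : weightedDensity r e φ (0, w') = d := by
    rw [h.weightedDensity_conj h.zero_mem hw', star_zero,
      h.weightedDensity_right_zero (star_mem hw'), h.det_form_real]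
  have := Complex.dist_le_div_mul_dist_of_mapsTo_ball (R₂ := 2 * M * (‖w'‖ / ρ)) (c := 0) (R₁ := ρ)
      (f := fun v => weightedDensity r e φ (v, w')) (z := w)
      (fun v hv => (DifferentiableAt.comp (f := fun v => (v, w')) v (hdiff v hv w' hw')
        (differentiableAt_id.prodMk (differentiableAt_const w'))).differentiableWithinAt)
      (fun v hv => by
        simp only [h0, mem_closedBall_iff_norm]
        exact hright v hv) hw
  rw [h0, dist_zero_right, dist_eq_norm] at this
  exact this.trans_eq (by ring)

end IsBochnerChart

theorem hermitian_diag_real {r : (Fin n → ℂ) × (Fin n → ℂ) → ℂ}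
    (hr : ∀ a, r a = conj (r (star a.2, star a.1))) (z : Fin n → ℂ) :
    r (z, star z) = ((r (z, star z)).re : ℂ) := by
  have := hr (z, star z)
  simp only [star_star] at this
  exact (Complex.conj_eq_iff_re.1 this.symm).symm

theorem bochnerFun_diag {r : (Fin n → ℂ) × (Fin n → ℂ) → ℂ}
    (hr : ∀ a, r a = conj (r (star a.2, star a.1))) (φ : (Fin n → ℂ) → Fin n → ℂ)
    (w : Fin n → ℂ) :
    bochnerFun r φ (w, star w) = ((cosSq r (φ 0) (φ w))⁻¹ : ℝ) := by
  have h1 : r (φ w, star (φ 0)) = conj (r (φ 0, star (φ w))) := by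
    rw [hr]; simp
  have h2 : ((‖r (φ 0, star (φ w))‖ : ℂ)) ^ 2
      = r (φ 0, star (φ w)) * conj (r (φ 0, star (φ w))) := (Complex.mul_conj' _).symm
  simp only [bochnerFun, cosSq, star_star]
  push_cast
  rw [← hermitian_diag_real hr, ← hermitian_diag_real hr, h2, h1]
  simp only [div_eq_mul_inv, mul_inv, inv_inv]
  ring

namespace IsBochnerChart

variable {r e : (Fin n → ℂ) × (Fin n → ℂ) → ℂ} {x : Fin n → ℂ} {φ : (Fin n → ℂ) → Fin n → ℂ}
  {ρ M : ℝ}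

theorem diastasis_estimate (h : IsBochnerChart r e x φ ρ M) {w : Fin n → ℂ}
    (hw : w ∈ Metric.ball (0 : Fin n → ℂ) ρ) (hpos : 0 < cosSq r x (φ w)) :
    |-Real.log (cosSq r x (φ w)) - (h.form w (star w)).re|
      ≤ (1 + n * M * ρ ^ 2) / ρ ^ 4 * ‖w‖ ^ 4 := by
  have h1 := h.norm_remainder_le_mul hw (star_mem hw)
  rw [remainder, bochnerFun_diag h.r_hermitian, h.map_zero,
    ← Complex.ofReal_log (inv_pos.2 hpos).le, Real.log_inv] at h1
  have h2 := (Complex.abs_re_le_norm _).trans h1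
  rw [Complex.sub_re, Complex.ofReal_re, norm_star] at h2
  refine h2.trans_eq ?_
  field_simp

/-- On the diagonal the inverse Bochner function of `e` is its normalized ratio `cosSq`, and the two
conjugate determinants combine into the real Jacobian. -/
theorem density_estimate (h : IsBochnerChart r e x φ ρ M) {w : Fin n → ℂ}
    (hw : w ∈ Metric.ball (0 : Fin n → ℂ) ρ) :
    |cosSq e x (φ w) * (‖(fderiv ℂ φ w).det‖ ^ 2
        * (bilinMatrix (logHess r (φ w, star (φ w)))).det.re) - (bilinMatrix h.form).det.re|
      ≤ 2 * M / ρ ^ 2 * ‖w‖ ^ 2 := by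
  have h1 := h.norm_weightedDensity_sub_le hw (star_mem hw)
  have h2 := (Complex.abs_re_le_norm _).trans h1
  have h3 : weightedDensity r e φ (w, star w) = ((cosSq e x (φ w) * ‖(fderiv ℂ φ w).det‖ ^ 2 : ℝ) : ℂ)
      * (bilinMatrix (logHess r (φ w, star (φ w)))).det := by
    rw [weightedDensity, bochnerFun_diag h.e_hermitian, h.map_zero]
    simp only [star_star]
    have := Complex.mul_conj' (fderiv ℂ φ w).det
    push_cast
    rw [← this, inv_inv]
    ring
  rw [h3, Complex.sub_re, Complex.re_ofReal_mul, norm_star] at h2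
  rw [← mul_assoc]
  exact h2.trans_eq (by ring)

end IsBochnerChart

end BochnerEstimates

/-! ### Gaussian integrals -/

section GaussianIntegrals

variable {n : ℕ}

theorem integral_exp_neg_sum_norm_sq :
    ∫ w : Fin n → ℂ, Real.exp (-∑ i, ‖w i‖ ^ 2) = Real.pi ^ n := by
  have h1 : ∀ w : Fin n → ℂ, Real.exp (-∑ i, ‖w i‖ ^ 2)
      = ∏ i, Real.exp (-1 * ‖w i‖ ^ 2) := fun w => by
    rw [← Real.exp_sum, ← Finset.sum_neg_distrib]
    simp
  simp_rw [h1]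
  rw [integral_fintype_prod_volume_eq_pow (fun z : ℂ => Real.exp (-1 * ‖z‖ ^ 2)),
    GaussianFourier.integral_rexp_neg_mul_sq_norm one_pos]
  simp

-- A positive matrix factors as `Bᴴ B`. It is the transpose that gets factored, since `T w (star w)`
-- has its conjugate in the second slot while `Bᴴ B` has it in the first.
open scoped MatrixOrder in
theorem exists_form_eq_sum_norm_sq {T : (Fin n → ℂ) →L[ℂ] (Fin n → ℂ) →L[ℂ] ℂ}
    (hT : (bilinMatrix T).PosDef) :
    ∃ B : (Fin n → ℂ) →L[ℂ] (Fin n → ℂ), (∀ w, (T w (star w)).re = ∑ i, ‖B w i‖ ^ 2) ∧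
      ‖B.det‖ ^ 2 = (bilinMatrix T).det.re := by
  obtain ⟨B, hB⟩ := CStarAlgebra.nonneg_iff_eq_star_mul_self.mp hT.transpose.posSemidef.nonneg
  have hB' : (bilinMatrix T).transpose = B.conjTranspose * B := hB
  refine ⟨LinearMap.toContinuousLinearMap (Matrix.toLin' B), fun w => ?_, ?_⟩
  · have h1 : T w (star w) = star (B.mulVec w) ⬝ᵥ B.mulVec w := by
      rw [bilin_eq_dotProduct, Matrix.star_mulVec, ← Matrix.dotProduct_mulVec,
        Matrix.mulVec_mulVec, ← hB', Matrix.mulVec_transpose, dotProduct_comm (star w),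
        ← Matrix.dotProduct_mulVec]
    rw [h1, dotProduct, Complex.re_sum]
    refine Finset.sum_congr rfl fun i _ => ?_
    have : star (B.mulVec w) i * B.mulVec w i = ((‖B.mulVec w i‖ ^ 2 : ℝ) : ℂ) := by
      push_cast
      rw [← Complex.conj_mul']
      rfl
    rw [this, Complex.ofReal_re]
    rfl
  · have h2 : (LinearMap.toContinuousLinearMap (Matrix.toLin' B)).det = B.det := by
      simp [ContinuousLinearMap.det]
    rw [h2, ← Matrix.det_transpose (bilinMatrix T), hB', Matrix.det_mul, Matrix.det_conjTranspose]
    have : star B.det * B.det = ((‖B.det‖ ^ 2 : ℝ) : ℂ) := by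
      push_cast
      rw [← Complex.conj_mul']
      rfl
    rw [this, Complex.ofReal_re]

theorem det_re_pos_of_posDef {T : (Fin n → ℂ) →L[ℂ] (Fin n → ℂ) →L[ℂ] ℂ}
    (hT : (bilinMatrix T).PosDef) : 0 < (bilinMatrix T).det.re :=
  (Complex.lt_def.1 hT.det_pos).1

theorem integral_comp_sqrt_smul {m : ℕ} (hm : 0 < m) (f : (Fin n → ℂ) → ℝ) :
    ∫ w, f (Real.sqrt m • w) = ((m : ℝ) ^ n)⁻¹ * ∫ w, f w := by
  rw [Measure.integral_comp_smul]
  have : Module.finrank ℝ (Fin n → ℂ) = 2 * n := by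
    rw [Module.finrank_pi_fintype]
    simp [Complex.finrank_real_complex, mul_comm]
  rw [this, pow_mul, Real.sq_sqrt (Nat.cast_nonneg _), abs_of_nonneg (by positivity), smul_eq_mul]

theorem form_real_smul (T : (Fin n → ℂ) →L[ℂ] (Fin n → ℂ) →L[ℂ] ℂ) (t : ℝ) (w : Fin n → ℂ) :
    (T (t • w) (star (t • w))).re = t ^ 2 * (T w (star w)).re := by
  have h1 : t • w = (t : ℂ) • w := by ext i; simp
  have h2 : star ((t : ℂ) • w) = (t : ℂ) • star w := by rw [star_smul]; simp
  rw [h1, h2, map_smul, map_smul, smul_apply, smul_smul, smul_eq_mul, ← pow_two,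
    ← Complex.ofReal_pow, Complex.re_ofReal_mul]

/-- Rescaling by `√m` in real dimension `2n` produces `m^{-n}`, and the linear change by `B` has
real Jacobian `det T`, which cancels the density. The constant is therefore the same for every `T`.
-/
theorem det_mul_integral_gaussian {T : (Fin n → ℂ) →L[ℂ] (Fin n → ℂ) →L[ℂ] ℂ}
    (hT : (bilinMatrix T).PosDef) {m : ℕ} (hm : 0 < m) :
    (bilinMatrix T).det.re * ∫ w, Real.exp (-(m * (T w (star w)).re))
      = Real.pi ^ n / (m : ℝ) ^ n := by
  have h1 : ∫ w, Real.exp (-(m * (T w (star w)).re))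
      = ((m : ℝ) ^ n)⁻¹ * ∫ w, Real.exp (-(T w (star w)).re) := by
    rw [← integral_comp_sqrt_smul hm]
    simp_rw [form_real_smul, Real.sq_sqrt (Nat.cast_nonneg m)]
  obtain ⟨B, hB, hdet⟩ := exists_form_eq_sum_norm_sq hT
  have hdet0 : B.det ≠ 0 := by
    intro h0
    have := det_re_pos_of_posDef hT
    rw [← hdet, h0] at this
    simp at this
  have hu : IsUnit (B.toLinearMap.det) := isUnit_iff_ne_zero.2 hdet0
  have hbij : Function.Bijective B := by
    exact (LinearMap.equivOfDetNeZero B.toLinearMap hdet0).bijective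
  have h2 := integral_image_eq_integral_abs_det_fderiv_smul (volume : Measure (Fin n → ℂ))
    MeasurableSet.univ (f := B) (f' := fun _ => B.restrictScalars ℝ)
    (fun x _ => (B.restrictScalars ℝ).hasFDerivWithinAt) hbij.1.injOn
    (fun w => Real.exp (-∑ i, ‖w i‖ ^ 2))
  rw [Set.image_univ, hbij.2.range_eq, setIntegral_univ, setIntegral_univ,
    integral_exp_neg_sum_norm_sq, det_restrictScalars_real, abs_of_nonneg (by positivity), hdet,
    integral_smul, smul_eq_mul] at h2
  rw [h1, h2]
  simp_rw [hB]
  field_simp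

theorem exists_integral_exp_neg_sq_le (n : ℕ) {c : ℝ} (hc : 0 < c) :
    ∃ K ≥ 0, ∀ m : ℕ, 0 < m →
      Integrable (fun w : Fin n → ℂ => Real.exp (-(m * (c * ‖w‖ ^ 2)))) ∧
      ∫ w : Fin n → ℂ, Real.exp (-(m * (c * ‖w‖ ^ 2))) ≤ K / (m : ℝ) ^ n := by
  have hint : Integrable (fun w : Fin n → ℂ => Real.exp (-(c * ‖w‖ ^ 2))) := by
    -- The norm is the sup norm, so the sum of squares is at most `n ‖w‖²`. Dividing by `n + 1`
    -- rather than `n` keeps `b` nonzero when `n = 0`.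
    set b := Real.sqrt (c / (n + 1)) with hb
    have hb0 : b ≠ 0 := by positivity
    have h1 : Integrable (fun w : Fin n → ℂ => Real.exp (-∑ i, ‖w i‖ ^ 2)) := by
      -- The Bochner integral of a non-integrable function is zero by convention, so a nonzero value
      -- proves integrability.
      refine Integrable.of_integral_ne_zero ?_
      rw [integral_exp_neg_sum_norm_sq]
      positivity
    have h2 := (integrable_comp_smul_iff volume (fun w : Fin n → ℂ => Real.exp (-∑ i, ‖w i‖ ^ 2))
      hb0).2 h1
    refine h2.mono' (by fun_prop) (Eventually.of_forall fun w => ?_)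
    rw [Real.norm_of_nonneg (Real.exp_pos _).le]
    refine Real.exp_le_exp.2 (neg_le_neg ?_)
    calc ∑ i, ‖(b • w) i‖ ^ 2 ≤ ∑ _i : Fin n, b ^ 2 * ‖w‖ ^ 2 := by
          refine Finset.sum_le_sum fun i _ => ?_
          rw [Pi.smul_apply, norm_smul, mul_pow, Real.norm_eq_abs, sq_abs]
          gcongr
          exact norm_le_pi_norm w i
      _ = n / (n + 1) * (c * ‖w‖ ^ 2) := by
          rw [hb, Real.sq_sqrt (by positivity)]
          simp
          ring
      _ ≤ 1 * (c * ‖w‖ ^ 2) := by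
          gcongr
          rw [div_le_one (by positivity)]
          linarith
      _ = _ := one_mul _
  have key : ∀ (m : ℕ) (w : Fin n → ℂ), Real.exp (-(m * (c * ‖w‖ ^ 2)))
      = Real.exp (-(c * ‖Real.sqrt m • w‖ ^ 2)) := fun m w => by
    rw [norm_smul, mul_pow, Real.norm_eq_abs, sq_abs, Real.sq_sqrt (Nat.cast_nonneg m)]
    ring_nf
  refine ⟨∫ w : Fin n → ℂ, Real.exp (-(c * ‖w‖ ^ 2)), integral_nonneg fun _ => (Real.exp_pos _).le,
    fun m hm => ⟨?_, ?_⟩⟩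
  · simp_rw [key]
    exact (integrable_comp_smul_iff volume (fun w : Fin n → ℂ => Real.exp (-(c * ‖w‖ ^ 2)))
      (by positivity)).2 hint
  · simp_rw [key]
    rw [integral_comp_sqrt_smul hm (fun w => Real.exp (-(c * ‖w‖ ^ 2)))]
    exact (by ring : _ = _).le

/-- The mean value property on a ball with a circle invariant weight. -/
theorem setIntegral_closedBall_mul_of_circle_invariant {ρ : ℝ} {F : (Fin n → ℂ) → ℂ}
    (hF : ∀ w ∈ Metric.closedBall (0 : Fin n → ℂ) ρ, AnalyticAt ℂ F w)
    {W : (Fin n → ℂ) → ℝ} (hW : Continuous W) (hinv : ∀ (θ : ℝ) w,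
      W (Complex.exp (θ * Complex.I) • w) = W w) :
    ∫ w in Metric.closedBall (0 : Fin n → ℂ) ρ, F w * W w
      = F 0 * ∫ w in Metric.closedBall (0 : Fin n → ℂ) ρ, (W w : ℂ) := by
  set B := Metric.closedBall (0 : Fin n → ℂ) ρ with hB
  have hBc : IsCompact B := isCompact_closedBall _ _
  have hrotB : ∀ (θ : ℝ) w, Complex.exp (θ * Complex.I) • w ∈ B ↔ w ∈ B := fun θ w => by
    simp [hB, norm_smul, Complex.norm_exp_ofReal_mul_I]
  have hFc : ContinuousOn F B := fun w hw => (hF w hw).continuousAt.continuousWithinAt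
  have hrot : ∀ θ : ℝ, ∫ w in B, F w * W w
      = ∫ w in B, F (Complex.exp (θ * Complex.I) • w) * W w := by
    intro θ
    set c := Complex.exp (θ * Complex.I) with hc
    have hc1 : ‖c‖ = 1 := Complex.norm_exp_ofReal_mul_I θ
    have hc0 : c ≠ 0 := by rw [← norm_ne_zero_iff, hc1]; exact one_ne_zero
    set A : (Fin n → ℂ) →L[ℂ] (Fin n → ℂ) := c • ContinuousLinearMap.id ℂ (Fin n → ℂ) with hA
    have hdet : ‖A.det‖ = 1 := by
      have h0 : A.det = c ^ n := by
        simp [hA, ContinuousLinearMap.det, LinearMap.det_smul]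
      rw [h0, norm_pow, hc1, one_pow]
    have h2 := integral_image_eq_integral_abs_det_fderiv_smul (volume : Measure (Fin n → ℂ))
      hBc.measurableSet (f := A) (f' := fun _ => A.restrictScalars ℝ)
      (fun x _ => (A.restrictScalars ℝ).hasFDerivWithinAt)
      (fun a _ b _ hab => smul_right_injective _ hc0 hab) (fun w => F w * W w)
    have himg : A '' B = B := by
      ext w
      constructor
      · rintro ⟨v, hv, rfl⟩
        exact (hrotB θ v).2 hv
      · intro hw
        refine ⟨c⁻¹ • w, (hrotB θ _).1 ?_, ?_⟩
        · rwa [smul_inv_smul₀ hc0]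
        · exact smul_inv_smul₀ hc0 w
    rw [himg, det_restrictScalars_real, hdet] at h2
    rw [h2]
    refine setIntegral_congr_fun hBc.measurableSet fun w _ => ?_
    have : A w = c • w := rfl
    simp [this, hinv, hc]
  -- On the complex line through `w`, `F` is holomorphic on a neighbourhood of the closed unit disc,
  -- so its circle average is its value at the centre.
  have hmean : ∀ w ∈ B, ∫ θ in (0 : ℝ)..2 * Real.pi, F (Complex.exp (θ * Complex.I) • w)
      = 2 * Real.pi * F 0 := by
    intro w hw
    have hd : ∀ t ∈ Metric.closedBall (0 : ℂ) 1, DifferentiableAt ℂ (fun t : ℂ => F (t • w)) t := by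
      intro t ht
      have hmem : t • w ∈ B := by
        rw [hB, mem_closedBall_zero_iff, norm_smul]
        have h1 := mem_closedBall_zero_iff.1 ht
        have h2 := mem_closedBall_zero_iff.1 hw
        calc ‖t‖ * ‖w‖ ≤ 1 * ρ := by gcongr
          _ = ρ := one_mul ρ
      exact (hF _ hmem).differentiableAt.comp t (f := fun t : ℂ => t • w)
        (differentiableAt_id.smul_const w)
    have h3 : DiffContOnCl ℂ (fun t : ℂ => F (t • w)) (Metric.ball 0 |(1 : ℝ)|) := by
      rw [abs_one]
      refine DifferentiableOn.diffContOnCl fun t ht => ?_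
      rw [closure_ball _ one_ne_zero] at ht
      exact (hd t ht).differentiableWithinAt
    have h4 := h3.circleAverage
    rw [Real.circleAverage_def, zero_smul] at h4
    rw [← h4, Complex.real_smul]
    have h5 : (2 * (Real.pi : ℂ)) ≠ 0 := by
      have := Real.pi_ne_zero
      exact mul_ne_zero two_ne_zero (by exact_mod_cast this)
    push_cast
    rw [← mul_assoc, mul_inv_cancel₀ h5, one_mul]
    simp [circleMap]
  have hpi : (0 : ℝ) ≤ 2 * Real.pi := by positivity
  -- The left side averages a quantity independent of `θ`; after exchanging the integrals the right
  -- side contains the circle means of `F`.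
  have hswap : ∫ θ in (0 : ℝ)..2 * Real.pi, ∫ w in B, F (Complex.exp (θ * Complex.I) • w) * W w
      = ∫ w in B, ∫ θ in (0 : ℝ)..2 * Real.pi, F (Complex.exp (θ * Complex.I) • w) * W w := by
    refine intervalIntegral_integral_swap ?_
    rw [Set.uIoc_of_le hpi]
    have hcont : ContinuousOn (fun q : ℝ × (Fin n → ℂ) =>
        F (Complex.exp (q.1 * Complex.I) • q.2) * W q.2) (Set.Icc 0 (2 * Real.pi) ×ˢ B) := by
      refine ContinuousOn.mul (hFc.comp (Continuous.continuousOn (by fun_prop)) fun q hq => ?_)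
        (Continuous.continuousOn (by fun_prop))
      exact (hrotB q.1 q.2).2 hq.2
    have := hcont.integrableOn_compact (μ := volume) (isCompact_Icc.prod hBc)
    rw [Measure.prod_restrict]
    exact (this.mono_set (Set.prod_mono Set.Ioc_subset_Icc_self le_rfl))
  have hL : ∫ θ in (0 : ℝ)..2 * Real.pi, ∫ w in B, F (Complex.exp (θ * Complex.I) • w) * W w
      = 2 * Real.pi * ∫ w in B, F w * W w := by
    have h6 : (fun θ : ℝ => ∫ w in B, F (Complex.exp (θ * Complex.I) • w) * W w)
        = fun _ => ∫ w in B, F w * W w := funext fun θ => (hrot θ).symm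
    rw [h6]
    simp
  have hR : ∫ w in B, ∫ θ in (0 : ℝ)..2 * Real.pi, F (Complex.exp (θ * Complex.I) • w) * W w
      = 2 * Real.pi * (F 0 * ∫ w in B, (W w : ℂ)) := by
    rw [← mul_assoc, ← integral_const_mul]
    refine setIntegral_congr_fun hBc.measurableSet fun w hw => ?_
    rw [intervalIntegral.integral_mul_const, hmean w hw]
  rw [hL, hR] at hswap
  have h5 : (2 * (Real.pi : ℂ)) ≠ 0 := by
    have := Real.pi_ne_zero
    exact mul_ne_zero two_ne_zero (by exact_mod_cast this)
  exact mul_left_cancel₀ h5 hswap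

end GaussianIntegrals

/-! ### The local Laplace asymptotics -/

section Laplace

variable {n : ℕ}

/-- Powers of `t` are paid for with a quarter of the exponent, 4/5 - 1/4 = 11/20. The result has to
exceed 1/2: one half later converts `‖F‖` into pointwise norms of the section, and the surplus 1/20
is the decay used in Schur's test. -/
theorem quadratic_exp_le {A B t : ℝ} (hA : 0 ≤ A) (hB : 0 ≤ B) (ht : 0 ≤ t) :
    (A * t + B * t ^ 2) * Real.exp (-(4 / 5 * t)) ≤ (4 * A + 64 * B) * Real.exp (-(11 / 20 * t)) := by
  have h1 : t / 8 ≤ Real.exp (t / 8) := (Real.add_one_le_exp _).trans' (by linarith)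
  have h2 : t / 4 ≤ Real.exp (t / 4) := (Real.add_one_le_exp _).trans' (by linarith)
  have h3 : t ^ 2 ≤ 64 * Real.exp (t / 4) := by
    have : Real.exp (t / 4) = Real.exp (t / 8) ^ 2 := by
      rw [← Real.exp_nat_mul]; congr 1; push_cast; ring
    rw [this]
    have := pow_le_pow_left₀ (by positivity) h1 2
    linarith [this]
  have h4 : Real.exp (-(11 / 20 * t)) = Real.exp (t / 4) * Real.exp (-(4 / 5 * t)) := by
    rw [← Real.exp_add]; congr 1; ring
  rw [h4, ← mul_assoc]
  refine mul_le_mul_of_nonneg_right ?_ (Real.exp_pos _).le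
  nlinarith [mul_le_mul_of_nonneg_left h2 hA, mul_le_mul_of_nonneg_left h3 hB]

theorem abs_exp_neg_sub_exp_neg_le {a b t : ℝ} (ha : t ≤ a) (hb : t ≤ b) :
    |Real.exp (-a) - Real.exp (-b)| ≤ |a - b| * Real.exp (-t) := by
  have key : ∀ {a b : ℝ}, t ≤ a → a ≤ b → Real.exp (-a) - Real.exp (-b) ≤ (b - a) * Real.exp (-t) := by
    intro a b ha hab
    have h1 : Real.exp (-b) = Real.exp (-a) * Real.exp (a - b) := by
      rw [← Real.exp_add]; congr 1; ring
    have h2 := Real.add_one_le_exp (a - b)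
    have h3 : Real.exp (-a) ≤ Real.exp (-t) := Real.exp_le_exp.2 (neg_le_neg ha)
    calc Real.exp (-a) - Real.exp (-b) = Real.exp (-a) * (1 - Real.exp (a - b)) := by rw [h1]; ring
      _ ≤ Real.exp (-a) * (b - a) := by
        refine mul_le_mul_of_nonneg_left ?_ (Real.exp_pos _).le
        linarith
      _ ≤ Real.exp (-t) * (b - a) := by
        refine mul_le_mul_of_nonneg_right h3 (by linarith)
      _ = _ := mul_comm _ _
  rcases le_total a b with h | h
  · rw [abs_of_nonneg (sub_nonneg.2 (Real.exp_le_exp.2 (neg_le_neg h))), abs_sub_comm,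
      abs_of_nonneg (sub_nonneg.2 h)]
    exact key ha h
  · rw [abs_sub_comm, abs_of_nonneg (sub_nonneg.2 (Real.exp_le_exp.2 (neg_le_neg h))),
      abs_of_nonneg (sub_nonneg.2 h)]
    exact key hb h

-- The weight is replaced by the Gaussian of `T` times `det T`. Against that, the integral of a
-- holomorphic `F` is `F 0` times the mass, so no derivative of `F` enters. The replacement error is
-- at most a quadratic polynomial in `m d`, divided by `m`, and the exponential absorbs it. It is
-- kept as a weighted integral of `‖F‖` because `F` has no a priori bound in terms of `F 0`. The
-- second error term is the Gaussian tail outside the ball.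
set_option maxHeartbeats 1000000 in
theorem exists_laplace_estimate (n : ℕ) {ρ c C D : ℝ} (hρ : 0 < ρ) (hc : 0 < c) (hC : 0 ≤ C)
    (hD : 0 ≤ D) (hsmall : C * ρ ^ 2 ≤ c / 4) :
    ∃ K ≥ 0, ∀ m : ℕ, 0 < m → ∀ (T : (Fin n → ℂ) →L[ℂ] (Fin n → ℂ) →L[ℂ] ℂ)
      (F : (Fin n → ℂ) → ℂ) (d h : (Fin n → ℂ) → ℝ),
      (bilinMatrix T).PosDef → (∀ w, c * ‖w‖ ^ 2 ≤ (T w (star w)).re) →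
      (bilinMatrix T).det.re ≤ D →
      (∀ w ∈ Metric.closedBall (0 : Fin n → ℂ) ρ, AnalyticAt ℂ F w) →
      ContinuousOn d (Metric.closedBall 0 ρ) → ContinuousOn h (Metric.closedBall 0 ρ) →
      (∀ w ∈ Metric.closedBall (0 : Fin n → ℂ) ρ, |d w - (T w (star w)).re| ≤ C * ‖w‖ ^ 4) →
      (∀ w ∈ Metric.closedBall (0 : Fin n → ℂ) ρ, |h w - (bilinMatrix T).det.re| ≤ C * ‖w‖ ^ 2) →
      ‖(∫ w in Metric.closedBall (0 : Fin n → ℂ) ρ, F w * (Real.exp (-(m * d w)) * h w : ℝ))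
          - (Real.pi ^ n / (m : ℝ) ^ n : ℝ) * F 0‖
        ≤ K / m * (∫ w in Metric.closedBall (0 : Fin n → ℂ) ρ,
            ‖F w‖ * Real.exp (-(11 / 20 * (m * d w)))) + K / (m : ℝ) ^ (n + 1) * ‖F 0‖ := by
  obtain ⟨K₁, hK₁, hgauss⟩ := exists_integral_exp_neg_sq_le n (half_pos hc)
  -- Since `‖w‖² ≤ 4 / (3c) · d w` on the ball, `C ‖w‖² ≤ a · d w` and `C D ‖w‖⁴ ≤ b · (d w)²`.
  set a := 4 / 3 * (C / c) with ha
  set b := 16 / 9 * (C * D / c ^ 2) with hb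
  have ha0 : 0 ≤ a := by positivity
  have hb0 : 0 ≤ b := by positivity
  set K₂ := 4 * a + 64 * b with hK₂
  have hK₂0 : 0 ≤ K₂ := by positivity
  set K₃ := D * K₁ * (2 / (c * ρ ^ 2)) with hK₃
  have hK₃0 : 0 ≤ K₃ := by positivity
  refine ⟨K₂ + K₃, by positivity, fun m hm T F d h hT hlow hdet hF hdc hhc hd hh => ?_⟩
  set B := Metric.closedBall (0 : Fin n → ℂ) ρ with hB
  set N : (Fin n → ℂ) → ℝ := fun w => (T w (star w)).re with hN
  set δ := (bilinMatrix T).det.re with hδ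
  have hδ0 : 0 < δ := det_re_pos_of_posDef hT
  have hBc : IsCompact B := isCompact_closedBall _ _
  have hm0 : (0 : ℝ) < m := Nat.cast_pos.2 hm
  have hNc : Continuous N := by fun_prop
  have hFc : ContinuousOn F B := fun w hw => (hF w hw).continuousAt.continuousWithinAt
  -- The assumption `C * ρ ^ 2 ≤ c / 4` makes the quartic error at most `N w / 4`, so `d` and `N`
  -- differ by a factor between 3/4 and 5/4.
  have hbd : ∀ w ∈ B, c * ‖w‖ ^ 2 ≤ N w ∧ 3 / 4 * N w ≤ d w ∧ 4 / 5 * d w ≤ N w := by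
    intro w hw
    have h1 := hlow w
    have hw' : ‖w‖ ≤ ρ := mem_closedBall_zero_iff.1 hw
    have h2 : C * ‖w‖ ^ 4 ≤ c / 4 * ‖w‖ ^ 2 := by
      calc C * ‖w‖ ^ 4 = C * ‖w‖ ^ 2 * ‖w‖ ^ 2 := by ring
        _ ≤ C * ρ ^ 2 * ‖w‖ ^ 2 := by gcongr
        _ ≤ _ := by gcongr
    have h3 := abs_le.1 ((hd w hw).trans h2)
    refine ⟨h1, ?_, ?_⟩ <;> simp only [hN] <;> nlinarith [h3.1, h3.2, sq_nonneg ‖w‖]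
  have hmain : ∫ w in B, F w * (Real.exp (-(m * N w)) * δ : ℝ)
      = F 0 * ((∫ w in B, Real.exp (-(m * N w)) * δ : ℝ) : ℂ) := by
    rw [setIntegral_closedBall_mul_of_circle_invariant (W := fun w => Real.exp (-(m * N w)) * δ) hF
      (by fun_prop), integral_complex_ofReal]
    intro θ w
    congr 4
    simp only [hN]
    have h1 : star (Complex.exp (θ * Complex.I) • w)
        = (conj (Complex.exp (θ * Complex.I))) • star w := by rw [star_smul]; rfl
    rw [h1, map_smul, map_smul, smul_apply, smul_smul, Complex.conj_mul',
      Complex.norm_exp_ofReal_mul_I]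
    simp
  have hI1 : IntegrableOn (fun w => F w * ((Real.exp (-(m * d w)) * h w : ℝ) : ℂ)) B := by
    refine ContinuousOn.integrableOn_compact hBc (hFc.mul ?_)
    exact Complex.continuous_ofReal.comp_continuousOn
      ((Real.continuous_exp.comp_continuousOn (hdc.const_mul _).neg).mul hhc)
  have hI2 : IntegrableOn (fun w => F w * ((Real.exp (-(m * N w)) * δ : ℝ) : ℂ)) B :=
    ContinuousOn.integrableOn_compact hBc (hFc.mul (Continuous.continuousOn (by fun_prop)))
  have hI3 : IntegrableOn (fun w => ‖F w‖ * Real.exp (-(11 / 20 * (m * d w)))) B :=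
    ContinuousOn.integrableOn_compact hBc (hFc.norm.mul
      (Real.continuous_exp.comp_continuousOn ((hdc.const_mul _).const_mul _).neg))
  have herr : ‖(∫ w in B, F w * (Real.exp (-(m * d w)) * h w : ℝ))
      - ∫ w in B, F w * (Real.exp (-(m * N w)) * δ : ℝ)‖
      ≤ K₂ / m * ∫ w in B, ‖F w‖ * Real.exp (-(11 / 20 * (m * d w))) := by
    rw [← integral_sub hI1 hI2, ← integral_const_mul]
    refine norm_integral_le_of_norm_le (hI3.const_mul _) ?_
    refine (ae_restrict_iff' hBc.measurableSet).2 (Eventually.of_forall fun w hw => ?_)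
    obtain ⟨h1, h2, h3⟩ := hbd w hw
    have hN0 : 0 ≤ N w := (by positivity : (0 : ℝ) ≤ c * ‖w‖ ^ 2).trans h1
    have hd0 : 0 ≤ d w := by linarith
    have hwd : ‖w‖ ^ 2 ≤ 4 / 3 / c * d w := by
      rw [div_mul_eq_mul_div, le_div_iff₀ hc]
      linarith
    have p1 : |Real.exp (-(m * d w)) - Real.exp (-(m * N w))|
        ≤ m * (C * ‖w‖ ^ 4) * Real.exp (-(4 / 5 * (m * d w))) := by
      refine (abs_exp_neg_sub_exp_neg_le (t := 4 / 5 * (m * d w)) ?_ ?_).trans ?_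
      · have : 0 ≤ m * d w := by positivity
        linarith
      · calc 4 / 5 * (m * d w) = m * (4 / 5 * d w) := by ring
          _ ≤ m * N w := by gcongr
      · rw [← mul_sub, abs_mul, abs_of_pos hm0]
        gcongr
        exact hd w hw
    have p2 : Real.exp (-(m * d w)) ≤ Real.exp (-(4 / 5 * (m * d w))) := by
      refine Real.exp_le_exp.2 ?_
      have : 0 ≤ m * d w := by positivity
      linarith
    have p3 : |Real.exp (-(m * d w)) * h w - Real.exp (-(m * N w)) * δ|
        ≤ K₂ / m * Real.exp (-(11 / 20 * (m * d w))) := by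
      calc |Real.exp (-(m * d w)) * h w - Real.exp (-(m * N w)) * δ|
          = |Real.exp (-(m * d w)) * (h w - δ)
            + (Real.exp (-(m * d w)) - Real.exp (-(m * N w))) * δ| := by ring_nf
        _ ≤ Real.exp (-(m * d w)) * |h w - δ|
            + |Real.exp (-(m * d w)) - Real.exp (-(m * N w))| * δ := by
          refine (abs_add_le _ _).trans_eq ?_
          rw [abs_mul, abs_mul, abs_of_pos (Real.exp_pos _), abs_of_pos hδ0]
        _ ≤ Real.exp (-(4 / 5 * (m * d w))) * (C * ‖w‖ ^ 2)
            + m * (C * ‖w‖ ^ 4) * Real.exp (-(4 / 5 * (m * d w))) * D := by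
          gcongr
          exact hh w hw
        _ = (C * ‖w‖ ^ 2 + m * (C * D * (‖w‖ ^ 2) ^ 2)) * Real.exp (-(4 / 5 * (m * d w))) := by ring
        _ ≤ (C * (4 / 3 / c * d w) + m * (C * D * (4 / 3 / c * d w) ^ 2))
            * Real.exp (-(4 / 5 * (m * d w))) := by gcongr
        _ = 1 / m * ((a * (m * d w) + b * (m * d w) ^ 2) * Real.exp (-(4 / 5 * (m * d w)))) := by
          rw [ha, hb]
          field_simp
          ring
        _ ≤ 1 / m * (K₂ * Real.exp (-(11 / 20 * (m * d w)))) := by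
          exact mul_le_mul_of_nonneg_left (quadratic_exp_le ha0 hb0 (by positivity)) (by positivity)
        _ = _ := by ring
    rw [← mul_sub, ← Complex.ofReal_sub, norm_mul, Complex.norm_real, Real.norm_eq_abs]
    calc _ ≤ ‖F w‖ * (K₂ / m * Real.exp (-(11 / 20 * (m * d w)))) := by gcongr
      _ = _ := by ring
  obtain ⟨hgi, hgb⟩ := hgauss m hm
  have hexpi : Integrable fun w => Real.exp (-(m * N w)) := by
    refine hgi.mono' (by fun_prop) (Eventually.of_forall fun w => ?_)
    rw [Real.norm_of_nonneg (Real.exp_pos _).le]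
    refine Real.exp_le_exp.2 (neg_le_neg ?_)
    have := hlow w
    gcongr
    exact this.trans' (by nlinarith [sq_nonneg ‖w‖])
  have htail : |Real.pi ^ n / (m : ℝ) ^ n - ∫ w in B, Real.exp (-(m * N w)) * δ|
      ≤ K₃ / (m : ℝ) ^ (n + 1) := by
    rw [← det_mul_integral_gaussian hT hm, integral_mul_const, mul_comm (∫ w in B, _) δ, ← mul_sub,
      ← integral_add_compl hBc.measurableSet hexpi, add_sub_cancel_left]
    have q0 : 0 ≤ ∫ w in Bᶜ, Real.exp (-(m * N w)) := integral_nonneg fun _ => (Real.exp_pos _).le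
    rw [abs_of_nonneg (mul_nonneg hδ0.le q0)]
    -- Half of the exponent is bounded by its value at radius `ρ`; the other half keeps the integral
    -- convergent and of size `m^{-n}`.
    have q1 : ∫ w in Bᶜ, Real.exp (-(m * N w))
        ≤ ∫ w in Bᶜ, Real.exp (-(m * (c / 2 * ρ ^ 2))) * Real.exp (-(m * (c / 2 * ‖w‖ ^ 2))) := by
      refine setIntegral_mono_on hexpi.integrableOn (hgi.integrableOn.const_mul _)
        hBc.measurableSet.compl fun w hw => ?_
      rw [← Real.exp_add]
      refine Real.exp_le_exp.2 ?_
      have hw' : ρ < ‖w‖ := by simpa [hB] using hw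
      have h1 : ρ ^ 2 ≤ ‖w‖ ^ 2 := by gcongr
      have h2 : c / 2 * ρ ^ 2 + c / 2 * ‖w‖ ^ 2 ≤ N w := (hlow w).trans' (by nlinarith)
      nlinarith [mul_le_mul_of_nonneg_left h2 hm0.le]
    have q2 : ∫ w in Bᶜ, Real.exp (-(m * (c / 2 * ‖w‖ ^ 2))) ≤ K₁ / (m : ℝ) ^ n :=
      (setIntegral_le_integral hgi (Eventually.of_forall fun _ => (Real.exp_pos _).le)).trans hgb
    -- The tail factor is exponentially small, but one extra power of `1 / m` is enough, so `exp
    -- (-t) ≤ 1 / t` suffices.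
    have q3 : Real.exp (-(m * (c / 2 * ρ ^ 2))) ≤ 2 / (c * ρ ^ 2) / m := by
      set t := m * (c / 2 * ρ ^ 2) with ht
      have ht0 : 0 < t := by positivity
      have h1 : Real.exp (-t) ≤ 1 / t := by
        rw [Real.exp_neg, ← one_div]
        exact one_div_le_one_div_of_le ht0 ((Real.add_one_le_exp t).trans' (by linarith))
      refine h1.trans_eq ?_
      rw [ht]
      field_simp
    rw [integral_const_mul] at q1
    have q4 : 0 ≤ ∫ w in Bᶜ, Real.exp (-(m * (c / 2 * ‖w‖ ^ 2))) :=
      integral_nonneg fun _ => (Real.exp_pos _).le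
    calc _ ≤ D * (2 / (c * ρ ^ 2) / m * (K₁ / (m : ℝ) ^ n)) := by
          gcongr
          refine q1.trans ?_
          gcongr
      _ = _ := by
          rw [hK₃]
          field_simp
          ring
  have hint3 : 0 ≤ ∫ w in B, ‖F w‖ * Real.exp (-(11 / 20 * (m * d w))) :=
    integral_nonneg fun _ => by positivity
  have h2 : ‖F 0 * ((∫ w in B, Real.exp (-(m * N w)) * δ : ℝ) : ℂ)
      - (Real.pi ^ n / (m : ℝ) ^ n : ℝ) * F 0‖ ≤ K₃ / (m : ℝ) ^ (n + 1) * ‖F 0‖ := by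
    rw [mul_comm _ (F 0), ← mul_sub, ← Complex.ofReal_sub, norm_mul, Complex.norm_real,
      Real.norm_eq_abs, abs_sub_comm, mul_comm]
    gcongr
  rw [hmain] at herr
  calc _ ≤ _ := norm_sub_le_norm_sub_add_norm_sub _ _ _
    _ ≤ _ := add_le_add herr h2
    _ ≤ _ := by
      gcongr
      · linarith
      · linarith

theorem exists_setIntegral_exp_le (n : ℕ) {c : ℝ} (hc : 0 < c) (ρ : ℝ) :
    ∃ K ≥ 0, ∀ m : ℕ, 0 < m → ∀ d : (Fin n → ℂ) → ℝ,
      (∀ w ∈ Metric.closedBall (0 : Fin n → ℂ) ρ, c * ‖w‖ ^ 2 ≤ d w) →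
      ContinuousOn d (Metric.closedBall 0 ρ) →
      ∫ w in Metric.closedBall (0 : Fin n → ℂ) ρ, Real.exp (-(1 / 20 * (m * d w)))
        ≤ K / (m : ℝ) ^ n := by
  obtain ⟨K, hK, h⟩ := exists_integral_exp_neg_sq_le n (c := c / 20) (by positivity)
  refine ⟨K, hK, fun m hm d hd hdc => ?_⟩
  obtain ⟨h1, h2⟩ := h m hm
  have hBc : IsCompact (Metric.closedBall (0 : Fin n → ℂ) ρ) := isCompact_closedBall _ _
  refine (setIntegral_mono_on ?_ h1.integrableOn hBc.measurableSet fun w hw => ?_).trans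
    ((setIntegral_le_integral h1 (Eventually.of_forall fun _ => (Real.exp_pos _).le)).trans h2)
  · exact ContinuousOn.integrableOn_compact hBc
      (Real.continuous_exp.comp_continuousOn ((hdc.const_mul _).const_mul _).neg)
  · refine Real.exp_le_exp.2 (neg_le_neg ?_)
    have hm0 : (0 : ℝ) < m := Nat.cast_pos.2 hm
    nlinarith [mul_le_mul_of_nonneg_left (hd w hw) hm0.le]

end Laplace

/-! ### Bochner coordinates with constants uniform in the centre. -/

section UniformBochner

variable {n : ℕ}

/-- A neighbourhood of `(a, 0, 0)` contains a product, so a joint condition yields one radius valid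
for all nearby centres. -/
theorem eventually_forall_ball {A B : Type*} [TopologicalSpace A] [SeminormedAddCommGroup B]
    {a : A} {p : A × B × B → Prop} (h : ∀ᶠ q in 𝓝 (a, ((0 : B), (0 : B))), p q) :
    ∃ ρ > 0, ∀ᶠ x in 𝓝 a, ∀ w ∈ Metric.ball (0 : B) ρ, ∀ w' ∈ Metric.ball (0 : B) ρ,
      p (x, w, w') := by
  rw [nhds_prod_eq, eventually_prod_iff] at h
  obtain ⟨pa, hpa, pb, hpb, hp⟩ := h
  obtain ⟨ρ, hρ, hb⟩ := Metric.eventually_nhds_iff_ball.1 hpb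
  refine ⟨ρ, hρ, hpa.mono fun x hx w hw w' hw' => hp hx (hb (w, w') ?_)⟩
  rw [← ball_prod_same]
  exact ⟨hw, hw'⟩

theorem continuousAt_det {A : Type*} [TopologicalSpace A] {f : A → Matrix (Fin n) (Fin n) ℂ} {a : A}
    (h : ContinuousAt f a) : ContinuousAt (fun x => (f x).det) a :=
  (Continuous.matrix_det continuous_id).continuousAt.comp h

theorem continuous_bilinMatrix :
    Continuous (bilinMatrix : ((Fin n → ℂ) →L[ℂ] (Fin n → ℂ) →L[ℂ] ℂ) → _) := by
  refine continuous_pi fun i => continuous_pi fun j => ?_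
  simp only [bilinMatrix, Matrix.of_apply]
  fun_prop

theorem continuous_clm_det :
    Continuous fun A : (Fin n → ℂ) →L[ℂ] (Fin n → ℂ) => A.det := by
  have h : ∀ A : (Fin n → ℂ) →L[ℂ] (Fin n → ℂ), A.det = (LinearMap.toMatrix' A.toLinearMap).det :=
    fun A => (LinearMap.det_toMatrix' _).symm
  simp_rw [h]
  refine Continuous.matrix_det (continuous_pi fun i => continuous_pi fun j => ?_)
  simp only [LinearMap.toMatrix'_apply]
  exact (continuous_apply i).comp
    (ContinuousLinearMap.apply ℂ (Fin n → ℂ) (Pi.single j (1 : ℂ) : Fin n → ℂ)).continuous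

theorem cosSq_self {r : (Fin n → ℂ) × (Fin n → ℂ) → ℂ}
    (hr : ∀ a, r a = conj (r (star a.2, star a.1))) {x : Fin n → ℂ} (h0 : r (x, star x) ≠ 0) :
    cosSq r x x = 1 := by
  have h1 := hermitian_diag_real hr x
  have h2 : (r (x, star x)).re ≠ 0 := by
    intro h
    rw [h1, h] at h0
    simp at h0
  rw [cosSq, h1, Complex.norm_real, Real.norm_eq_abs, sq_abs, Complex.ofReal_re]
  field_simp

/-- The requirements are stable conditions on centre and coordinates. At `(p, 0, 0)` the Bochner
functions equal 1 and all other quantities have finite limits, so joint continuity gives a single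
radius and single bounds for all centres near `p`. -/
theorem exists_uniform_bochnerChart {r e : (Fin n → ℂ) × (Fin n → ℂ) → ℂ} {p : Fin n → ℂ}
    {U : Set (Fin n → ℂ)} (hU : U ∈ 𝓝 p) (hrh : ∀ a, r a = conj (r (star a.2, star a.1)))
    (heh : ∀ a, e a = conj (e (star a.2, star a.1))) (hr : AnalyticAt ℂ r (p, star p))
    (hr0 : r (p, star p) ≠ 0) (he : AnalyticAt ℂ e (p, star p)) (he0 : e (p, star p) ≠ 0)
    (hpos : ∀ᶠ x in 𝓝 p, (bilinMatrix (logHess r (x, star x))).PosDef) :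
    ∃ (Φ : (Fin n → ℂ) → (Fin n → ℂ) → Fin n → ℂ) (ρ M c : ℝ), 0 < ρ ∧ 0 < c ∧
      (∀ᶠ x in 𝓝 p, ∃ h : IsBochnerChart r e x (Φ x) ρ M,
        (∀ w, c * ‖w‖ ^ 2 ≤ (h.form w (star w)).re) ∧
        ∀ w ∈ Metric.ball (0 : Fin n → ℂ) ρ, Φ x w ∈ U ∧ 1 / 2 ≤ cosSq e x (Φ x w) ∧
          c ≤ ‖(fderiv ℂ (Φ x) w).det‖ ^ 2
            * (bilinMatrix (logHess r (Φ x w, star (Φ x w)))).det.re) ∧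
      ∀ ρ' > 0, ∀ᶠ q : (Fin n → ℂ) × (Fin n → ℂ) in 𝓝 (p, p),
        ∃ w ∈ Metric.ball (0 : Fin n → ℂ) ρ', Φ q.1 w = q.2 := by
  have hpp := hpos.self_of_nhds
  obtain ⟨Φ, t1, c2, a3, g4, z5, s6⟩ := exists_normal_coordinates hr hr0 hpp.det_pos.ne'
  set o : (Fin n → ℂ) × (Fin n → ℂ) × (Fin n → ℂ) := (p, 0, 0) with ho
  have k0 : Tendsto (fun q : (Fin n → ℂ) × (Fin n → ℂ) × (Fin n → ℂ) => q.1) (𝓝 o) (𝓝 p) :=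
    continuous_fst.tendsto' _ _ rfl
  have k1 : Tendsto (fun q : (Fin n → ℂ) × (Fin n → ℂ) × (Fin n → ℂ) => (q.1, q.2.1)) (𝓝 o)
      (𝓝 (p, 0)) := Continuous.tendsto' (by fun_prop) _ _ rfl
  have k2 : Tendsto (fun q : (Fin n → ℂ) × (Fin n → ℂ) × (Fin n → ℂ) => (q.1, q.2.2)) (𝓝 o)
      (𝓝 (p, 0)) := Continuous.tendsto' (by fun_prop) _ _ rfl
  have f1 : Tendsto (fun q : (Fin n → ℂ) × (Fin n → ℂ) × (Fin n → ℂ) => Φ q.1 q.2.1) (𝓝 o) (𝓝 p) :=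
    t1.comp k1
  have f2 : Tendsto (fun q : (Fin n → ℂ) × (Fin n → ℂ) × (Fin n → ℂ) => Φ q.1 q.2.2) (𝓝 o) (𝓝 p) :=
    t1.comp k2
  have hstar : Continuous fun z : Fin n → ℂ => star z := continuous_star
  have pr : ∀ {α β : (Fin n → ℂ) × (Fin n → ℂ) × (Fin n → ℂ) → Fin n → ℂ},
      Tendsto α (𝓝 o) (𝓝 p) → Tendsto β (𝓝 o) (𝓝 p) →
      Tendsto (fun q => (α q, star (β q))) (𝓝 o) (𝓝 (p, star p)) := fun hα hβ =>
    hα.prodMk_nhds ((hstar.tendsto p).comp hβ)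
  have d1 : Tendsto (fun q : (Fin n → ℂ) × (Fin n → ℂ) × (Fin n → ℂ) => fderiv ℂ (Φ q.1) q.2.1)
      (𝓝 o) (𝓝 (fderiv ℂ (Φ p) 0)) := c2.tendsto.comp k1
  have d2 : Tendsto (fun q : (Fin n → ℂ) × (Fin n → ℂ) × (Fin n → ℂ) => fderiv ℂ (Φ q.1) q.2.2)
      (𝓝 o) (𝓝 (fderiv ℂ (Φ p) 0)) := c2.tendsto.comp k2
  have e1 := (continuous_clm_det.tendsto _).comp d1
  have e2 := (continuous_clm_det.tendsto _).comp d2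
  have lH : Tendsto (fun a => (bilinMatrix (logHess r a)).det) (𝓝 (p, star p))
      (𝓝 (bilinMatrix (logHess r (p, star p))).det) :=
    (continuousAt_det (continuous_bilinMatrix.continuousAt.comp
      (analyticAt_logHess hr hr0).continuousAt)).tendsto
  have z5' : ∀ᶠ q in 𝓝 o, Φ q.1 0 = q.1 := k0.eventually z5
  have bf : ∀ {f : (Fin n → ℂ) × (Fin n → ℂ) → ℂ}, AnalyticAt ℂ f (p, star p) → f (p, star p) ≠ 0 →
      Tendsto (fun q : (Fin n → ℂ) × (Fin n → ℂ) × (Fin n → ℂ) =>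
        bochnerFun f (Φ q.1) (q.2.1, star q.2.2)) (𝓝 o) (𝓝 1) := by
    intro f hf hf0
    have hc := hf.continuousAt.tendsto
    have h1 := (((hc.comp (pr k0 k0)).div (hc.comp (pr f1 k0)) hf0).mul
      ((hc.comp (pr k0 f2)).inv₀ hf0)).mul (hc.comp (pr f1 f2))
    have h2 : f (p, star p) / f (p, star p) * (f (p, star p))⁻¹ * f (p, star p) = 1 := by
      field_simp
    rw [h2] at h1
    refine h1.congr' ?_
    filter_upwards [z5'] with q hq
    simp [bochnerFun, hq]
  have wd : Tendsto (fun q : (Fin n → ℂ) × (Fin n → ℂ) × (Fin n → ℂ) =>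
      weightedDensity r e (Φ q.1) (q.2.1, star q.2.2)) (𝓝 o) (𝓝 ((1 : ℂ)⁻¹ *
        ((fderiv ℂ (Φ p) 0).det * (bilinMatrix (logHess r (p, star p))).det
          * conj (fderiv ℂ (Φ p) 0).det))) := by
    have h1 := ((bf he he0).inv₀ one_ne_zero).mul ((e1.mul (lH.comp (pr f1 f2))).mul
      ((Complex.continuous_conj.tendsto _).comp e2))
    refine h1.congr fun q => ?_
    simp [weightedDensity]
  set M₁ := ‖(1 : ℂ)⁻¹ * ((fderiv ℂ (Φ p) 0).det * (bilinMatrix (logHess r (p, star p))).det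
          * conj (fderiv ℂ (Φ p) 0).det)‖ + 1 with hM₁
  set M := max M₁ (‖fderiv ℂ (Φ p) 0‖ + 1) with hM
  have slit : ∀ᶠ z in 𝓝 (1 : ℂ), z ∈ Complex.slitPlane ∧ ‖Complex.log z‖ ≤ 1 := by
    refine (Complex.isOpen_slitPlane.eventually_mem Complex.one_mem_slitPlane).and ?_
    have h1 : Tendsto (fun z => ‖Complex.log z‖) (𝓝 1) (𝓝 0) := by
      simpa using (continuousAt_clog Complex.one_mem_slitPlane).norm.tendsto
    exact h1.eventually_le_const one_pos
  have hgood : ∀ {f : (Fin n → ℂ) × (Fin n → ℂ) → ℂ}, AnalyticAt ℂ f (p, star p) →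
      f (p, star p) ≠ 0 → ∀ᶠ q in 𝓝 o, AnalyticAt ℂ f (Φ q.1 q.2.1, star (Φ q.1 q.2.2)) ∧
        f (Φ q.1 q.2.1, star (Φ q.1 q.2.2)) ≠ 0 := fun hf hf0 =>
    (pr f1 f2).eventually (hf.eventually_analyticAt.and (hf.continuousAt.eventually_ne hf0))
  have hdens : ∀ᶠ q in 𝓝 o, ‖weightedDensity r e (Φ q.1) (q.2.1, star q.2.2)‖ ≤ M := by
    filter_upwards [wd.norm.eventually_le_const (lt_add_one _)] with q hq
    exact hq.trans (le_max_left _ _)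
  have hcos : ∀ᶠ q in 𝓝 o, 1 / 2 ≤ cosSq e q.1 (Φ q.1 q.2.1) := by
    have hc := he.continuousAt.tendsto
    have hre := (Complex.continuous_re.tendsto (e (p, star p))).comp hc
    have hre0 : (e (p, star p)).re ≠ 0 := by
      intro h
      have h1 := hermitian_diag_real heh p
      rw [h1, h] at he0
      simp at he0
    have h1 := ((hc.comp (pr k0 f1)).norm.pow 2).div
      ((hre.comp (pr k0 k0)).mul (hre.comp (pr f1 f1))) (mul_ne_zero hre0 hre0)
    have h2 : ‖e (p, star p)‖ ^ 2 / ((e (p, star p)).re * (e (p, star p)).re) = 1 :=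
      cosSq_self heh he0
    rw [h2] at h1
    exact h1.eventually_const_le (by norm_num)
  have hden : Tendsto (fun q : (Fin n → ℂ) × (Fin n → ℂ) × (Fin n → ℂ) =>
      ‖(fderiv ℂ (Φ q.1) q.2.1).det‖ ^ 2
        * (bilinMatrix (logHess r (Φ q.1 q.2.1, star (Φ q.1 q.2.1)))).det.re) (𝓝 o)
      (𝓝 (‖(fderiv ℂ (Φ p) 0).det‖ ^ 2 * (bilinMatrix (logHess r (p, star p))).det.re)) :=
    (e1.norm.pow 2).mul ((Complex.continuous_re.tendsto _).comp (lH.comp (pr f1 f1)))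
  set c₁ := ‖(fderiv ℂ (Φ p) 0).det‖ ^ 2 * (bilinMatrix (logHess r (p, star p))).det.re with hc₁
  have hc₁0 : 0 ≤ c₁ := mul_nonneg (by positivity) (det_re_pos_of_posDef hpp).le
  -- Strict positivity of `c₁` comes from injectivity of the derivative, which is known only once a
  -- Bochner chart at `p` exists, and that chart needs the ball being built here. So `c₁ = 0` cannot
  -- be excluded yet; `hc₁pos` does it afterwards.
  have hden' : ∀ᶠ q in 𝓝 o, c₁ / 2 ≤ ‖(fderiv ℂ (Φ q.1) q.2.1).det‖ ^ 2
      * (bilinMatrix (logHess r (Φ q.1 q.2.1, star (Φ q.1 q.2.1)))).det.re := by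
    rcases hc₁0.eq_or_lt with h | h
    · filter_upwards [f1.eventually hpos] with q hq
      rw [← h, zero_div]
      exact mul_nonneg (by positivity) (det_re_pos_of_posDef hq).le
    · exact hden.eventually_const_le (half_lt_self h)
  obtain ⟨ρ, hρ, hball⟩ := eventually_forall_ball ((k1.eventually a3).and ((k1.eventually g4).and
    ((hgood hr hr0).and ((hgood he he0).and (((bf hr hr0).eventually slit).and (hdens.and
    ((f1.eventually hU).and (hcos.and hden'))))))))
  have hJ : Tendsto (fun x => fderiv ℂ (Φ x) 0) (𝓝 p) (𝓝 (fderiv ℂ (Φ p) 0)) :=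
    c2.tendsto.comp ((continuous_id.prodMk continuous_const).tendsto p)
  have hJM : ∀ᶠ x in 𝓝 p, ‖fderiv ℂ (Φ x) 0‖ ≤ M := by
    filter_upwards [hJ.norm.eventually_le_const (lt_add_one _)] with x hx
    exact hx.trans (le_max_right _ _)
  have hz : (0 : Fin n → ℂ) ∈ Metric.ball (0 : Fin n → ℂ) ρ := Metric.mem_ball_self hρ
  have hchart : ∀ᶠ x in 𝓝 p, IsBochnerChart r e x (Φ x) ρ M := by
    filter_upwards [hball, z5, hpos, hJM] with x h1 h2 h3 h4
    exact
      { radius_pos := hρ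
        r_hermitian := hrh
        e_hermitian := heh
        map_zero := h2
        analytic := fun w hw => (h1 w hw 0 hz).1
        grad := fun w hw => (h1 w hw 0 hz).2.1
        r_analytic := fun w hw w' hw' => (h1 w hw w' hw').2.2.1
        e_analytic := fun w hw w' hw' => (h1 w hw w' hw').2.2.2.1
        slit := fun w hw w' hw' => (h1 w hw w' hw').2.2.2.2.1
        density_le := fun w hw w' hw' => (h1 w hw w' hw').2.2.2.2.2.1
        fderiv_le := h4
        posDef := h3 }
  have hp0 := hchart.self_of_nhds
  have hc₁pos : 0 < c₁ := by
    refine mul_pos (pow_pos (norm_pos_iff.2 ?_) 2) (det_re_pos_of_posDef hpp)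
    have hinj : LinearMap.ker (fderiv ℂ (Φ p) 0).toLinearMap = ⊥ :=
      LinearMap.ker_eq_bot.2 hp0.fderiv_injective
    intro hdet
    have h1 := LinearMap.bot_lt_ker_of_det_eq_zero (f := (fderiv ℂ (Φ p) 0).toLinearMap) hdet
    rw [hinj] at h1
    exact lt_irrefl _ h1
  obtain ⟨c₂, hc₂, hlow⟩ := exists_lower_bound_of_posDef hp0.form_posDef
  -- The form depends on the centre only through the derivative of the coordinates at 0, so
  -- continuity of that derivative preserves half of the lower bound found at `p`.
  have hclose : ∀ᶠ x in 𝓝 p, n * ‖fderiv ℂ (Φ p) 0 - fderiv ℂ (Φ x) 0‖ ≤ c₂ / 2 := by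
    have h1 : Tendsto (fun x => n * ‖fderiv ℂ (Φ p) 0 - fderiv ℂ (Φ x) 0‖) (𝓝 p) (𝓝 0) := by
      have h2 := ((tendsto_const_nhds (x := fderiv ℂ (Φ p) 0)).sub hJ).norm.const_mul (n : ℝ)
      rwa [sub_self, norm_zero, mul_zero] at h2
    exact h1.eventually_le_const (half_pos hc₂)
  refine ⟨Φ, ρ, M, min (c₁ / 2) (c₂ / 2), hρ, lt_min (half_pos hc₁pos) (half_pos hc₂), ?_, s6⟩
  filter_upwards [hchart, hball, hclose] with x hx h1 h2
  refine ⟨hx, fun w => ?_, fun w hw => ?_⟩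
  · have h3 : hp0.form w (star w) - hx.form w (star w)
        = w ⬝ᵥ star ((fderiv ℂ (Φ p) 0 - fderiv ℂ (Φ x) 0) w) := by
      rw [hp0.form_apply, hx.form_apply, ← dotProduct_sub, conjCLM_apply, conjCLM_apply, star_star,
        ← star_sub]
      rfl
    have h4 : ‖hp0.form w (star w) - hx.form w (star w)‖ ≤ c₂ / 2 * ‖w‖ ^ 2 := by
      rw [h3]
      calc _ ≤ n * (‖w‖ * ‖star ((fderiv ℂ (Φ p) 0 - fderiv ℂ (Φ x) 0) w)‖) :=
            norm_dotProduct_le _ _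
        _ ≤ n * (‖w‖ * (‖fderiv ℂ (Φ p) 0 - fderiv ℂ (Φ x) 0‖ * ‖w‖)) := by
            rw [norm_star]
            gcongr
            exact ContinuousLinearMap.le_opNorm _ _
        _ = n * ‖fderiv ℂ (Φ p) 0 - fderiv ℂ (Φ x) 0‖ * ‖w‖ ^ 2 := by ring
        _ ≤ _ := by gcongr
    have h5 := (Complex.re_le_norm _).trans h4
    rw [Complex.sub_re] at h5
    have h6 := hlow w
    have h7 : min (c₁ / 2) (c₂ / 2) * ‖w‖ ^ 2 ≤ c₂ / 2 * ‖w‖ ^ 2 := by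
      gcongr
      exact min_le_right _ _
    linarith
  · obtain ⟨-, -, -, -, -, -, h3, h4, h5⟩ := h1 w hw 0 hz
    exact ⟨h3, h4, (min_le_left _ _).trans h5⟩

end UniformBochner

/-! ### Normalized kernels -/

theorem eventually_mem_baseSet {X : Type*} [TopologicalSpace X] {F : X → Type*}
    [∀ x, TopologicalSpace (F x)] [TopologicalSpace (TotalSpace ℂ F)] [FiberBundle ℂ F] (x₀ : X) :
    ∀ᶠ x in 𝓝 x₀, x ∈ (trivializationAt ℂ F x₀).baseSet :=
  (trivializationAt ℂ F x₀).open_baseSet.mem_nhds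
    (FiberBundle.mem_baseSet_trivializationAt' x₀)

namespace HermitianAlgebraicFunction

variable {n : ℕ} {X : Type*} [TopologicalSpace X] [ChartedSpace (Fin n → ℂ) X] {F : X → Type*}
  [∀ x, AddCommGroup (F x)] [∀ x, Module ℂ (F x)] [∀ x, TopologicalSpace (F x)]
  [TopologicalSpace (TotalSpace ℂ F)] [FiberBundle ℂ F] [VectorBundle ℂ ℂ F]
  (Q : HermitianAlgebraicFunction n F)

theorem normSq_transition {p q x : X} (hp : x ∈ (trivializationAt ℂ F p).baseSet)
    (hq : x ∈ (trivializationAt ℂ F q).baseSet) :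
    Q.normSq (dualFrame F p x) = ‖frameTransition F q p x‖ ^ 2 * Q.normSq (dualFrame F q x) := by
  have h := Q.inFrames_transition hp hq hp hq
  rw [inFrames_self, inFrames_self, Complex.mul_conj'] at h
  exact_mod_cast h

/-- `|Q(x, ȳ)|² / (Q(x, x̄) Q(y, ȳ))`. -/
def cauchyRatio (x y : X) : ℝ :=
  ‖Q.inFrames x y x y‖ ^ 2 / (Q.normSq (dualFrame F x x) * Q.normSq (dualFrame F y y))

/-- A change of frame multiplies numerator and denominator by the same positive number. The frames
at `x` and `y` in the definition jump with the points, so every regularity statement goes through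
fixed frames. -/
theorem cauchyRatio_eq {p q x y : X} (hp : x ∈ (trivializationAt ℂ F p).baseSet)
    (hq : y ∈ (trivializationAt ℂ F q).baseSet) :
    Q.cauchyRatio x y = ‖Q.inFrames p q x y‖ ^ 2
      / (Q.normSq (dualFrame F p x) * Q.normSq (dualFrame F q y)) := by
  have hx := FiberBundle.mem_baseSet_trivializationAt' (F := ℂ) (E := F) x
  have hy := FiberBundle.mem_baseSet_trivializationAt' (F := ℂ) (E := F) y
  have t1 : ‖frameTransition F p x x‖ ≠ 0 := norm_ne_zero_iff.2 (frameTransition_ne_zero hx hp)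
  have t2 : ‖frameTransition F q y y‖ ≠ 0 := norm_ne_zero_iff.2 (frameTransition_ne_zero hy hq)
  rw [cauchyRatio, Q.inFrames_transition hx hp hy hq, Q.normSq_transition hx hp,
    Q.normSq_transition hy hq, norm_mul, norm_mul, RCLike.norm_conj, mul_pow, mul_pow,
    mul_mul_mul_comm, mul_div_mul_left _ _ (by positivity)]

theorem cauchyRatio_eq_cosSq {p : X} {z z' : Fin n → ℂ} (hz : z ∈ chartDomain n F p)
    (hz' : z' ∈ chartDomain n F p) :
    Q.cauchyRatio ((chartAt (Fin n → ℂ) p).symm z) ((chartAt (Fin n → ℂ) p).symm z')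
      = cosSq (Q.loc p) z z' := by
  rw [Q.cauchyRatio_eq hz.2 hz'.2, cosSq, loc_diag, loc_diag, Complex.ofReal_re, Complex.ofReal_re,
    loc, star_star]

theorem cauchyRatio_comm (x y : X) : Q.cauchyRatio x y = Q.cauchyRatio y x := by
  rw [cauchyRatio, cauchyRatio, inFrames_conj_symm, RCLike.norm_conj, mul_comm (Q.normSq _)]

variable {Q}

theorem IsPositive.normSq_self_pos (hQ : Q.IsPositive) (x : X) :
    0 < Q.normSq (dualFrame F x x) :=
  hQ.normSq_dualFrame_pos (FiberBundle.mem_baseSet_trivializationAt' (F := ℂ) (E := F) x)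

theorem IsPositive.cauchyRatio_nonneg (hQ : Q.IsPositive) (x y : X) : 0 ≤ Q.cauchyRatio x y :=
  div_nonneg (by positivity) (mul_pos (hQ.normSq_self_pos x) (hQ.normSq_self_pos y)).le

theorem SGCS.cauchyRatio_lt_one (hQ : Q.IsPositive) (hS : Q.SGCS) {x y : X} (hxy : x ≠ y) :
    Q.cauchyRatio x y < 1 := by
  rw [cauchyRatio, div_lt_one (mul_pos (hQ.normSq_self_pos x) (hQ.normSq_self_pos y))]
  exact hS.cauchySchwarz x y hxy _ _
    (dualFrame_ne_zero (FiberBundle.mem_baseSet_trivializationAt' (F := ℂ) (E := F) x))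
    (dualFrame_ne_zero (FiberBundle.mem_baseSet_trivializationAt' (F := ℂ) (E := F) y))

variable (Q)

theorem continuousAt_inFrames (x₀ y₀ : X) :
    ContinuousAt (fun q : X × X => Q.inFrames x₀ y₀ q.1 q.2) (x₀, y₀) := by
  have hx := mem_chart_source (Fin n → ℂ) x₀
  have hy := mem_chart_source (Fin n → ℂ) y₀
  have c1 : ContinuousAt (fun q : X × X => chartAt (Fin n → ℂ) x₀ q.1) (x₀, y₀) :=
    ((chartAt (Fin n → ℂ) x₀).continuousAt hx).comp (f := Prod.fst) (x := (x₀, y₀)) continuousAt_fst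
  have c2 : ContinuousAt (fun q : X × X => star (chartAt (Fin n → ℂ) y₀ q.2)) (x₀, y₀) :=
    continuous_star.continuousAt.comp
      (((chartAt (Fin n → ℂ) y₀).continuousAt hy).comp (f := Prod.snd) (x := (x₀, y₀))
        continuousAt_snd)
  have h := ContinuousAt.comp (x := (x₀, y₀))
    (f := fun q : X × X => (chartAt (Fin n → ℂ) x₀ q.1, star (chartAt (Fin n → ℂ) y₀ q.2)))
    (Q.holomorphic x₀ y₀).continuousAt (c1.prodMk c2)
  refine h.congr ?_
  have hopen : IsOpen ((chartAt (Fin n → ℂ) x₀).source ×ˢ (chartAt (Fin n → ℂ) y₀).source) :=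
    (chartAt (Fin n → ℂ) x₀).open_source.prod (chartAt (Fin n → ℂ) y₀).open_source
  filter_upwards [hopen.mem_nhds (x := (x₀, y₀)) ⟨hx, hy⟩] with q hq
  simp only [Function.comp_apply]
  rw [star_star, (chartAt (Fin n → ℂ) x₀).left_inv hq.1, (chartAt (Fin n → ℂ) y₀).left_inv hq.2]
  rfl

theorem continuousAt_normSq (x₀ : X) :
    ContinuousAt (fun x => Q.normSq (dualFrame F x₀ x)) x₀ := by
  have h := ContinuousAt.comp (x := x₀) (f := fun x => (x, x)) (Q.continuousAt_inFrames x₀ x₀)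
    (continuousAt_id.prodMk continuousAt_id)
  refine (Complex.continuous_re.continuousAt.comp h).congr (Eventually.of_forall fun x => ?_)
  simp [inFrames_self]

variable {Q}

theorem IsPositive.continuous_cauchyRatio (hQ : Q.IsPositive) :
    Continuous fun q : X × X => Q.cauchyRatio q.1 q.2 := by
  refine continuous_iff_continuousAt.2 fun ⟨x₀, y₀⟩ => ?_
  have c1 : ContinuousAt (fun q : X × X => Q.normSq (dualFrame F x₀ q.1)) (x₀, y₀) :=
    (Q.continuousAt_normSq x₀).comp (f := Prod.fst) (x := (x₀, y₀)) continuousAt_fst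
  have c2 : ContinuousAt (fun q : X × X => Q.normSq (dualFrame F y₀ q.2)) (x₀, y₀) :=
    (Q.continuousAt_normSq y₀).comp (f := Prod.snd) (x := (x₀, y₀)) continuousAt_snd
  refine (((Q.continuousAt_inFrames x₀ y₀).norm.pow 2).div (c1.mul c2)
    (mul_pos (hQ.normSq_self_pos x₀) (hQ.normSq_self_pos y₀)).ne').congr ?_
  filter_upwards [continuousAt_fst.eventually (eventually_mem_baseSet (F := F) x₀),
    continuousAt_snd.eventually (eventually_mem_baseSet (F := F) y₀)] with q h1 h2
  exact (Q.cauchyRatio_eq h1 h2).symm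

theorem IsPositive.continuous_cauchyRatio_right (hQ : Q.IsPositive) (x : X) :
    Continuous (Q.cauchyRatio x) :=
  Continuous.uncurry_left (f := Q.cauchyRatio) x hQ.continuous_cauchyRatio

end HermitianAlgebraicFunction

section NormalizedKernel

open HermitianAlgebraicFunction

variable {n : ℕ} {X : Type*} [TopologicalSpace X] [ChartedSpace (Fin n → ℂ) X]
  {L : X → Type*}
  [∀ x, AddCommGroup (L x)] [∀ x, Module ℂ (L x)] [∀ x, TopologicalSpace (L x)]
  [TopologicalSpace (TotalSpace ℂ L)] [FiberBundle ℂ L] [VectorBundle ℂ ℂ L]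
  {E : X → Type*}
  [∀ x, AddCommGroup (E x)] [∀ x, Module ℂ (E x)] [∀ x, TopologicalSpace (E x)]
  [TopologicalSpace (TotalSpace ℂ E)] [FiberBundle ℂ E] [VectorBundle ℂ ℂ E]
  {m : ℕ} (R : HermitianAlgebraicFunction n L) (P : HermitianAlgebraicFunction n E)
  (s : ∀ x : X, (⨂[ℂ]^m (L x)) ⊗[ℂ] E x)

/-- The coefficient of `s` in the frames at `p`. -/
def frameCoeff (p x : X) : ℂ := tensorEval m (dualFrame L p x) (dualFrame E p x) (s x)

theorem frameCoeff_transition {p q x : X} (hpL : x ∈ (trivializationAt ℂ L p).baseSet)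
    (hqL : x ∈ (trivializationAt ℂ L q).baseSet) (hpE : x ∈ (trivializationAt ℂ E p).baseSet)
    (hqE : x ∈ (trivializationAt ℂ E q).baseSet) :
    frameCoeff s p x = frameTransition L q p x ^ m * frameTransition E q p x * frameCoeff s q x := by
  rw [frameCoeff, dualFrame_eq_frameTransition_smul hpL hqL,
    dualFrame_eq_frameTransition_smul hpE hqE, tensorEval_smul, frameCoeff]

/-- `(R^m P)(x, x̄)` in the frames at `p`. -/
def frameWeight (m : ℕ) (R : HermitianAlgebraicFunction n L) (P : HermitianAlgebraicFunction n E)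
    (p x : X) : ℝ :=
  R.normSq (dualFrame L p x) ^ m * P.normSq (dualFrame E p x)

theorem frameWeight_transition {p q x : X} (hpL : x ∈ (trivializationAt ℂ L p).baseSet)
    (hqL : x ∈ (trivializationAt ℂ L q).baseSet) (hpE : x ∈ (trivializationAt ℂ E p).baseSet)
    (hqE : x ∈ (trivializationAt ℂ E q).baseSet) :
    frameWeight m R P p x
      = ‖frameTransition L q p x ^ m * frameTransition E q p x‖ ^ 2 * frameWeight m R P q x := by
  rw [frameWeight, R.normSq_transition hpL hqL, P.normSq_transition hpE hqE, frameWeight, norm_mul,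
    norm_pow]
  ring

/-- `|s(x)|² / (R^m P)(x, x̄)`. -/
def pointNormSq (x : X) : ℝ := ‖frameCoeff s x x‖ ^ 2 / frameWeight m R P x x

theorem pointNormSq_eq {p x : X} (hL : x ∈ (trivializationAt ℂ L p).baseSet)
    (hE : x ∈ (trivializationAt ℂ E p).baseSet) :
    pointNormSq R P s x = ‖frameCoeff s p x‖ ^ 2 / frameWeight m R P p x := by
  have hxL := FiberBundle.mem_baseSet_trivializationAt' (F := ℂ) (E := L) x
  have hxE := FiberBundle.mem_baseSet_trivializationAt' (F := ℂ) (E := E) x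
  have t : ‖frameTransition L p x x ^ m * frameTransition E p x x‖ ≠ 0 :=
    norm_ne_zero_iff.2 (mul_ne_zero (pow_ne_zero _ (frameTransition_ne_zero hxL hL))
      (frameTransition_ne_zero hxE hE))
  rw [pointNormSq, frameCoeff_transition s hxL hL hxE hE, frameWeight_transition R P hxL hL hxE hE,
    norm_mul, mul_pow, mul_div_mul_left _ _ (by positivity)]

/-- The integrand of `integralForm`. -/
def sectionKernel (x y : X) : ℂ :=
  powMulKernel m R P x y * sectionCoeff s y * conj (sectionCoeff s x) /
    (powMulKernel m R P x x * powMulKernel m R P y y)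

theorem sectionKernel_eq {p q x y : X} (hpL : x ∈ (trivializationAt ℂ L p).baseSet)
    (hpE : x ∈ (trivializationAt ℂ E p).baseSet) (hqL : y ∈ (trivializationAt ℂ L q).baseSet)
    (hqE : y ∈ (trivializationAt ℂ E q).baseSet) :
    sectionKernel R P s x y = R.inFrames p q x y ^ m * P.inFrames p q x y * frameCoeff s q y
      * conj (frameCoeff s p x) / (frameWeight m R P p x * frameWeight m R P q y : ℝ) := by
  have hxL := FiberBundle.mem_baseSet_trivializationAt' (F := ℂ) (E := L) x
  have hxE := FiberBundle.mem_baseSet_trivializationAt' (F := ℂ) (E := E) x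
  have hyL := FiberBundle.mem_baseSet_trivializationAt' (F := ℂ) (E := L) y
  have hyE := FiberBundle.mem_baseSet_trivializationAt' (F := ℂ) (E := E) y
  set τ := frameTransition L p x x ^ m * frameTransition E p x x with hτ
  set σ := frameTransition L q y y ^ m * frameTransition E q y y with hσ
  have t : τ ≠ 0 := mul_ne_zero (pow_ne_zero _ (frameTransition_ne_zero hxL hpL))
      (frameTransition_ne_zero hxE hpE)
  have t' : σ ≠ 0 := mul_ne_zero (pow_ne_zero _ (frameTransition_ne_zero hyL hqL))
      (frameTransition_ne_zero hyE hqE)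
  have ct : conj τ ≠ 0 := (map_ne_zero _).2 t
  have ct' : conj σ ≠ 0 := (map_ne_zero _).2 t'
  have hw : ∀ x, powMulKernel m R P x x = (frameWeight m R P x x : ℂ) := fun x => by
    rw [powMulKernel, R.toFun_self, P.toFun_self, frameWeight]
    push_cast
    rfl
  have hk : powMulKernel m R P x y
      = τ * conj σ * (R.inFrames p q x y ^ m * P.inFrames p q x y) := by
    have h1 := R.inFrames_transition hxL hpL hyL hqL
    have h2 := P.inFrames_transition hxE hpE hyE hqE
    rw [inFrames] at h1 h2
    rw [powMulKernel, h1, h2, hτ, hσ]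
    simp only [map_mul, map_pow]
    ring
  have hx : sectionCoeff s x = τ * frameCoeff s p x := frameCoeff_transition s hxL hpL hxE hpE
  have hy : sectionCoeff s y = σ * frameCoeff s q y := frameCoeff_transition s hyL hqL hyE hqE
  rw [sectionKernel, hw, hw, hk, hx, hy, frameWeight_transition R P hxL hpL hxE hpE,
    frameWeight_transition R P hyL hqL hyE hqE, ← hτ, ← hσ]
  push_cast
  rw [← Complex.mul_conj', ← Complex.mul_conj', map_mul conj τ (frameCoeff s p x)]
  have e1 : τ * conj σ * (R.inFrames p q x y ^ m * P.inFrames p q x y) * (σ * frameCoeff s q y)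
      * (conj τ * conj (frameCoeff s p x))
      = (τ * conj τ * (σ * conj σ)) * (R.inFrames p q x y ^ m * P.inFrames p q x y
        * frameCoeff s q y * conj (frameCoeff s p x)) := by ring
  have e2 : τ * conj τ * (frameWeight m R P p x : ℂ) * (σ * conj σ * (frameWeight m R P q y : ℂ))
      = (τ * conj τ * (σ * conj σ))
        * ((frameWeight m R P p x : ℂ) * (frameWeight m R P q y : ℂ)) := by ring
  rw [e1, e2, mul_div_mul_left _ _ (mul_ne_zero (mul_ne_zero t ct) (mul_ne_zero t' ct'))]

variable {R P}

theorem frameWeight_pos (hR : R.IsPositive) (hP : P.IsPositive) {p x : X}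
    (hL : x ∈ (trivializationAt ℂ L p).baseSet) (hE : x ∈ (trivializationAt ℂ E p).baseSet) :
    0 < frameWeight m R P p x :=
  mul_pos (pow_pos (hR.normSq_dualFrame_pos hL) _) (hP.normSq_dualFrame_pos hE)

theorem frameWeight_self_pos (hR : R.IsPositive) (hP : P.IsPositive) (x : X) :
    0 < frameWeight m R P x x :=
  frameWeight_pos hR hP (FiberBundle.mem_baseSet_trivializationAt' (F := ℂ) (E := L) x)
    (FiberBundle.mem_baseSet_trivializationAt' (F := ℂ) (E := E) x)

theorem pointNormSq_nonneg (hR : R.IsPositive) (hP : P.IsPositive) (x : X) :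
    0 ≤ pointNormSq R P s x :=
  div_nonneg (by positivity) (frameWeight_self_pos hR hP x).le

/-- An exact factorization. It controls the kernel away from the diagonal and, near the diagonal,
converts the modulus of the holomorphic factor into pointwise norms. -/
theorem norm_sectionKernel (hR : R.IsPositive) (hP : P.IsPositive) (x y : X) :
    ‖sectionKernel R P s x y‖ = Real.sqrt (pointNormSq R P s x) * Real.sqrt (pointNormSq R P s y)
      * Real.sqrt (R.cauchyRatio x y ^ m * P.cauchyRatio x y) := by
  have hxL := FiberBundle.mem_baseSet_trivializationAt' (F := ℂ) (E := L) x
  have hxE := FiberBundle.mem_baseSet_trivializationAt' (F := ℂ) (E := E) x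
  have hyL := FiberBundle.mem_baseSet_trivializationAt' (F := ℂ) (E := L) y
  have hyE := FiberBundle.mem_baseSet_trivializationAt' (F := ℂ) (E := E) y
  have px := pointNormSq_nonneg s hR hP x
  have py := pointNormSq_nonneg s hR hP y
  have r1 := (hR.normSq_self_pos x).ne'
  have r2 := (hR.normSq_self_pos y).ne'
  have p1 := (hP.normSq_self_pos x).ne'
  have p2 := (hP.normSq_self_pos y).ne'
  have key : ‖sectionKernel R P s x y‖ ^ 2 = pointNormSq R P s x * pointNormSq R P s y
      * (R.cauchyRatio x y ^ m * P.cauchyRatio x y) := by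
    rw [sectionKernel_eq R P s hxL hxE hyL hyE, norm_div, Complex.norm_real, Real.norm_eq_abs,
      div_pow, sq_abs, norm_mul, norm_mul, norm_mul, RCLike.norm_conj, norm_pow]
    simp only [pointNormSq, HermitianAlgebraicFunction.cauchyRatio, frameWeight, div_pow, mul_pow]
    field_simp
    ring
  rw [← Real.sqrt_mul px, ← Real.sqrt_mul (mul_nonneg px py), ← key, Real.sqrt_sq (norm_nonneg _)]

theorem continuousAt_frameCoeff {s : ∀ x : X, (⨂[ℂ]^m (L x)) ⊗[ℂ] E x}
    (hs : IsHolomorphicSection n s) (x₀ : X) : ContinuousAt (frameCoeff s x₀) x₀ := by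
  have hx := mem_chart_source (Fin n → ℂ) x₀
  refine ((hs x₀).continuousAt.comp ((chartAt (Fin n → ℂ) x₀).continuousAt hx)).congr ?_
  filter_upwards [(chartAt (Fin n → ℂ) x₀).open_source.mem_nhds hx] with x hx'
  simp only [Function.comp_apply]
  rw [(chartAt (Fin n → ℂ) x₀).left_inv hx']
  rfl

theorem continuousAt_frameWeight (R : HermitianAlgebraicFunction n L)
    (P : HermitianAlgebraicFunction n E) (x₀ : X) : ContinuousAt (frameWeight m R P x₀) x₀ :=
  ((R.continuousAt_normSq x₀).pow m).mul (P.continuousAt_normSq x₀)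

theorem continuous_pointNormSq (hR : R.IsPositive) (hP : P.IsPositive)
    {s : ∀ x : X, (⨂[ℂ]^m (L x)) ⊗[ℂ] E x} (hs : IsHolomorphicSection n s) :
    Continuous (pointNormSq R P s) := by
  refine continuous_iff_continuousAt.2 fun x₀ => ?_
  refine (((continuousAt_frameCoeff hs x₀).norm.pow 2).div (continuousAt_frameWeight (m := m) R P x₀)
    (frameWeight_self_pos hR hP x₀).ne').congr ?_
  filter_upwards [eventually_mem_baseSet (F := L) x₀, eventually_mem_baseSet (F := E) x₀]
    with x h1 h2
  exact (pointNormSq_eq R P s h1 h2).symm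

/-- The frames in the definition are not continuous in the points, so continuity is read off in the
frames fixed at `x₀` and `y₀`. -/
theorem continuous_sectionKernel (hR : R.IsPositive) (hP : P.IsPositive)
    {s : ∀ x : X, (⨂[ℂ]^m (L x)) ⊗[ℂ] E x} (hs : IsHolomorphicSection n s) :
    Continuous fun q : X × X => sectionKernel R P s q.1 q.2 := by
  refine continuous_iff_continuousAt.2 fun ⟨x₀, y₀⟩ => ?_
  have k1 := (continuousAt_frameCoeff hs x₀).comp (f := Prod.fst) (x := (x₀, y₀)) continuousAt_fst
  have k2 := (continuousAt_frameCoeff hs y₀).comp (f := Prod.snd) (x := (x₀, y₀)) continuousAt_snd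
  have w1 := (continuousAt_frameWeight (m := m) R P x₀).comp (f := Prod.fst) (x := (x₀, y₀))
    continuousAt_fst
  have w2 := (continuousAt_frameWeight (m := m) R P y₀).comp (f := Prod.snd) (x := (x₀, y₀))
    continuousAt_snd
  have w0 : ((frameWeight m R P x₀ x₀ * frameWeight m R P y₀ y₀ : ℝ) : ℂ) ≠ 0 := by
    exact_mod_cast (mul_pos (frameWeight_self_pos hR hP x₀) (frameWeight_self_pos hR hP y₀)).ne'
  refine ((((((R.continuousAt_inFrames x₀ y₀).pow m).mul (P.continuousAt_inFrames x₀ y₀)).mul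
    k2).mul (Complex.continuous_conj.continuousAt.comp k1)).div
      (Complex.continuous_ofReal.continuousAt.comp (w1.mul w2)) w0).congr ?_
  filter_upwards [continuousAt_fst.eventually (eventually_mem_baseSet (F := L) x₀),
    continuousAt_snd.eventually (eventually_mem_baseSet (F := L) y₀),
    continuousAt_fst.eventually (eventually_mem_baseSet (F := E) x₀),
    continuousAt_snd.eventually (eventually_mem_baseSet (F := E) y₀)] with q h1 h2 h3 h4
  rw [sectionKernel_eq R P s h1 h3 h2 h4]
  rfl

theorem sectionInner_self_eq [MeasurableSpace X] (R : HermitianAlgebraicFunction n L)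
    (P : HermitianAlgebraicFunction n E) (Ω : Measure X) :
    sectionInner R P Ω s s = ((∫ x, pointNormSq R P s x ∂Ω : ℝ) : ℂ) := by
  rw [sectionInner, ← integral_complex_ofReal]
  refine integral_congr_ae (Eventually.of_forall fun x => ?_)
  simp only [pointNormSq, powMulKernel, R.toFun_self, P.toFun_self, frameWeight]
  rw [Complex.mul_conj']
  push_cast
  rfl

end NormalizedKernel

/-! ### Local models -/

section LocalModels

open HermitianAlgebraicFunction

variable {n : ℕ} {X : Type*} [TopologicalSpace X] [ChartedSpace (Fin n → ℂ) X]
  {L : X → Type*}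
  [∀ x, AddCommGroup (L x)] [∀ x, Module ℂ (L x)] [∀ x, TopologicalSpace (L x)]
  [TopologicalSpace (TotalSpace ℂ L)] [FiberBundle ℂ L] [VectorBundle ℂ ℂ L]
  {E : X → Type*}
  [∀ x, AddCommGroup (E x)] [∀ x, Module ℂ (E x)] [∀ x, TopologicalSpace (E x)]
  [TopologicalSpace (TotalSpace ℂ E)] [FiberBundle ℂ E] [VectorBundle ℂ ℂ E]

/-- A parametrization `κ` of a neighbourhood of `x` by a closed ball of `ℂⁿ` in which the diastasis
of `R` is `T(w, w̄)` and the density `g` of the volume form, weighted by the Cauchy–Schwarz ratio of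
`P`, is `det T`, up to errors controlled by `C`. -/
structure IsLocalModel [MeasurableSpace X] (R : HermitianAlgebraicFunction n L)
    (P : HermitianAlgebraicFunction n E) (ρ c C : ℝ) (W : Set X) (x : X) (κ : (Fin n → ℂ) → X)
    (g : (Fin n → ℂ) → ℝ) (T : (Fin n → ℂ) →L[ℂ] (Fin n → ℂ) →L[ℂ] ℂ) : Prop where
  subset_image : W ⊆ κ '' Metric.closedBall 0 ρ
  measurableSet_image : MeasurableSet (κ '' Metric.closedBall 0 ρ)
  continuousOn : ContinuousOn κ (Metric.closedBall 0 ρ)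
  continuousOn_density : ContinuousOn g (Metric.closedBall 0 ρ)
  volume_restrict : R.volumeForm.restrict (κ '' Metric.closedBall 0 ρ)
    = ((volume.restrict (Metric.closedBall 0 ρ)).withDensity fun w => ENNReal.ofReal (g w)).map κ
  posDef : (bilinMatrix T).PosDef
  form_lower : ∀ w, c * ‖w‖ ^ 2 ≤ (T w (star w)).re
  det_le : (bilinMatrix T).det.re ≤ C
  density_lower : ∀ w ∈ Metric.closedBall (0 : Fin n → ℂ) ρ, c ≤ g w
  ratio_pos : ∀ w ∈ Metric.closedBall (0 : Fin n → ℂ) ρ, 0 < R.cauchyRatio x (κ w)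
  half_le_ratio : ∀ w ∈ Metric.closedBall (0 : Fin n → ℂ) ρ, 1 / 2 ≤ P.cauchyRatio x (κ w)
  diastasis : ∀ w ∈ Metric.closedBall (0 : Fin n → ℂ) ρ,
    |-Real.log (R.cauchyRatio x (κ w)) - (T w (star w)).re| ≤ C * ‖w‖ ^ 4
  density : ∀ w ∈ Metric.closedBall (0 : Fin n → ℂ) ρ,
    |P.cauchyRatio x (κ w) * g w - (bilinMatrix T).det.re| ≤ C * ‖w‖ ^ 2
  kernel : ∀ (m : ℕ) (s : ∀ x : X, (⨂[ℂ]^m (L x)) ⊗[ℂ] E x), IsHolomorphicSection n s →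
    ∃ F : (Fin n → ℂ) → ℂ, (∀ w ∈ Metric.closedBall (0 : Fin n → ℂ) ρ, AnalyticAt ℂ F w) ∧
      F 0 = (pointNormSq R P s x : ℂ) ∧ ∀ w ∈ Metric.closedBall (0 : Fin n → ℂ) ρ,
        sectionKernel R P s x (κ w)
          = F w * (R.cauchyRatio x (κ w) ^ m * P.cauchyRatio x (κ w) : ℝ)

/-- As a function of y, R(x, ȳ) is antiholomorphic, but it equals |R(y, x̄)|² / R(y, x̄). Taking the
moduli into the weight leaves s(y) conj s(x) / (R^m P)(y, x̄), holomorphic because R(y, x̄) and P(y,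
x̄) do not vanish in the chart. -/
theorem exists_local_factor [IsManifold 𝓘(ℂ, Fin n → ℂ) ω X]
    [ContMDiffVectorBundle ω ℂ L 𝓘(ℂ, Fin n → ℂ)] [ContMDiffVectorBundle ω ℂ E 𝓘(ℂ, Fin n → ℂ)]
    {R : HermitianAlgebraicFunction n L} {P : HermitianAlgebraicFunction n E}
    (hR : R.IsPositive) (hP : P.IsPositive) {p : X} {z : Fin n → ℂ} {φ : (Fin n → ℂ) → Fin n → ℂ}
    {ρ M : ℝ} (h : IsBochnerChart (R.loc p) (P.loc p) z φ ρ M) {m : ℕ}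
    {s : ∀ x : X, (⨂[ℂ]^m (L x)) ⊗[ℂ] E x} (hs : IsHolomorphicSection n s)
    (hφ : ∀ w ∈ Metric.ball (0 : Fin n → ℂ) ρ, φ w ∈ chartDomain n L p ∩ chartDomain n E p) :
    ∃ F : (Fin n → ℂ) → ℂ, (∀ w ∈ Metric.ball (0 : Fin n → ℂ) ρ, AnalyticAt ℂ F w) ∧
      F 0 = (pointNormSq R P s ((chartAt (Fin n → ℂ) p).symm z) : ℂ) ∧
      ∀ w ∈ Metric.ball (0 : Fin n → ℂ) ρ,
        sectionKernel R P s ((chartAt (Fin n → ℂ) p).symm z) ((chartAt (Fin n → ℂ) p).symm (φ w))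
          = F w * (cosSq (R.loc p) z (φ w) ^ m * cosSq (P.loc p) z (φ w) : ℝ) := by
  have hz := hφ 0 h.zero_mem
  rw [h.map_zero] at hz
  have hw0 : ∀ y ∈ chartDomain n L p ∩ chartDomain n E p,
      frameWeight m R P p ((chartAt (Fin n → ℂ) p).symm y)
        = (R.loc p (y, star y)).re ^ m * (P.loc p (y, star y)).re := fun y _ => by
    rw [loc_diag, loc_diag, Complex.ofReal_re, Complex.ofReal_re, frameWeight]
  have rpos : ∀ y ∈ chartDomain n L p ∩ chartDomain n E p, (R.loc p (y, star y)).re ≠ 0 :=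
    fun y hy => by
      rw [loc_diag, Complex.ofReal_re]
      exact (hR.normSq_dualFrame_pos hy.1.2).ne'
  have ppos : ∀ y ∈ chartDomain n L p ∩ chartDomain n E p, (P.loc p (y, star y)).re ≠ 0 :=
    fun y hy => by
      rw [loc_diag, Complex.ofReal_re]
      exact (hP.normSq_dualFrame_pos hy.2.2).ne'
  have hswap : ∀ {f : (Fin n → ℂ) × (Fin n → ℂ) → ℂ}, (∀ a, f a = conj (f (star a.2, star a.1))) →
      ∀ u v, f (u, star v) = conj (f (v, star u)) := fun hf u v => by
    rw [hf (u, star v), star_star]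
  have hr0 : ∀ w ∈ Metric.ball (0 : Fin n → ℂ) ρ,
      AnalyticAt ℂ (R.loc p) (φ w, star z) ∧ R.loc p (φ w, star z) ≠ 0 := fun w hw => by
    have := h.r_analytic w hw 0 h.zero_mem
    rwa [h.map_zero] at this
  have he0 : ∀ w ∈ Metric.ball (0 : Fin n → ℂ) ρ,
      AnalyticAt ℂ (P.loc p) (φ w, star z) ∧ P.loc p (φ w, star z) ≠ 0 := fun w hw => by
    have := h.e_analytic w hw 0 h.zero_mem
    rwa [h.map_zero] at this
  refine ⟨fun w => locSection n s p (φ w) * conj (locSection n s p z)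
    / (R.loc p (φ w, star z) ^ m * P.loc p (φ w, star z)), fun w hw => ?_, ?_, fun w hw => ?_⟩
  · have a1 : AnalyticAt ℂ (fun w => locSection n s p (φ w)) w :=
      (hs.analyticAt (hφ w hw).1 (hφ w hw).2).fun_comp (h.analytic w hw)
    have a2 := h.analyticAt_left hw (hr0 w hw).1
    have a3 := h.analyticAt_left hw (he0 w hw).1
    exact (a1.mul analyticAt_const).div ((a2.pow m).mul a3)
      (mul_ne_zero (pow_ne_zero _ (hr0 w hw).2) (he0 w hw).2)
  · simp only [h.map_zero]
    rw [pointNormSq_eq R P s hz.1.2 hz.2.2, hw0 z hz, Complex.mul_conj',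
      hermitian_diag_real (R.loc_hermitian p) z, hermitian_diag_real (P.loc_hermitian p) z]
    push_cast
    rfl
  · have h1 := hφ w hw
    rw [sectionKernel_eq R P s hz.1.2 hz.2.2 h1.1.2 h1.2.2, hw0 z hz, hw0 _ h1]
    have i1 : R.inFrames p p ((chartAt (Fin n → ℂ) p).symm z) ((chartAt (Fin n → ℂ) p).symm (φ w))
        = conj (R.loc p (φ w, star z)) := by
      rw [inFrames_conj_symm, loc, star_star]
    have i2 : P.inFrames p p ((chartAt (Fin n → ℂ) p).symm z) ((chartAt (Fin n → ℂ) p).symm (φ w))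
        = conj (P.loc p (φ w, star z)) := by
      rw [inFrames_conj_symm, loc, star_star]
    rw [i1, i2, cosSq, cosSq, hswap (R.loc_hermitian p) z (φ w), hswap (P.loc_hermitian p) z (φ w),
      RCLike.norm_conj, RCLike.norm_conj]
    have n1 := (hr0 w hw).2
    have n2 := (he0 w hw).2
    have n3 : ((R.loc p (z, star z)).re : ℂ) ≠ 0 := by exact_mod_cast rpos z hz
    have n4 : ((P.loc p (z, star z)).re : ℂ) ≠ 0 := by exact_mod_cast ppos z hz
    have n5 : ((R.loc p (φ w, star (φ w))).re : ℂ) ≠ 0 := by exact_mod_cast rpos _ h1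
    have n6 : ((P.loc p (φ w, star (φ w))).re : ℂ) ≠ 0 := by exact_mod_cast ppos _ h1
    push_cast
    rw [← Complex.mul_conj', ← Complex.mul_conj', div_pow, mul_pow, mul_pow]
    change _ * _ * locSection n s p (φ w) * conj (locSection n s p z) / _ = _
    field_simp

variable [MeasurableSpace X] [BorelSpace X] [CompactSpace X]
  [IsManifold 𝓘(ℂ, Fin n → ℂ) ω X]
  [ContMDiffVectorBundle ω ℂ L 𝓘(ℂ, Fin n → ℂ)] [ContMDiffVectorBundle ω ℂ E 𝓘(ℂ, Fin n → ℂ)]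
  {R : HermitianAlgebraicFunction n L} {P : HermitianAlgebraicFunction n E}

theorem exists_localModel (hR : R.IsPositive) (hP : P.IsPositive) (hS : R.SGCS) (p : X) :
    ∃ ρ c C : ℝ, 0 < ρ ∧ 0 < c ∧ 0 ≤ C ∧ C * ρ ^ 2 ≤ c / 4 ∧ ∃ W ∈ 𝓝 p,
      ∀ᶠ x in 𝓝 p, ∃ κ g T, IsLocalModel R P ρ c C W x κ g T := by
  set z₀ := chartAt (Fin n → ℂ) p p with hz₀
  have hL : z₀ ∈ chartDomain n L p := chart_mem_chartDomain (mem_frameDomain_self p)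
  have hE : z₀ ∈ chartDomain n E p := chart_mem_chartDomain (mem_frameDomain_self p)
  have hU : chartDomain n L p ∩ chartDomain n E p ∈ 𝓝 z₀ :=
    inter_mem ((isOpen_chartDomain p).mem_nhds hL) ((isOpen_chartDomain p).mem_nhds hE)
  obtain ⟨Φ, ρ, M, c, hρ, hc, hΦ, hsurj⟩ := exists_uniform_bochnerChart hU (R.loc_hermitian p)
    (P.loc_hermitian p) (R.analyticAt_loc hL) (hR.loc_diag_ne_zero hL) (P.analyticAt_loc hE)
    (hP.loc_diag_ne_zero hE) (by
      filter_upwards [(isOpen_chartDomain p).mem_nhds hL] with z hz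
      exact hS.posDef_levi hR hz)
  set C := max (max ((1 + n * M * ρ ^ 2) / ρ ^ 4) (2 * M / ρ ^ 2)) (max M 0) with hC
  have hC0 : 0 ≤ C := (le_max_right M 0).trans (le_max_right _ _)
  -- Half of `ρ` puts the closed ball inside the open one; the square root enforces `C * ρ₁ ^ 2 ≤ c
  -- / 4`, with `C + 1` guarding against `C = 0`.
  set ρ₁ := min (ρ / 2) (Real.sqrt (c / (4 * (C + 1)))) with hρ₁
  have hρ₁0 : 0 < ρ₁ := lt_min (half_pos hρ) (Real.sqrt_pos.2 (by positivity))
  have hρ₁ρ : ρ₁ < ρ := (min_le_left _ _).trans_lt (half_lt_self hρ)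
  have hsub : Metric.closedBall (0 : Fin n → ℂ) ρ₁ ⊆ Metric.ball 0 ρ :=
    Metric.closedBall_subset_ball hρ₁ρ
  have hsmall : C * ρ₁ ^ 2 ≤ c / 4 := by
    have h1 : ρ₁ ^ 2 ≤ c / (4 * (C + 1)) := by
      rw [← Real.sq_sqrt (show 0 ≤ c / (4 * (C + 1)) by positivity)]
      exact pow_le_pow_left₀ hρ₁0.le (min_le_right _ _) 2
    calc C * ρ₁ ^ 2 ≤ (C + 1) * (c / (4 * (C + 1))) := by
          gcongr
          linarith
      _ = c / 4 := by field_simp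
  -- The product form of the neighbourhood separates the condition on centres from that on targets,
  -- so that one `W` serves all nearby centres.
  have hs := hsurj ρ₁ hρ₁0
  rw [nhds_prod_eq, eventually_prod_iff] at hs
  obtain ⟨pa, hpa, pb, hpb, hab⟩ := hs
  have hchart : Tendsto (chartAt (Fin n → ℂ) p) (𝓝 p) (𝓝 z₀) :=
    ((chartAt (Fin n → ℂ) p).continuousAt (mem_chart_source _ p)).tendsto
  have hsource : ∀ᶠ x in 𝓝 p, x ∈ (chartAt (Fin n → ℂ) p).source :=
    (chartAt (Fin n → ℂ) p).open_source.mem_nhds (mem_chart_source _ p)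
  refine ⟨ρ₁, c, C, hρ₁0, hc, hC0, hsmall, {y | pb (chartAt (Fin n → ℂ) p y) ∧
    y ∈ (chartAt (Fin n → ℂ) p).source}, (hchart.eventually hpb).and hsource, ?_⟩
  filter_upwards [hchart.eventually hΦ, hchart.eventually hpa, hsource] with x hx hxa hxs
  set z := chartAt (Fin n → ℂ) p x with hz
  obtain ⟨h, hlow, hball⟩ := hx
  have hxz : (chartAt (Fin n → ℂ) p).symm z = x := (chartAt (Fin n → ℂ) p).left_inv hxs
  have hzD : z ∈ chartDomain n L p ∩ chartDomain n E p := by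
    have := (hball 0 h.zero_mem).1
    rwa [h.map_zero] at this
  -- The affine identity `grad` recovers `w` from `Φ z w`.
  have hinj : Set.InjOn (Φ z) (Metric.closedBall 0 ρ₁) := by
    intro a ha b hb hab
    have h1 : ∀ k, (a - b) ⬝ᵥ k = 0 := fun k => by
      have h2 := h.grad a (hsub ha) k
      rw [hab, h.grad b (hsub hb) k] at h2
      rw [sub_dotProduct, sub_eq_zero]
      exact (add_left_cancel h2).symm
    exact sub_eq_zero.1 (dotProduct_eq_zero _ h1)
  have hvol := volumeForm_restrict_image hR p (Metric.isClosed_closedBall.measurableSet)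
    (fun w hw => (h.analytic w (hsub hw)).differentiableAt) hinj
    (fun w hw => (hball w (hsub hw)).1.1)
  have ra : ∀ w ∈ Metric.closedBall (0 : Fin n → ℂ) ρ₁,
      R.cauchyRatio x ((chartAt (Fin n → ℂ) p).symm (Φ z w)) = cosSq (R.loc p) z (Φ z w) :=
    fun w hw => by
      rw [← R.cauchyRatio_eq_cosSq hzD.1 (hball w (hsub hw)).1.1, hxz]
  have rb : ∀ w ∈ Metric.closedBall (0 : Fin n → ℂ) ρ₁,
      P.cauchyRatio x ((chartAt (Fin n → ℂ) p).symm (Φ z w)) = cosSq (P.loc p) z (Φ z w) :=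
    fun w hw => by
      rw [← P.cauchyRatio_eq_cosSq hzD.2 (hball w (hsub hw)).1.2, hxz]
  have hpos : ∀ w ∈ Metric.closedBall (0 : Fin n → ℂ) ρ₁, 0 < cosSq (R.loc p) z (Φ z w) := by
    intro w hw
    have h1 := (h.r_analytic 0 h.zero_mem w (hsub hw)).2
    rw [h.map_zero] at h1
    refine div_pos (pow_pos (norm_pos_iff.2 h1) 2) ?_
    rw [loc_diag, loc_diag, Complex.ofReal_re, Complex.ofReal_re]
    exact mul_pos (hR.normSq_dualFrame_pos hzD.1.2)
      (hR.normSq_dualFrame_pos (hball w (hsub hw)).1.1.2)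
  refine ⟨fun w => (chartAt (Fin n → ℂ) p).symm (Φ z w), fun w => ‖(fderiv ℂ (Φ z) w).det‖ ^ 2
    * (bilinMatrix (R.levi p (Φ z w))).det.re, h.form, ?_⟩
  exact
    { subset_image := fun y hy => by
        obtain ⟨w, hw, hwy⟩ := hab hxa hy.1
        refine ⟨w, Metric.ball_subset_closedBall hw, ?_⟩
        have h1 : Φ z w = chartAt (Fin n → ℂ) p y := hwy
        simp only [h1]
        exact (chartAt (Fin n → ℂ) p).left_inv hy.2
      measurableSet_image := hvol.1
      continuousOn := fun w hw => (((chartAt (Fin n → ℂ) p).continuousAt_symm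
        (hball w (hsub hw)).1.1.1).comp (h.analytic w (hsub hw)).continuousAt).continuousWithinAt
      continuousOn_density := fun w hw => by
        have a1 : ContinuousAt (fun w => (fderiv ℂ (Φ z) w).det) w :=
          continuous_clm_det.continuousAt.comp (h.analytic w (hsub hw)).fderiv.continuousAt
        have a2 : ContinuousAt (fun w => (bilinMatrix (R.levi p (Φ z w))).det) w :=
          ContinuousAt.comp (g := fun z => (bilinMatrix (R.levi p z)).det)
            (continuousAt_det_levi hR (hball w (hsub hw)).1.1) (h.analytic w (hsub hw)).continuousAt
        exact ((a1.norm.pow 2).mul (Complex.continuous_re.continuousAt.comp a2)).continuousWithinAt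
      volume_restrict := hvol.2
      posDef := h.form_posDef
      form_lower := hlow
      det_le := by
        have h1 := h.density_le 0 h.zero_mem 0 h.zero_mem
        rw [star_zero, h.weightedDensity_right_zero h.zero_mem] at h1
        exact (Complex.re_le_norm _).trans (h1.trans ((le_max_left _ _).trans (le_max_right _ _)))
      density_lower := fun w hw => (hball w (hsub hw)).2.2
      ratio_pos := fun w hw => by
        rw [ra w hw]
        exact hpos w hw
      half_le_ratio := fun w hw => by
        rw [rb w hw]
        exact (hball w (hsub hw)).2.1
      diastasis := fun w hw => by
        rw [ra w hw]
        refine (h.diastasis_estimate (hsub hw) (hpos w hw)).trans ?_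
        gcongr
        exact (le_max_left _ _).trans (le_max_left _ _)
      density := fun w hw => by
        rw [rb w hw]
        refine (h.density_estimate (hsub hw)).trans ?_
        gcongr
        exact (le_max_right _ _).trans (le_max_left _ _)
      kernel := fun m s hs => by
        obtain ⟨F, h1, h2, h3⟩ := exists_local_factor hR hP h hs fun w hw => (hball w hw).1
        rw [hxz] at h2 h3
        refine ⟨F, fun w hw => h1 w (hsub hw), h2, fun w hw => ?_⟩
        rw [ra w hw, rb w hw]
        exact h3 w (hsub hw) }

end LocalModels

/-! ### Pointwise estimates -/

theorem exists_rpow_decay {q : ℝ} (hq0 : 0 ≤ q) (hq1 : q < 1) (j : ℕ) :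
    ∃ K ≥ 0, ∀ m : ℕ, 0 < m → q ^ ((m : ℝ) / 20) ≤ K / (m : ℝ) ^ j := by
  set t := q ^ ((1 : ℝ) / 20) with ht
  have ht0 : 0 ≤ t := Real.rpow_nonneg hq0 _
  have ht1 : t < 1 := Real.rpow_lt_one hq0 hq1 (by norm_num)
  obtain ⟨K, hK⟩ := (tendsto_pow_const_mul_const_pow_of_abs_lt_one j
    (by rwa [abs_of_nonneg ht0])).bddAbove_range
  refine ⟨max K 0, le_max_right _ _, fun m hm => ?_⟩
  have h1 : q ^ ((m : ℝ) / 20) = t ^ m := by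
    rw [ht, ← Real.rpow_natCast, ← Real.rpow_mul hq0]
    congr 1
    ring
  rw [h1, le_div_iff₀ (by positivity), mul_comm]
  exact (hK ⟨m, rfl⟩).trans (le_max_left _ _)

theorem Continuous.integrable_of_compactSpace {X G : Type*} [TopologicalSpace X] [CompactSpace X]
    [MeasurableSpace X] [BorelSpace X] [NormedAddCommGroup G] {μ : Measure X} [IsFiniteMeasure μ]
    {f : X → G} (hf : Continuous f) : Integrable f μ :=
  hf.integrable_of_hasCompactSupport (HasCompactSupport.of_compactSpace f)

section PointwiseEstimates

open HermitianAlgebraicFunction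

variable {n : ℕ} {X : Type*} [TopologicalSpace X] [ChartedSpace (Fin n → ℂ) X]
  {L : X → Type*}
  [∀ x, AddCommGroup (L x)] [∀ x, Module ℂ (L x)] [∀ x, TopologicalSpace (L x)]
  [TopologicalSpace (TotalSpace ℂ L)] [FiberBundle ℂ L] [VectorBundle ℂ ℂ L]
  {E : X → Type*}
  [∀ x, AddCommGroup (E x)] [∀ x, Module ℂ (E x)] [∀ x, TopologicalSpace (E x)]
  [TopologicalSpace (TotalSpace ℂ E)] [FiberBundle ℂ E] [VectorBundle ℂ ℂ E]
  {R : HermitianAlgebraicFunction n L} {P : HermitianAlgebraicFunction n E}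

/-- The only place where the global Cauchy–Schwarz inequality acts. At `p` its strictness and
compactness of the complement give a maximum below 1; compactness then lets the base point move. -/
theorem exists_cauchyRatio_le_of_notMem [CompactSpace X] (hR : R.IsPositive) (hS : R.SGCS) {p : X}
    {W : Set X} (hW : W ∈ 𝓝 p) :
    ∃ q, 0 ≤ q ∧ q < 1 ∧ ∀ᶠ x in 𝓝 p, ∀ y ∉ W, R.cauchyRatio x y ≤ q := by
  have hK : IsCompact (interior W)ᶜ := isOpen_interior.isClosed_compl.isCompact
  have hc := hR.continuous_cauchyRatio
  have hcp := hR.continuous_cauchyRatio_right p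
  obtain ⟨q₀, hq0, hq1, hq⟩ : ∃ q₀, 0 ≤ q₀ ∧ q₀ < 1 ∧
      ∀ y ∈ (interior W)ᶜ, R.cauchyRatio p y ≤ q₀ := by
    rcases (interior W)ᶜ.eq_empty_or_nonempty with he | hne
    · exact ⟨0, le_rfl, one_pos, fun y hy => by rw [he] at hy; exact hy.elim⟩
    · obtain ⟨y₀, hy₀, hmax⟩ := hK.exists_isMaxOn hne hcp.continuousOn
      have hne' : p ≠ y₀ := fun h => hy₀ (h ▸ mem_interior_iff_mem_nhds.2 hW)
      exact ⟨R.cauchyRatio p y₀, hR.cauchyRatio_nonneg p y₀, hS.cauchyRatio_lt_one hR hne',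
        fun y hy => hmax hy⟩
  -- The midpoint between `q₀` and 1 leaves room for moving from `p` to nearby `x`.
  refine ⟨(1 + q₀) / 2, by linarith, by linarith, ?_⟩
  have h1 := hK.eventually_forall_of_forall_eventually (x₀ := p)
    (P := fun x y => R.cauchyRatio x y ≤ (1 + q₀) / 2) fun y hy =>
      hc.continuousAt.eventually_le_const (by linarith [hq y hy])
  filter_upwards [h1] with x hx y hy
  exact hx y fun h => hy (interior_subset h)

theorem continuous_rpow_ratio (hR : R.IsPositive) (m : ℕ) :
    Continuous fun q : X × X => R.cauchyRatio q.1 q.2 ^ ((m : ℝ) / 20) :=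
  hR.continuous_cauchyRatio.rpow_const fun _ => Or.inr (by positivity)

variable [MeasurableSpace X]

theorem IsLocalModel.setIntegral_image [BorelSpace X] {ρ c C : ℝ} {W : Set X} {x : X}
    {κ : (Fin n → ℂ) → X} {g : (Fin n → ℂ) → ℝ} {T : (Fin n → ℂ) →L[ℂ] (Fin n → ℂ) →L[ℂ] ℂ}
    (h : IsLocalModel R P ρ c C W x κ g T) (hc : 0 < c) {G : Type*} [NormedAddCommGroup G]
    [NormedSpace ℝ G] [SecondCountableTopologyEither X G] {f : X → G} (hf : Continuous f) :
    ∫ y in κ '' Metric.closedBall 0 ρ, f y ∂(volumeForm R)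
      = ∫ w in Metric.closedBall (0 : Fin n → ℂ) ρ, g w • f (κ w) := by
  have hB : MeasurableSet (Metric.closedBall (0 : Fin n → ℂ) ρ) := Metric.isClosed_closedBall.measurableSet
  rw [h.volume_restrict, integral_map ((h.continuousOn.aemeasurable hB).mono_ac
    (withDensity_absolutelyContinuous _ _)) hf.aestronglyMeasurable,
    integral_withDensity_eq_integral_toReal_smul₀
      (h.continuousOn_density.aemeasurable hB).ennreal_ofReal
      (Eventually.of_forall fun _ => ENNReal.ofReal_lt_top)]
  refine setIntegral_congr_fun hB fun w hw => ?_
  rw [ENNReal.toReal_ofReal (hc.le.trans (h.density_lower w hw))]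

theorem IsLocalModel.log_ratio_lower {ρ c C : ℝ} {W : Set X} {x : X}
    {κ : (Fin n → ℂ) → X} {g : (Fin n → ℂ) → ℝ} {T : (Fin n → ℂ) →L[ℂ] (Fin n → ℂ) →L[ℂ] ℂ}
    (h : IsLocalModel R P ρ c C W x κ g T) (hC : 0 ≤ C) (hsmall : C * ρ ^ 2 ≤ c / 4)
    {w : Fin n → ℂ} (hw : w ∈ Metric.closedBall (0 : Fin n → ℂ) ρ) :
    3 / 4 * c * ‖w‖ ^ 2 ≤ -Real.log (R.cauchyRatio x (κ w)) := by
  have h1 := h.form_lower w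
  have hw' : ‖w‖ ≤ ρ := mem_closedBall_zero_iff.1 hw
  have h2 : C * ‖w‖ ^ 4 ≤ c / 4 * ‖w‖ ^ 2 := by
    calc C * ‖w‖ ^ 4 = C * ‖w‖ ^ 2 * ‖w‖ ^ 2 := by ring
      _ ≤ C * ρ ^ 2 * ‖w‖ ^ 2 := by gcongr
      _ ≤ _ := by gcongr
  have h3 := (abs_le.1 ((h.diastasis w hw).trans h2)).1
  linarith

theorem IsLocalModel.rpow_ratio {ρ c C : ℝ} {W : Set X} {x : X}
    {κ : (Fin n → ℂ) → X} {g : (Fin n → ℂ) → ℝ} {T : (Fin n → ℂ) →L[ℂ] (Fin n → ℂ) →L[ℂ] ℂ}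
    (h : IsLocalModel R P ρ c C W x κ g T) (m : ℕ)
    {w : Fin n → ℂ} (hw : w ∈ Metric.closedBall (0 : Fin n → ℂ) ρ) :
    R.cauchyRatio x (κ w) ^ ((m : ℝ) / 20)
      = Real.exp (-(1 / 20 * (m * -Real.log (R.cauchyRatio x (κ w))))) := by
  rw [Real.rpow_def_of_pos (h.ratio_pos w hw)]
  congr 1
  ring

theorem IsLocalModel.continuousOn_log_ratio (hR : R.IsPositive) {ρ c C : ℝ} {W : Set X} {x : X}
    {κ : (Fin n → ℂ) → X} {g : (Fin n → ℂ) → ℝ} {T : (Fin n → ℂ) →L[ℂ] (Fin n → ℂ) →L[ℂ] ℂ}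
    (h : IsLocalModel R P ρ c C W x κ g T) :
    ContinuousOn (fun w => -Real.log (R.cauchyRatio x (κ w))) (Metric.closedBall 0 ρ) :=
  (ContinuousOn.log ((hR.continuous_cauchyRatio_right x).comp_continuousOn h.continuousOn)
      fun w hw => (h.ratio_pos w hw).ne').neg

theorem IsLocalModel.density_upper {ρ c C : ℝ} {W : Set X} {x : X}
    {κ : (Fin n → ℂ) → X} {g : (Fin n → ℂ) → ℝ} {T : (Fin n → ℂ) →L[ℂ] (Fin n → ℂ) →L[ℂ] ℂ}
    (h : IsLocalModel R P ρ c C W x κ g T) (hc : 0 < c) (hC : 0 ≤ C)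
    {w : Fin n → ℂ} (hw : w ∈ Metric.closedBall (0 : Fin n → ℂ) ρ) :
    g w ≤ 2 * (C + C * ρ ^ 2) := by
  have h1 := (abs_le.1 (h.density w hw)).2
  have hw' : ‖w‖ ≤ ρ := mem_closedBall_zero_iff.1 hw
  have h2 : C * ‖w‖ ^ 2 ≤ C * ρ ^ 2 := by gcongr
  have h3 := h.det_le
  have h4 := mul_le_mul_of_nonneg_right (h.half_le_ratio w hw)
    (hc.le.trans (h.density_lower w hw))
  linarith

variable [BorelSpace X] [CompactSpace X] [IsManifold 𝓘(ℂ, Fin n → ℂ) ω X]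
  [ContMDiffVectorBundle ω ℂ L 𝓘(ℂ, Fin n → ℂ)]

/-- The row bound for Schur's test. Near `x` the ratio is at most a Gaussian, giving `m^{-n}`; off
the image of the ball it is at most `q`, and the exponential decay beats any power. -/
theorem exists_integral_ratio_le_of_localModel (hR : R.IsPositive) {ρ c C q : ℝ}
    (hρ : 0 < ρ) (hc : 0 < c) (hC : 0 ≤ C) (hsmall : C * ρ ^ 2 ≤ c / 4) (hq0 : 0 ≤ q) (hq1 : q < 1) :
    ∃ K ≥ 0, ∀ (P : HermitianAlgebraicFunction n E) (W : Set X) (x : X) (κ : (Fin n → ℂ) → X)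
      (g : (Fin n → ℂ) → ℝ) (T : (Fin n → ℂ) →L[ℂ] (Fin n → ℂ) →L[ℂ] ℂ),
      IsLocalModel R P ρ c C W x κ g T → (∀ y ∉ W, R.cauchyRatio x y ≤ q) → ∀ m : ℕ, 0 < m →
        ∫ y, R.cauchyRatio x y ^ ((m : ℝ) / 20) ∂(volumeForm R) ≤ K / (m : ℝ) ^ n := by
  have := isFiniteMeasure_volumeForm hR
  obtain ⟨K₁, hK₁, hball⟩ := exists_setIntegral_exp_le n (c := 3 / 4 * c) (by positivity) ρ
  obtain ⟨K₂, hK₂, hdecay⟩ := exists_rpow_decay hq0 hq1 n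
  set V := R.volumeForm.real Set.univ with hV
  refine ⟨2 * (C + C * ρ ^ 2) * K₁ + K₂ * V, by positivity, fun P W x κ g T h hqW m hm => ?_⟩
  set B := Metric.closedBall (0 : Fin n → ℂ) ρ with hB
  have hBc : IsCompact B := isCompact_closedBall _ _
  have hcont : Continuous fun y => R.cauchyRatio x y ^ ((m : ℝ) / 20) :=
    (hR.continuous_cauchyRatio_right x).rpow_const fun _ => Or.inr (by positivity)
  have hint : Integrable (fun y => R.cauchyRatio x y ^ ((m : ℝ) / 20)) R.volumeForm :=
    hcont.integrable_of_compactSpace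
  have hG : 0 ≤ 2 * (C + C * ρ ^ 2) := by positivity
  have hlog := h.continuousOn_log_ratio hR
  have i1 : ∫ w in B, g w • R.cauchyRatio x (κ w) ^ ((m : ℝ) / 20)
      ≤ 2 * (C + C * ρ ^ 2) * (K₁ / (m : ℝ) ^ n) := by
    refine le_trans ?_ (mul_le_mul_of_nonneg_left
      (hball m hm _ (fun w hw => h.log_ratio_lower hC hsmall hw) hlog) hG)
    rw [← integral_const_mul]
    refine setIntegral_mono_on ((h.continuousOn_density.smul
      (hcont.comp_continuousOn h.continuousOn)).integrableOn_compact hBc)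
      (ContinuousOn.integrableOn_compact hBc (continuousOn_const.mul
        (Real.continuous_exp.comp_continuousOn ((hlog.const_mul _).const_mul _).neg)))
      hBc.measurableSet fun w hw => ?_
    rw [h.rpow_ratio m hw, smul_eq_mul]
    exact mul_le_mul_of_nonneg_right (h.density_upper hc hC hw) (Real.exp_pos _).le
  have i2 : ∫ y in (κ '' B)ᶜ, R.cauchyRatio x y ^ ((m : ℝ) / 20) ∂(volumeForm R)
      ≤ K₂ / (m : ℝ) ^ n * V := by
    have h1 : ∫ y in (κ '' B)ᶜ, R.cauchyRatio x y ^ ((m : ℝ) / 20) ∂(volumeForm R)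
        ≤ ∫ _y in (κ '' B)ᶜ, q ^ ((m : ℝ) / 20) ∂(volumeForm R) := by
      refine setIntegral_mono_on hint.integrableOn (integrable_const _)
        h.measurableSet_image.compl fun y hy => ?_
      exact Real.rpow_le_rpow (hR.cauchyRatio_nonneg x y)
        (hqW y fun hyW => hy (h.subset_image hyW)) (by positivity)
    rw [setIntegral_const, smul_eq_mul, mul_comm] at h1
    refine h1.trans ?_
    gcongr
    · exact hdecay m hm
    · exact measureReal_mono (Set.subset_univ _)
  rw [← integral_add_compl h.measurableSet_image hint, h.setIntegral_image hc hcont]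
  refine (add_le_add i1 i2).trans_eq ?_
  ring

/-- On the image of the ball this is `exists_laplace_estimate` with `d = -log a` and `h = b g`; its
error term is rewritten intrinsically by `norm_sectionKernel`. The rest of `X` is absorbed in the
same error term, thanks to the decay of `a`. -/
theorem exists_integral_kernel_sub_le_of_localModel (hR : R.IsPositive) (hP : P.IsPositive)
    {ρ c C q : ℝ} (hρ : 0 < ρ) (hc : 0 < c) (hC : 0 ≤ C)
    (hsmall : C * ρ ^ 2 ≤ c / 4) (hq0 : 0 ≤ q) (hq1 : q < 1) :
    ∃ K ≥ 0, ∀ (W : Set X) (x : X) (κ : (Fin n → ℂ) → X)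
      (g : (Fin n → ℂ) → ℝ) (T : (Fin n → ℂ) →L[ℂ] (Fin n → ℂ) →L[ℂ] ℂ),
      IsLocalModel R P ρ c C W x κ g T → (∀ y ∉ W, R.cauchyRatio x y ≤ q) → ∀ m : ℕ, 0 < m →
        ∀ s : (∀ x : X, (⨂[ℂ]^m (L x)) ⊗[ℂ] E x), IsHolomorphicSection n s →
        ‖∫ y, sectionKernel R P s x y ∂(volumeForm R)
            - (Real.pi ^ n / (m : ℝ) ^ n : ℝ) * (pointNormSq R P s x : ℂ)‖
          ≤ K / m * (∫ y, Real.sqrt (pointNormSq R P s x) * Real.sqrt (pointNormSq R P s y)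
              * R.cauchyRatio x y ^ ((m : ℝ) / 20) ∂(volumeForm R))
            + K / (m : ℝ) ^ (n + 1) * pointNormSq R P s x := by
  have := isFiniteMeasure_volumeForm hR
  obtain ⟨K₁, hK₁, hlap⟩ := exists_laplace_estimate n hρ hc hC hC hsmall
  obtain ⟨K₂, hK₂, hdecay⟩ := exists_rpow_decay hq0 hq1 1
  -- No Cauchy–Schwarz inequality is available for `P`; compactness supplies an upper bound for its
  -- ratio.
  obtain ⟨b₁, hb₁⟩ : ∃ b₁, ∀ x y, P.cauchyRatio x y ≤ b₁ := by
    obtain ⟨b₁, hb₁⟩ := (isCompact_range hP.continuous_cauchyRatio).bddAbove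
    exact ⟨b₁, fun x y => hb₁ ⟨(x, y), rfl⟩⟩
  refine ⟨2 / c * K₁ + Real.sqrt b₁ * K₂ + K₁, by positivity,
    fun W x κ g T h hqW m hm s hs => ?_⟩
  set B := Metric.closedBall (0 : Fin n → ℂ) ρ with hB
  have hBc : IsCompact B := isCompact_closedBall _ _
  have hm0 : (0 : ℝ) < m := Nat.cast_pos.2 hm
  obtain ⟨F, hFa, hF0, hF⟩ := h.kernel m s hs
  have hFc : ContinuousOn F B := fun w hw => (hFa w hw).continuousAt.continuousWithinAt
  have hlog := h.continuousOn_log_ratio hR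
  set a : X → ℝ := R.cauchyRatio x with ha
  set b : X → ℝ := P.cauchyRatio x with hb
  set v : X → ℝ := fun y => Real.sqrt (pointNormSq R P s x) * Real.sqrt (pointNormSq R P s y)
    * a y ^ ((m : ℝ) / 20) with hv
  have hac : Continuous a := hR.continuous_cauchyRatio_right x
  have hbc : Continuous b := hP.continuous_cauchyRatio_right x
  have ha0 : ∀ y, 0 ≤ a y := hR.cauchyRatio_nonneg x
  have hvc : Continuous v := (continuous_const.mul
    (continuous_pointNormSq hR hP hs).sqrt).mul
      (hac.rpow_const fun _ => Or.inr (by positivity))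
  have hv0 : ∀ y, 0 ≤ v y := fun y => mul_nonneg (mul_nonneg (Real.sqrt_nonneg _)
    (Real.sqrt_nonneg _)) (Real.rpow_nonneg (ha0 y) _)
  have hvi : Integrable v R.volumeForm := hvc.integrable_of_compactSpace
  have hkc : Continuous (sectionKernel R P s x) :=
    Continuous.uncurry_left (f := sectionKernel R P s) x (continuous_sectionKernel hR hP hs)
  have hki : Integrable (sectionKernel R P s x) R.volumeForm := hkc.integrable_of_compactSpace
  have hexp : ∀ w ∈ B, ∀ j : ℕ, Real.exp (-(j * -Real.log (a (κ w)))) = a (κ w) ^ j :=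
    fun w hw j => by
      rw [mul_neg, neg_neg, Real.exp_nat_mul, Real.exp_log (h.ratio_pos w hw)]
  have hlocal : ∫ y in κ '' B, sectionKernel R P s x y ∂(volumeForm R)
      = ∫ w in B, F w * (Real.exp (-(m * -Real.log (a (κ w)))) * (b (κ w) * g w) : ℝ) := by
    rw [h.setIntegral_image hc hkc]
    refine setIntegral_congr_fun hBc.measurableSet fun w hw => ?_
    rw [hF w hw, hexp w hw m, Complex.real_smul]
    push_cast
    ring
  -- Split 11/20 = 1/2 + 1/20. The half combines with `‖F w‖` into the product of pointwise norms,
  -- at a factor 2 because `√b ≥ 1/2`; the bound `c ≤ g` replaces Lebesgue measure by the volume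
  -- form.
  have hbound : ∀ w ∈ B, ‖F w‖ * Real.exp (-(11 / 20 * (m * -Real.log (a (κ w)))))
      ≤ 2 / c * (g w • v (κ w)) := by
    intro w hw
    have haw := h.ratio_pos w hw
    have hbw := h.half_le_ratio w hw
    have hgw := h.density_lower w hw
    have hab : 0 < a (κ w) ^ m * b (κ w) := mul_pos (pow_pos haw m) (by linarith [hbw])
    have h1 := norm_sectionKernel s hR hP x (κ w)
    rw [hF w hw, norm_mul, Complex.norm_real, Real.norm_of_nonneg hab.le] at h1
    have h2 : ‖F w‖ * Real.sqrt (a (κ w) ^ m * b (κ w))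
        = Real.sqrt (pointNormSq R P s x) * Real.sqrt (pointNormSq R P s (κ w)) := by
      have h3 : Real.sqrt (a (κ w) ^ m * b (κ w)) ≠ 0 := (Real.sqrt_pos.2 hab).ne'
      refine mul_right_cancel₀ h3 ?_
      rw [mul_assoc, Real.mul_self_sqrt hab.le, h1]
    have h4 : Real.exp (-(11 / 20 * (m * -Real.log (a (κ w)))))
        = Real.sqrt (a (κ w) ^ m) * a (κ w) ^ ((m : ℝ) / 20) := by
      rw [Real.sqrt_eq_rpow, ← Real.rpow_natCast, ← Real.rpow_mul haw.le, ← Real.rpow_add haw,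
        Real.rpow_def_of_pos haw]
      congr 1
      ring
    have h5 : Real.sqrt (a (κ w) ^ m) ≤ 2 * Real.sqrt (a (κ w) ^ m * b (κ w)) := by
      rw [Real.sqrt_mul (pow_pos haw m).le]
      have h6 : 1 / 2 ≤ Real.sqrt (b (κ w)) := by
        refine Real.le_sqrt_of_sq_le ?_
        exact (by norm_num : ((1 : ℝ) / 2) ^ 2 ≤ 1 / 2).trans hbw
      nlinarith [Real.sqrt_nonneg (a (κ w) ^ m)]
    have h7 : 1 ≤ g w / c := (one_le_div hc).2 hgw
    calc _ ≤ ‖F w‖ * (2 * Real.sqrt (a (κ w) ^ m * b (κ w)) * a (κ w) ^ ((m : ℝ) / 20)) := by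
          rw [h4]
          gcongr
      _ = 2 * ((‖F w‖ * Real.sqrt (a (κ w) ^ m * b (κ w))) * a (κ w) ^ ((m : ℝ) / 20)) := by ring
      _ = 1 * (2 * v (κ w)) := by rw [h2, one_mul]
      _ ≤ g w / c * (2 * v (κ w)) := by
          have := hv0 (κ w)
          gcongr
      _ = _ := by
          rw [smul_eq_mul]
          ring
  have hint : ∫ w in B, ‖F w‖ * Real.exp (-(11 / 20 * (m * -Real.log (a (κ w)))))
      ≤ 2 / c * ∫ y, v y ∂(volumeForm R) := by
    refine le_trans ?_ (mul_le_mul_of_nonneg_left (setIntegral_le_integral (s := κ '' B) hvi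
      (Eventually.of_forall hv0)) (by positivity))
    rw [h.setIntegral_image hc hvc, ← integral_const_mul]
    refine setIntegral_mono_on (ContinuousOn.integrableOn_compact hBc (hFc.norm.mul
      (Real.continuous_exp.comp_continuousOn ((hlog.const_mul _).const_mul _).neg)))
      (ContinuousOn.integrableOn_compact hBc (continuousOn_const.mul
        (h.continuousOn_density.smul (hvc.comp_continuousOn h.continuousOn))))
      hBc.measurableSet hbound
  have hmain := hlap m hm T F (fun w => -Real.log (a (κ w))) (fun w => b (κ w) * g w) h.posDef
    h.form_lower h.det_le hFa hlog ((hbc.comp_continuousOn h.continuousOn).mul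
      h.continuousOn_density) h.diastasis h.density
  have hoff : ‖∫ y in (κ '' B)ᶜ, sectionKernel R P s x y ∂(volumeForm R)‖
      ≤ Real.sqrt b₁ * K₂ / m * ∫ y, v y ∂(volumeForm R) := by
    have h1 : ‖∫ y in (κ '' B)ᶜ, sectionKernel R P s x y ∂(volumeForm R)‖
        ≤ ∫ y in (κ '' B)ᶜ, Real.sqrt b₁ * K₂ / m * v y ∂(volumeForm R) := by
      refine norm_integral_le_of_norm_le (hvi.integrableOn.const_mul _) ?_
      refine (ae_restrict_iff' h.measurableSet_image.compl).2 (Eventually.of_forall fun y hy => ?_)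
      have hay := ha0 y
      have haq : a y ≤ q := hqW y fun hyW => hy (h.subset_image hyW)
      -- Of the exponent `m / 2` only two shares of `m / 20` are used: one remains as the Schur
      -- kernel, the other supplies the factor `1 / m`.
      have h2 : Real.sqrt (a y ^ m) ≤ a y ^ ((m : ℝ) / 20) * (K₂ / m) := by
        have h3 : a y ^ ((m : ℝ) / 20) ≤ K₂ / m := by
          refine (Real.rpow_le_rpow hay haq (by positivity)).trans ?_
          simpa using hdecay m hm
        calc Real.sqrt (a y ^ m) = a y ^ ((m : ℝ) / 2) := by
              rw [Real.sqrt_eq_rpow, ← Real.rpow_natCast, ← Real.rpow_mul hay]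
              congr 1
              ring
          _ ≤ a y ^ ((m : ℝ) / 20 + (m : ℝ) / 20) := by
              refine Real.rpow_le_rpow_of_exponent_ge_of_imp hay (haq.trans hq1.le) (by linarith) ?_
              intro _ h0
              exact absurd h0 (by positivity)
          _ = a y ^ ((m : ℝ) / 20) * a y ^ ((m : ℝ) / 20) :=
              Real.rpow_add_of_nonneg hay (by positivity) (by positivity)
          _ ≤ _ := by gcongr
      rw [norm_sectionKernel s hR hP x y, Real.sqrt_mul (pow_nonneg hay m)]
      calc _ ≤ Real.sqrt (pointNormSq R P s x) * Real.sqrt (pointNormSq R P s y)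
            * (a y ^ ((m : ℝ) / 20) * (K₂ / m) * Real.sqrt b₁) := by
            gcongr
            exact hb₁ x y
        _ = _ := by
            simp only [hv]
            ring
    refine h1.trans ?_
    rw [integral_const_mul]
    exact mul_le_mul_of_nonneg_left (setIntegral_le_integral hvi (Eventually.of_forall hv0))
      (by positivity)
  have hux := pointNormSq_nonneg s hR hP x
  have hvI : 0 ≤ ∫ y, v y ∂(volumeForm R) := integral_nonneg hv0
  rw [← integral_add_compl h.measurableSet_image hki, hlocal, add_sub_right_comm]
  rw [hF0, Complex.norm_real, Real.norm_of_nonneg hux] at hmain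
  refine (norm_add_le _ _).trans ((add_le_add hmain hoff).trans ?_)
  have e1 : K₁ / m * (∫ w in B, ‖F w‖ * Real.exp (-(11 / 20 * (m * -Real.log (a (κ w))))))
      ≤ K₁ / m * (2 / c * ∫ y, v y ∂(volumeForm R)) :=
    mul_le_mul_of_nonneg_left hint (by positivity)
  have e2 : (2 / c * K₁ + Real.sqrt b₁ * K₂) / m * (∫ y, v y ∂(volumeForm R))
      ≤ (2 / c * K₁ + Real.sqrt b₁ * K₂ + K₁) / m * (∫ y, v y ∂(volumeForm R)) :=
    mul_le_mul_of_nonneg_right (div_le_div_of_nonneg_right (by linarith) hm0.le) hvI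
  have e3 : K₁ / (m : ℝ) ^ (n + 1) * pointNormSq R P s x
      ≤ (2 / c * K₁ + Real.sqrt b₁ * K₂ + K₁) / (m : ℝ) ^ (n + 1) * pointNormSq R P s x := by
    refine mul_le_mul_of_nonneg_right (div_le_div_of_nonneg_right ?_ (by positivity)) hux
    have : 0 ≤ 2 / c * K₁ + Real.sqrt b₁ * K₂ := by positivity
    linarith
  refine (add_le_add (add_le_add e1 le_rfl) le_rfl).trans ((add_le_add e2 e3).trans' (le_of_eq ?_))
  ring

theorem exists_pointwise_estimate [ContMDiffVectorBundle ω ℂ E 𝓘(ℂ, Fin n → ℂ)] (hR : R.IsPositive) (hP : P.IsPositive) (hS : R.SGCS) (p : X) :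
    ∃ K ≥ 0, ∀ᶠ x in 𝓝 p, ∀ m : ℕ, 0 < m →
      ∫ y, R.cauchyRatio x y ^ ((m : ℝ) / 20) ∂(volumeForm R) ≤ K / (m : ℝ) ^ n ∧
      ∀ s : (∀ x : X, (⨂[ℂ]^m (L x)) ⊗[ℂ] E x), IsHolomorphicSection n s →
        ‖∫ y, sectionKernel R P s x y ∂(volumeForm R)
            - (Real.pi ^ n / (m : ℝ) ^ n : ℝ) * (pointNormSq R P s x : ℂ)‖
          ≤ K / m * (∫ y, Real.sqrt (pointNormSq R P s x) * Real.sqrt (pointNormSq R P s y)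
              * R.cauchyRatio x y ^ ((m : ℝ) / 20) ∂(volumeForm R))
            + K / (m : ℝ) ^ (n + 1) * pointNormSq R P s x := by
  obtain ⟨ρ, c, C, hρ, hc, hC, hsmall, W, hW, hmodel⟩ := exists_localModel hR hP hS p
  obtain ⟨q, hq0, hq1, hq⟩ := exists_cauchyRatio_le_of_notMem hR hS hW
  obtain ⟨K₁, hK₁, h₁⟩ := exists_integral_ratio_le_of_localModel (E := E) hR hρ hc hC hsmall hq0 hq1
  obtain ⟨K₂, hK₂, h₂⟩ :=
    exists_integral_kernel_sub_le_of_localModel hR hP hρ hc hC hsmall hq0 hq1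
  refine ⟨max K₁ K₂, hK₁.trans (le_max_left _ _), ?_⟩
  filter_upwards [hmodel, hq] with x hx hqx m hm
  obtain ⟨κ, g, T, h⟩ := hx
  refine ⟨(h₁ P W x κ g T h hqx m hm).trans ?_, fun s hs => (h₂ W x κ g T h hqx m hm s hs).trans ?_⟩
  · gcongr
    exact le_max_left _ _
  · have h3 : 0 ≤ ∫ y, Real.sqrt (pointNormSq R P s x) * Real.sqrt (pointNormSq R P s y)
        * R.cauchyRatio x y ^ ((m : ℝ) / 20) ∂(volumeForm R) :=
      integral_nonneg fun y => mul_nonneg (mul_nonneg (Real.sqrt_nonneg _) (Real.sqrt_nonneg _))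
        (Real.rpow_nonneg (hR.cauchyRatio_nonneg x y) _)
    exact add_le_add (mul_le_mul_of_nonneg_right
      (div_le_div_of_nonneg_right (le_max_right _ _) (Nat.cast_nonneg _)) h3)
      (mul_le_mul_of_nonneg_right (div_le_div_of_nonneg_right (le_max_right _ _) (by positivity))
        (pointNormSq_nonneg s hR hP x))

end PointwiseEstimates

/-! ### The global estimate -/

section GlobalEstimate

open HermitianAlgebraicFunction

variable {n : ℕ} {X : Type*} [TopologicalSpace X] [ChartedSpace (Fin n → ℂ) X]
  {L : X → Type*}
  [∀ x, AddCommGroup (L x)] [∀ x, Module ℂ (L x)] [∀ x, TopologicalSpace (L x)]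
  [TopologicalSpace (TotalSpace ℂ L)] [FiberBundle ℂ L] [VectorBundle ℂ ℂ L]
  {E : X → Type*}
  [∀ x, AddCommGroup (E x)] [∀ x, Module ℂ (E x)] [∀ x, TopologicalSpace (E x)]
  [TopologicalSpace (TotalSpace ℂ E)] [FiberBundle ℂ E] [VectorBundle ℂ ℂ E]
  {R : HermitianAlgebraicFunction n L} {P : HermitianAlgebraicFunction n E}
  [MeasurableSpace X]

theorem sectionNorm_sq (hR : R.IsPositive) (hP : P.IsPositive) {m : ℕ} (Ω : Measure X)
    (s : ∀ x : X, (⨂[ℂ]^m (L x)) ⊗[ℂ] E x) :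
    sectionNorm R P Ω s ^ 2 = ∫ x, pointNormSq R P s x ∂Ω := by
  rw [sectionNorm, sectionInner_self_eq, Complex.ofReal_re,
    Real.sq_sqrt (integral_nonneg (pointNormSq_nonneg s hR hP))]

variable [BorelSpace X] [CompactSpace X] [IsManifold 𝓘(ℂ, Fin n → ℂ) ω X]
  [ContMDiffVectorBundle ω ℂ L 𝓘(ℂ, Fin n → ℂ)]

theorem exists_uniform_estimate [ContMDiffVectorBundle ω ℂ E 𝓘(ℂ, Fin n → ℂ)]
    (hR : R.IsPositive) (hP : P.IsPositive) (hS : R.SGCS) :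
    ∃ K ≥ 0, ∀ (x : X) (m : ℕ), 0 < m →
      ∫ y, R.cauchyRatio x y ^ ((m : ℝ) / 20) ∂(volumeForm R) ≤ K / (m : ℝ) ^ n ∧
      ∀ s : (∀ x : X, (⨂[ℂ]^m (L x)) ⊗[ℂ] E x), IsHolomorphicSection n s →
        ‖∫ y, sectionKernel R P s x y ∂(volumeForm R)
            - (Real.pi ^ n / (m : ℝ) ^ n : ℝ) * (pointNormSq R P s x : ℂ)‖
          ≤ K / m * (∫ y, Real.sqrt (pointNormSq R P s x) * Real.sqrt (pointNormSq R P s y)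
              * R.cauchyRatio x y ^ ((m : ℝ) / 20) ∂(volumeForm R))
            + K / (m : ℝ) ^ (n + 1) * pointNormSq R P s x := by
  choose K hK hest using exists_pointwise_estimate hR hP hS
  obtain ⟨t, ht⟩ := CompactSpace.elim_nhds_subcover _ hest
  -- The sum over the finite cover dominates each constant, without any need for the cover to be
  -- nonempty.
  refine ⟨∑ p ∈ t, K p, Finset.sum_nonneg fun p _ => hK p, fun x m hm => ?_⟩
  have hx : x ∈ (⊤ : Set X) := trivial
  rw [← ht] at hx
  simp only [Set.mem_iUnion] at hx
  obtain ⟨p, hp, hx⟩ := hx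
  have hle : K p ≤ ∑ p ∈ t, K p := Finset.single_le_sum (fun p _ => hK p) hp
  obtain ⟨h1, h2⟩ := hx m hm
  refine ⟨h1.trans (div_le_div_of_nonneg_right hle (by positivity)), fun s hs =>
    (h2 s hs).trans ?_⟩
  have h3 : 0 ≤ ∫ y, Real.sqrt (pointNormSq R P s x) * Real.sqrt (pointNormSq R P s y)
      * R.cauchyRatio x y ^ ((m : ℝ) / 20) ∂(volumeForm R) :=
    integral_nonneg fun y => mul_nonneg (mul_nonneg (Real.sqrt_nonneg _) (Real.sqrt_nonneg _))
      (Real.rpow_nonneg (hR.cauchyRatio_nonneg x y) _)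
  exact add_le_add (mul_le_mul_of_nonneg_right
    (div_le_div_of_nonneg_right hle (Nat.cast_nonneg _)) h3)
    (mul_le_mul_of_nonneg_right (div_le_div_of_nonneg_right hle (by positivity))
      (pointNormSq_nonneg s hR hP x))

/-- Schur's test for the kernel `|R(x, ȳ)|² / (R(x, x̄) R(y, ȳ))` raised to a power. -/
theorem integral_integral_sqrt_mul_ratio_le [SecondCountableTopology X] (hR : R.IsPositive) {m : ℕ}
    {u : X → ℝ} (hu : Continuous u) (hu0 : ∀ x, 0 ≤ u x) {A : ℝ}
    (hA : ∀ x, ∫ y, R.cauchyRatio x y ^ ((m : ℝ) / 20) ∂(volumeForm R) ≤ A) :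
    ∫ x, ∫ y, Real.sqrt (u x) * Real.sqrt (u y) * R.cauchyRatio x y ^ ((m : ℝ) / 20)
      ∂(volumeForm R) ∂(volumeForm R) ≤ A * ∫ x, u x ∂(volumeForm R) := by
  have := isFiniteMeasure_volumeForm hR
  set Ω := volumeForm R with hΩ
  set f : X → X → ℝ := fun x y => R.cauchyRatio x y ^ ((m : ℝ) / 20) with hf
  have hfc : Continuous fun q : X × X => f q.1 q.2 := continuous_rpow_ratio hR m
  have hf0 : ∀ x y, 0 ≤ f x y := fun x y => Real.rpow_nonneg (hR.cauchyRatio_nonneg x y) _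
  have hu1 : Continuous fun q : X × X => u q.1 := hu.comp continuous_fst
  have hu2 : Continuous fun q : X × X => u q.2 := hu.comp continuous_snd
  have i1 : Integrable (fun q : X × X => u q.1 / 2 * f q.1 q.2) (Ω.prod Ω) :=
    ((hu1.div_const 2).mul hfc).integrable_of_compactSpace
  have i2 : Integrable (fun q : X × X => u q.2 / 2 * f q.1 q.2) (Ω.prod Ω) :=
    ((hu2.div_const 2).mul hfc).integrable_of_compactSpace
  have i0 : Integrable (fun q : X × X => Real.sqrt (u q.1) * Real.sqrt (u q.2) * f q.1 q.2)
      (Ω.prod Ω) := ((hu1.sqrt.mul hu2.sqrt).mul hfc).integrable_of_compactSpace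
  have iu : Integrable u Ω := hu.integrable_of_compactSpace
  have h1 : ∫ x, ∫ y, u x / 2 * f x y ∂Ω ∂Ω ≤ A / 2 * ∫ x, u x ∂Ω := by
    rw [← integral_const_mul]
    refine integral_mono i1.integral_prod_left (iu.const_mul _) fun x => ?_
    simp only [integral_const_mul]
    have := mul_le_mul_of_nonneg_left (hA x) (div_nonneg (hu0 x) zero_le_two)
    exact this.trans_eq (by ring)
  -- The ratio is symmetric, so column integrals are row integrals and the single bound `hA` serves
  -- for both.
  have h2 : ∫ x, ∫ y, u y / 2 * f x y ∂Ω ∂Ω = ∫ x, ∫ y, u x / 2 * f x y ∂Ω ∂Ω := by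
    rw [integral_integral_swap i2]
    simp only [hf, R.cauchyRatio_comm]
  have h3 : ∫ q : X × X, Real.sqrt (u q.1) * Real.sqrt (u q.2) * f q.1 q.2 ∂(Ω.prod Ω)
      ≤ ∫ q : X × X, (u q.1 / 2 * f q.1 q.2 + u q.2 / 2 * f q.1 q.2) ∂(Ω.prod Ω) := by
    refine integral_mono i0 (i1.add i2) fun q => ?_
    -- The arithmetic–geometric mean inequality separates the two variables, the core of Schur's
    -- test.
    have h4 : Real.sqrt (u q.1) * Real.sqrt (u q.2) ≤ u q.1 / 2 + u q.2 / 2 := by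
      have := two_mul_le_add_sq (Real.sqrt (u q.1)) (Real.sqrt (u q.2))
      rw [Real.sq_sqrt (hu0 _), Real.sq_sqrt (hu0 _)] at this
      linarith
    simp only [← add_mul]
    exact mul_le_mul_of_nonneg_right h4 (hf0 _ _)
  rw [integral_prod _ i0, integral_add i1 i2, integral_prod _ i1, integral_prod _ i2, h2] at h3
  refine h3.trans ((add_le_add h1 h1).trans_eq ?_)
  ring

end GlobalEstimate

end

/-! ### Integration of the pointwise estimate over X. -/

theorem theorem1p1 (n : ℕ)
    {X : Type*} [TopologicalSpace X] [T2Space X] [CompactSpace X]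
    [ChartedSpace (Fin n → ℂ) X] [IsManifold 𝓘(ℂ, Fin n → ℂ) ω X]
    [MeasurableSpace X] [BorelSpace X]
    (L : X → Type*)
    [∀ x, AddCommGroup (L x)] [∀ x, Module ℂ (L x)] [∀ x, TopologicalSpace (L x)]
    [TopologicalSpace (TotalSpace ℂ L)] [FiberBundle ℂ L] [VectorBundle ℂ ℂ L]
    [ContMDiffVectorBundle ω ℂ L 𝓘(ℂ, Fin n → ℂ)]
    (E : X → Type*)
    [∀ x, AddCommGroup (E x)] [∀ x, Module ℂ (E x)] [∀ x, TopologicalSpace (E x)]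
    [TopologicalSpace (TotalSpace ℂ E)] [FiberBundle ℂ E] [VectorBundle ℂ ℂ E]
    [ContMDiffVectorBundle ω ℂ E 𝓘(ℂ, Fin n → ℂ)]
    (R : HermitianAlgebraicFunction n L) (P : HermitianAlgebraicFunction n E)
    (hR : R.IsPositive) (hP : P.IsPositive) (hSGCS : R.SGCS) :
    ∃ C : ℝ, 0 < C ∧ ∀ m : ℕ, 0 < m →
      ∀ s : (∀ x : X, (⨂[ℂ]^m (L x)) ⊗[ℂ] E x), IsHolomorphicSection n s →
        ‖integralForm R P R.volumeForm s s
            - ((Real.pi ^ n / (m : ℝ) ^ n * sectionNorm R P R.volumeForm s ^ 2 : ℝ) : ℂ)‖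
          ≤ C / (m : ℝ) ^ (n + 1) * sectionNorm R P R.volumeForm s ^ 2 := by
  have := HermitianAlgebraicFunction.isFiniteMeasure_volumeForm hR
  -- Second countability makes the product σ-algebra on `X × X` the Borel one, so that continuous
  -- integrands are measurable.
  have : SecondCountableTopology X := ChartedSpace.secondCountable_of_sigmaCompact (Fin n → ℂ) X
  obtain ⟨K, hK, hest⟩ := exists_uniform_estimate hR hP hSGCS
  -- `K ^ 2` arises from the row bound inside the weighted error term, `K` from the pointwise error
  -- term, and 1 ensures strict positivity.
  refine ⟨K ^ 2 + K + 1, by positivity, fun m hm s hs => ?_⟩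
  have hm0 : (0 : ℝ) < m := Nat.cast_pos.2 hm
  set Ω := R.volumeForm with hΩ
  set u : X → ℝ := pointNormSq R P s with hu
  have huc : Continuous u := continuous_pointNormSq hR hP hs
  have hu0 : ∀ x, 0 ≤ u x := pointNormSq_nonneg s hR hP
  have iu : Integrable u Ω := huc.integrable_of_compactSpace
  have hS0 : 0 ≤ ∫ x, u x ∂Ω := integral_nonneg hu0
  set v : X → X → ℝ := fun x y => Real.sqrt (u x) * Real.sqrt (u y)
    * R.cauchyRatio x y ^ ((m : ℝ) / 20) with hv
  have iv : Integrable (fun q : X × X => v q.1 q.2) (Ω.prod Ω) :=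
    (((huc.comp continuous_fst).sqrt.mul (huc.comp continuous_snd).sqrt).mul
      (continuous_rpow_ratio hR m)).integrable_of_compactSpace
  have ik : Integrable (fun q : X × X => sectionKernel R P s q.1 q.2) (Ω.prod Ω) :=
    (continuous_sectionKernel hR hP hs).integrable_of_compactSpace
  have hform : integralForm R P Ω s s = ∫ x, ∫ y, sectionKernel R P s x y ∂Ω ∂Ω :=
    integral_prod _ ik
  have hnorm : ((Real.pi ^ n / (m : ℝ) ^ n * ∫ x, u x ∂Ω : ℝ) : ℂ)
      = ∫ x, (Real.pi ^ n / (m : ℝ) ^ n : ℝ) * (u x : ℂ) ∂Ω := by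
    rw [integral_const_mul, integral_complex_ofReal, Complex.ofReal_mul]
  have hschur : ∫ x, ∫ y, v x y ∂Ω ∂Ω ≤ K / (m : ℝ) ^ n * ∫ x, u x ∂Ω :=
    integral_integral_sqrt_mul_ratio_le hR huc hu0 fun x => (hest x m hm).1
  have ik1 : Integrable (fun x => ∫ y, sectionKernel R P s x y ∂Ω) Ω := ik.integral_prod_left
  have iv1 : Integrable (fun x => ∫ y, v x y ∂Ω) Ω := iv.integral_prod_left
  have iu1 : Integrable (fun x => (Real.pi ^ n / (m : ℝ) ^ n : ℝ) * (u x : ℂ)) Ω :=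
    iu.ofReal.const_mul _
  rw [sectionNorm_sq hR hP, hform, hnorm, ← integral_sub ik1 iu1]
  have hle : ‖∫ x, ((∫ y, sectionKernel R P s x y ∂Ω)
      - (Real.pi ^ n / (m : ℝ) ^ n : ℝ) * (u x : ℂ)) ∂Ω‖
      ≤ ∫ x, (K / m * (∫ y, v x y ∂Ω) + K / (m : ℝ) ^ (n + 1) * u x) ∂Ω :=
    norm_integral_le_of_norm_le ((iv1.const_mul _).add (iu.const_mul _))
      (ae_of_all _ fun x => (hest x m hm).2 s hs)
  rw [integral_add (iv1.const_mul _) (iu.const_mul _), integral_const_mul,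
    integral_const_mul] at hle
  refine hle.trans ?_
  calc K / m * (∫ x, ∫ y, v x y ∂Ω ∂Ω) + K / (m : ℝ) ^ (n + 1) * ∫ x, u x ∂Ω
      ≤ K / m * (K / (m : ℝ) ^ n * ∫ x, u x ∂Ω) + K / (m : ℝ) ^ (n + 1) * ∫ x, u x ∂Ω :=
        add_le_add (mul_le_mul_of_nonneg_left hschur (by positivity)) le_rfl
    _ = (K ^ 2 + K) / (m : ℝ) ^ (n + 1) * ∫ x, u x ∂Ω := by
        rw [pow_succ]
        field_simp
    _ ≤ (K ^ 2 + K + 1) / (m : ℝ) ^ (n + 1) * ∫ x, u x ∂Ω :=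
        mul_le_mul_of_nonneg_right (div_le_div_of_nonneg_right (by linarith) (by positivity)) hS0
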